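/- Let $0<c_3<1/27$. There is a unique pair of half-periods $\omega_1=\omega_1(c_3)\in\mathbb R_{>0}$, $\omega_2=\omega_2(c_3)\in i\,\mathbb R_{>0}$ such that the lattice $2\Omega=2\mathbb Z\omega_1+2\mathbb Z\omega_2$ has Weierstrass invariants $$g_2=\tfrac1{12}-2c_3,\qquad g_3=\tfrac{c_3}{6}-\tfrac1{216}-c_3^2 .$$ Let $\wp$ and $\zeta$ be the Weierstrass functions of $2\Omega$, let $\eta_i=\zeta(\omega_i)$, and for $s\in\mathbb R$ put $$y^k(s)=\frac{c_3}{\frac1{12}-\wp\bigl(\omega_2+\frac{\omega_1}{\pi}(s+\frac{2\pi k}{3})\bigr)}\quad(k=1,2,3),\qquad \varsigma(s)=\zeta\Bigl(\omega_2+\frac{s\,\omega_1}{\pi}\Bigr)-\eta_2-\frac{s}{\pi}\,\eta_1 .$$ Then $\varsigma(s)$ and the $y^k(s)$ are real, $y^k(s)>0$, $y^1+y^2+y^3=1$ and $y^1y^2y^3=c_3$. On $\mathbb{CP}^2$ let $(z_1,z_2)\mapsto[z_1:z_2:1]$ be the standard affine chart, with the standard complex structure $J$ (multiplication by $i$), let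 $y^k=|Z_k|^2/\sum_j|Z_j|^2$ be the components of the moment map, let $\sigma=i z_1z_2\,\partial_{z_1}\wedge\partial_{z_2}$ be the toric invariant holomorphic Poisson tensor, and let $Q=4\operatorname{Im}\sigma$ be the Hitchin Poisson tensor. The formulae $$z_k=\bigl(y^k(s)/y^3(s)\bigr)^{1/2}e^{i\theta_k},\qquad k=1,2,$$ define smooth local coordinates $(c_3,s,\theta_1,\theta_2)$, with $s,\theta_1,\theta_2$ each determined modulo $2\pi$, on the open set $\{0<y^1y^2y^3<1/27\}$ of $\mathbb{CP}^2$, and the moment map is given by $y^k=y^k(s)$. In these coordinates $$Q=\frac{4c_3\pi}{\omega_1}\,\partial_{c_3}\wedge\partial_s-\partial_{\theta_1}\wedge\partial_{\theta_2},$$ and the components $J^a{}_b=\langle da,J\partial_b\rangle$ of the standard complex structure are $$\begin{pmatrix}J^{\theta_1}{}_s\\ J^{\theta_2}{}_s\end{pmatrix}=\frac{\omega_1}{2\pi}\begin{pmatrix}3y^2-1\\ 1-3y^1\end{pmatrix},\qquad \bigl(J^{c_3}{}_{\theta_1}\ \ J^{c_3}{}_{\theta_2}\bigr)=\frac{4\pi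 c_3}{\omega_1}\bigl(-J^{\theta_2}{}_s\ \ J^{\theta_1}{}_s\bigr),$$ $$\begin{pmatrix}J^{\theta_1}{}_{c_3}\\ J^{\theta_2}{}_{c_3}\end{pmatrix}=\frac{1}{4c_3(1-27c_3)}\begin{pmatrix}1+3y^2-18y^1y^2-6\varsigma(s)(1-3y^2)\\ 1+3y^1-18y^1y^2+6\varsigma(s)(1-3y^1)\end{pmatrix},\qquad \bigl(J^{s}{}_{\theta_1}\ \ J^{s}{}_{\theta_2}\bigr)=\frac{4\pi c_3}{\omega_1}\bigl(J^{\theta_2}{}_{c_3}\ \ -J^{\theta_1}{}_{c_3}\bigr),$$ all other components (those within the pair $c_3,s$ and those within the pair $\theta_1,\theta_2$) being zero. Finally $(c_3,s)\mapsto(y^1,y^2)$ is a local diffeomorphism, and the Jacobian determinant of its local inverses is $$\frac{\partial(c_3,s)}{\partial(y^1,y^2)}=\frac{\pi}{\omega_1}.$$ -/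

import Mathlib

open Real Set
open scoped Manifold ContDiff LinearAlgebra.Projectivization

noncomputable section

namespace HitchinCP2

/-! ### Elliptic functions of a rectangular lattice -/

/-- Pairs `(a, b)` of positive reals, standing for the half-periods `a` and `b * I`. -/
abbrev HalfPeriods : Type := {p : ℝ × ℝ // 0 < p.1 ∧ 0 < p.2}

/-- The rectangular period lattice generated by `2 * a` and `2 * b * I`. -/
def HalfPeriods.lattice (p : HalfPeriods) : PeriodPair where
  ω₁ := 2 * (p.1.1 : ℂ)
  ω₂ := 2 * ((p.1.2 : ℂ) * Complex.I)
  indep := by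
    rw [LinearIndependent.pair_iff]
    intro s t h
    have hre := congrArg Complex.re h
    have him := congrArg Complex.im h
    have h1 := p.2.1
    have h2 := p.2.2
    simp at hre him
    exact ⟨hre.resolve_right h1.ne', him.resolve_right h2.ne'⟩

/-- The lattice of `p` has the Weierstrass invariants
`g₂ = 1/12 - 2c` and `g₃ = c/6 - 1/216 - c²`. -/
def IsHalfPeriods (c : ℝ) (p : HalfPeriods) : Prop :=
  p.lattice.g₂ = 1 / 12 - 2 * (c : ℂ) ∧
    p.lattice.g₃ = (c : ℂ) / 6 - 1 / 216 - (c : ℂ) ^ 2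

instance : Nonempty HalfPeriods := ⟨⟨(1, 1), one_pos, one_pos⟩⟩

/-- The half-periods belonging to `c` (their existence and uniqueness for `0 < c < 1/27` is part of
the theorem; outside that interval the value is irrelevant). -/
def halfPeriods (c : ℝ) : HalfPeriods := Classical.epsilon (IsHalfPeriods c)

/-- The period lattice `2Ω` belonging to `c`. -/
def lat (c : ℝ) : PeriodPair := (halfPeriods c).lattice

/-- The real half-period `ω₁ > 0`. -/
def omega1 (c : ℝ) : ℝ := (halfPeriods c).1.1

/-- The imaginary half-period `ω₂ ∈ i ℝ_{>0}`. -/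
def omega2 (c : ℝ) : ℂ := ((halfPeriods c).1.2 : ℂ) * Complex.I

/-- The Weierstrass zeta function of a lattice,
`ζ(z) = 1/z + ∑_{l ≠ 0} (1/(z - l) + 1/l + z/l²)`;
with `1/0 = 0` the summand at `l = 0` is the leading `1/z`. -/
def weierstrassZeta (L : PeriodPair) (z : ℂ) : ℂ :=
  ∑' l : L.lattice, (1 / (z - (l : ℂ)) + 1 / (l : ℂ) + z / (l : ℂ) ^ 2)

/-- `η₁ = ζ(ω₁)`. -/
def eta1 (c : ℝ) : ℂ := weierstrassZeta (lat c) (omega1 c)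

/-- `η₂ = ζ(ω₂)`. -/
def eta2 (c : ℝ) : ℂ := weierstrassZeta (lat c) (omega2 c)

/-- The complex-valued expression
`c / (1/12 - ℘(ω₂ + (ω₁/π)(s + 2πk/3)))`. -/
def yC (k : ℕ) (c s : ℝ) : ℂ :=
  (c : ℂ) / (1 / 12 - (lat c).weierstrassP
    (omega2 c + (omega1 c : ℂ) / π * ((s : ℂ) + 2 * π * k / 3)))

/-- `y^k(c, s)` as a real number (that `yC` is real is part of the theorem). -/
def y (k : ℕ) (c s : ℝ) : ℝ := (yC k c s).re

/-- The complex-valued expression `ζ(ω₂ + s ω₁/π) - η₂ - (s/π) η₁`. -/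
def varsigmaC (c s : ℝ) : ℂ :=
  weierstrassZeta (lat c) (omega2 c + (s : ℂ) * (omega1 c : ℂ) / π) - eta2 c
    - (s : ℂ) / π * eta1 c

/-- `ς(s)` as a real number (that `varsigmaC` is real is part of the theorem). -/
def varsigma (c s : ℝ) : ℝ := (varsigmaC c s).re

/-! ### The complex projective plane -/

/-- The complex projective plane. -/
abbrev CP2 : Type := ℙ ℂ (Fin 3 → ℂ)

/-- The inverse of the standard affine chart: `(z₁, z₂) ↦ [z₁ : z₂ : 1]`. -/
def affinePoint (z : Fin 2 → ℂ) : CP2 :=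
  Projectivization.mk ℂ ![z 0, z 1, 1] (fun h => by simpa using congrFun h 2)

/-- The moment map `y^k([Z]) = |Z_k|² / (|Z_1|² + |Z_2|² + |Z_3|²)` of the torus action. -/
def momentMap (p : CP2) (k : Fin 3) : ℝ := ‖p.rep k‖ ^ 2 / ∑ j, ‖p.rep j‖ ^ 2

/-- The bivector `u ∧ v`, as a pairing on real covectors. -/
def wedge {E : Type*} [NormedAddCommGroup E] [NormedSpace ℝ E] (u v : E) (α β : E →L[ℝ] ℝ) : ℝ :=
  α u * β v - α v * β u

/-- The pairing `⟨α, ∂/∂z_k⟩` of a real covector with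
`∂/∂z_k = (∂/∂x_k - i ∂/∂y_k) / 2`. -/
def pairDz (α : (Fin 2 → ℂ) →L[ℝ] ℝ) (k : Fin 2) : ℂ :=
  ((α (Pi.single k 1) : ℂ) - Complex.I * (α (Pi.single k Complex.I) : ℂ)) / 2

/-- The toric invariant holomorphic Poisson tensor `σ = i z₁ z₂ ∂_{z₁} ∧ ∂_{z₂}` of `CP2` in the
standard affine chart. -/
def sigma (z : Fin 2 → ℂ) (α β : (Fin 2 → ℂ) →L[ℝ] ℝ) : ℂ :=
  Complex.I * z 0 * z 1 * (pairDz α 0 * pairDz β 1 - pairDz α 1 * pairDz β 0)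

/-- The Hitchin Poisson tensor `Q = 4 Im σ` in the standard affine chart. -/
def hitchinQ (z : Fin 2 → ℂ) (α β : (Fin 2 → ℂ) →L[ℝ] ℝ) : ℝ := 4 * (sigma z α β).im

/-! ### The coordinates `(c₃, s, θ₁, θ₂)` -/

/-- The range of the coordinates `x = (c₃, s, θ₁, θ₂)`. -/
def coordDomain : Set (Fin 4 → ℝ) := {x | 0 < x 0 ∧ x 0 < 1 / 27}

/-- The inhomogeneous coordinates `z_k = (y^k / y^3)^{1/2} e^{iθ_k}` of the point with coordinates
`x = (c₃, s, θ₁, θ₂)`. -/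
def param (x : Fin 4 → ℝ) : Fin 2 → ℂ :=
  ![(√(y 1 (x 0) (x 1) / y 3 (x 0) (x 1)) : ℂ) * Complex.exp ((x 2 : ℂ) * Complex.I),
    (√(y 2 (x 0) (x 1) / y 3 (x 0) (x 1)) : ℂ) * Complex.exp ((x 3 : ℂ) * Complex.I)]

/-- The point of `CP2` with coordinates `x = (c₃, s, θ₁, θ₂)`. -/
def point (x : Fin 4 → ℝ) : CP2 := affinePoint (param x)

/-- The coordinate vector `∂/∂x_a`. -/
def dd (a : Fin 4) : Fin 4 → ℝ := Pi.single a 1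

/-- The component `⟨dx_a, J ∂_{x_b}⟩` of the standard complex structure `J` of `CP2`
(multiplication by `i` in the affine chart) in the coordinates `x = (c₃, s, θ₁, θ₂)`. -/
def J (x : Fin 4 → ℝ) (a b : Fin 4) : ℝ :=
  (fderiv ℝ param x).inverse (Complex.I • fderiv ℝ param x (dd b)) a

end HitchinCP2

end

/-! On the level {y¹y²y³ = c} put q = y¹y². Then y³ = c/q, and y¹, y² are the roots of Y² − (1 −
c/q)Y + q, hence rational in q and a square root of (c − q)² − 4q³. For q = 1/12 − ℘ that cubic
equals ℘'²; this dictates g₂ and g₃. On the line ω₂ + ℝ the function q is real and positive, and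
translation by 2ω₁/3, a 3-torsion point with ℘ = 1/12 and ℘' = −c, permutes the y^k cyclically
(`IsHalfPeriods.translation`, `IsHalfPeriods.third`). This gives the sum, the product and, in the
time x = ω₁s/π, the Lotka-Volterra system dy^k/dx = y^k(y^{k+1} − y^{k−1}).

Half-periods: the invariants determine ℘ near 0, and the lattice is the pole set of ℘, whence
uniqueness. For existence, g₃/g₂^{3/2} is a continuous, injective, odd function of log(|ω₂|/ω₁) with
limit 27^{-1/2} at infinity, and the prescribed value lies in its range because g₂³ − 27g₃² = c³(1 −
27c) > 0.

Dependence on c: the variational equation of the Lotka-Volterra system, augmented by a zeta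
primitive, has the closed solution `lvVar`. A Gronwall estimate (`hasFDerivAt_integralCurve`)
identifies it with the c-derivative, and bootstrapping gives smoothness. The implicit function
theorem for y¹ = y² at x = ω₁ makes ω₁ smooth and computes its derivative. Passing from x to s then
cancels the secular terms and leaves ς (`hasFDerivAt_yMap`).

Geometry: z_k = exp(ρ_k + iθ_k), where J turns ∂_{ρ_k} into ∂_{θ_k} and Q = ∂_{ρ₁}∧∂_{ρ₂} −
∂_{θ₁}∧∂_{θ₂}. All tensor formulae follow from the Jacobian matrix of ρ in (c, s), whose determinant
is ω₁/(4πc) (`rhoC_rhoS`). That the coordinates reach every point, and only once modulo periods,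
holds because q sweeps the whole interval between the two largest roots of the cubic, and (℘, ℘')
determines a point modulo the lattice. -/

namespace HitchinCP2

open Filter Topology

/-! ### Analytic functions vanishing near a point -/

/-- A regular singular linear equation `z A D' = B D` has no nonzero analytic solution of order `n`
unless `n A(0) = B(0)`. -/
lemma eventually_eq_zero_of_mul_deriv_eq {D A B : ℂ → ℂ} (hD : AnalyticAt ℂ D 0)
    (hA : ContinuousAt A 0) (hB : ContinuousAt B 0)
    (h : ∀ᶠ z in 𝓝[≠] (0 : ℂ), z * A z * deriv D z = B z * D z)
    (hn : ∀ n : ℕ, (D 0 = 0 → 1 ≤ n) → n * A 0 ≠ B 0) : ∀ᶠ z in 𝓝 (0 : ℂ), D z = 0 := by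
  by_contra hne
  obtain ⟨n, g, hg, hg0, hDg⟩ := hD.exists_eventuallyEq_pow_smul_nonzero_iff.mpr hne
  simp only [sub_zero, smul_eq_mul] at hDg
  have hder : ∀ᶠ z in 𝓝[≠] (0 : ℂ), z * A z * (n * z ^ (n - 1) * g z + z ^ n * deriv g z)
      = B z * (z ^ n * g z) := by
    have h1 : ∀ᶠ z in 𝓝 (0 : ℂ), deriv D z = n * z ^ (n - 1) * g z + z ^ n * deriv g z := by
      filter_upwards [hDg.eventually_nhds, hg.eventually_analyticAt] with z hz hgz
      rw [EventuallyEq.deriv_eq hz]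
      exact ((hasDerivAt_pow n z).mul hgz.differentiableAt.hasDerivAt).deriv
    filter_upwards [h, nhdsWithin_le_nhds h1, nhdsWithin_le_nhds hDg] with z h2 h3 h4
    rw [← h3, h2, h4]
  -- Dividing by `z ^ n` leaves an identity whose limit at 0 is the indicial equation.
  have hlim : ∀ᶠ z in 𝓝[≠] (0 : ℂ), A z * (n * g z + z * deriv g z) = B z * g z := by
    filter_upwards [hder, self_mem_nhdsWithin] with z hz hz0
    have hz0 : z ≠ 0 := hz0
    have h5 : z * (n * z ^ (n - 1) : ℂ) = n * z ^ n := by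
      rcases Nat.eq_zero_or_pos n with rfl | hp
      · simp
      · rw [mul_left_comm, ← pow_succ', Nat.sub_add_cancel hp]
    apply mul_left_cancel₀ (pow_ne_zero n hz0)
    linear_combination hz - A z * g z * h5
  have hc1 : Tendsto (fun z => A z * (n * g z + z * deriv g z)) (𝓝[≠] 0)
      (𝓝 (A 0 * (n * g 0 + 0 * deriv g 0))) := by
    refine tendsto_nhdsWithin_of_tendsto_nhds ?_
    exact (hA.mul ((continuousAt_const.mul hg.continuousAt).add
      (continuousAt_id.mul hg.deriv.continuousAt))).tendsto
  have hc2 : Tendsto (fun z => B z * g z) (𝓝[≠] 0) (𝓝 (B 0 * g 0)) :=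
    tendsto_nhdsWithin_of_tendsto_nhds (hB.mul hg.continuousAt).tendsto
  have heq := tendsto_nhds_unique (hc1.congr' hlim) hc2
  have hn' : (n : ℂ) * A 0 = B 0 := by
    apply mul_right_cancel₀ hg0
    linear_combination heq
  -- If `D 0 = 0` then `n = 0` is impossible, since the cofactor `g` does not vanish at 0.
  refine hn n (fun hD0 => ?_) hn'
  by_contra hlt
  have : n = 0 := by omega
  subst this
  apply hg0
  have := hDg.self_of_nhds
  simpa [hD0] using this.symm

/-- Uniqueness for a linear second order equation with analytic coefficient. -/
lemma eventually_eq_zero_of_deriv_deriv_eq {D E : ℂ → ℂ} {z₀ : ℂ} (hD : AnalyticAt ℂ D z₀)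
    (hE : AnalyticAt ℂ E z₀) (h : ∀ᶠ z in 𝓝 z₀, deriv (deriv D) z = E z * D z)
    (h0 : D z₀ = 0) (h1 : deriv D z₀ = 0) : ∀ᶠ z in 𝓝 z₀, D z = 0 := by
  rw [← analyticOrderAt_eq_top]
  have e1 := hD.analyticOrderAt_deriv_add_one
  have e2 := hD.deriv.analyticOrderAt_deriv_add_one
  simp only [h0, h1, sub_zero] at e1 e2
  have e3 : analyticOrderAt (deriv (deriv D)) z₀ = analyticOrderAt E z₀ + analyticOrderAt D z₀ := by
    rw [analyticOrderAt_congr (g := E * D) h, analyticOrderAt_mul hE hD]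
  -- Two derivatives lower the order of the zero by two, whereas multiplication by `E` cannot lower
  -- it; only infinite order is consistent.
  have e4 : analyticOrderAt D z₀ = analyticOrderAt E z₀ + analyticOrderAt D z₀ + 1 + 1 := by
    rw [← e3, e2, e1]
  by_contra hne
  lift analyticOrderAt D z₀ to ℕ using hne with n
  rcases eq_or_ne (analyticOrderAt E z₀) ⊤ with ht | ht
  · simp [ht] at e4
  · lift analyticOrderAt E z₀ to ℕ using ht with m
    norm_cast at e4
    omega

/-! ### The Weierstrass function of a general lattice -/

section General

variable (L : PeriodPair)

lemma countable_lattice : (L.lattice : Set ℂ).Countable := by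
  have : Countable L.lattice := L.latticeEquivProd.toEquiv.countable_iff.mpr inferInstance
  exact Set.to_countable _

lemma isPreconnected_compl_lattice : IsPreconnected ((L.lattice : Set ℂ)ᶜ) := by
  exact ((countable_lattice L).isPathConnected_compl_of_one_lt_rank (by simp)).isConnected.isPreconnected

lemma hasDerivAt_weierstrassP {z : ℂ} (hz : z ∉ L.lattice) :
    HasDerivAt L.weierstrassP (L.derivWeierstrassP z) z := by
  have := (L.analyticOnNhd_weierstrassP z hz).differentiableAt.hasDerivAt
  rwa [L.deriv_weierstrassP] at this

lemma compl_lattice_mem_nhds {z : ℂ} (hz : z ∉ L.lattice) : (L.lattice : Set ℂ)ᶜ ∈ 𝓝 z :=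
  L.isClosed_lattice.isOpen_compl.mem_nhds hz

lemma punctured_compl_lattice : ∀ᶠ z in 𝓝[≠] (0 : ℂ), z ∉ L.lattice := by
  filter_upwards [self_mem_nhdsWithin,
    mem_nhdsWithin_of_mem_nhds (L.compl_lattice_sdiff_singleton_mem_nhds 0)] with w hw hw'
  simp_all

lemma weierstrassP_eq_except (z : ℂ) :
    L.weierstrassP z = L.weierstrassPExcept 0 z + 1 / z ^ 2 := by
  have := L.weierstrassPExcept_add ⟨0, L.lattice.zero_mem⟩ z
  simpa using this.symm

lemma derivWeierstrassP_eq_except (z : ℂ) :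
    L.derivWeierstrassP z = L.derivWeierstrassPExcept 0 z - 2 / z ^ 3 := by
  have := L.derivWeierstrassPExcept_sub ⟨0, L.lattice.zero_mem⟩ z
  simpa using this.symm

/-- `℘` is not constant near any point. -/
lemma not_eventually_derivWeierstrassP_eq_zero {z : ℂ} (hz : z ∉ L.lattice) :
    ¬ ∀ᶠ w in 𝓝 z, L.derivWeierstrassP w = 0 := by
  intro h
  have h0 : EqOn L.derivWeierstrassP 0 (L.lattice : Set ℂ)ᶜ :=
    L.analyticOnNhd_derivWeierstrassP.eqOn_zero_of_preconnected_of_eventuallyEq_zero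
      (isPreconnected_compl_lattice L) hz h
  -- If ℘' vanished identically, its pole -2/w³ would have to be cancelled by a part that is regular
  -- at 0.
  have h1 : ∀ᶠ w in 𝓝[≠] (0 : ℂ), L.derivWeierstrassPExcept 0 w * w ^ 3 = 2 := by
    filter_upwards [punctured_compl_lattice L, self_mem_nhdsWithin] with w hw hw0
    have hw0 : w ≠ 0 := hw0
    have := h0 hw
    rw [derivWeierstrassP_eq_except, Pi.zero_apply, sub_eq_zero] at this
    rw [this]; field_simp
  have h2 : Tendsto (fun w => L.derivWeierstrassPExcept 0 w * w ^ 3) (𝓝[≠] (0 : ℂ))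
      (𝓝 (L.derivWeierstrassPExcept 0 0 * 0 ^ 3)) :=
    tendsto_nhdsWithin_of_tendsto_nhds
      (((L.analyticAt_derivWeierstrassPExcept 0).continuousAt).mul
        (continuousAt_id.pow 3)).tendsto
  have := tendsto_nhds_unique (h2.congr' h1) tendsto_const_nhds
  norm_num at this

/-- The second order equation `℘'' = 6 ℘² - g₂ / 2`. -/
lemma deriv_derivWeierstrassP {z : ℂ} (hz : z ∉ L.lattice) :
    deriv L.derivWeierstrassP z = 6 * L.weierstrassP z ^ 2 - L.g₂ / 2 := by
  have hP := L.analyticOnNhd_weierstrassP z hz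
  have hP' := L.analyticOnNhd_derivWeierstrassP z hz
  -- Differentiating the cubic gives the claim multiplied by ℘'. Zeros of ℘' are isolated, so the
  -- factor can be removed by the identity theorem.
  have hmul : ∀ᶠ w in 𝓝 z, L.derivWeierstrassP w *
      (deriv L.derivWeierstrassP w - (6 * L.weierstrassP w ^ 2 - L.g₂ / 2)) = 0 := by
    filter_upwards [compl_lattice_mem_nhds L hz] with w hw
    have e : L.derivWeierstrassP ^ 2 =ᶠ[𝓝 w]
        fun u => 4 * L.weierstrassP u ^ 3 - L.g₂ * L.weierstrassP u - L.g₃ := by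
      filter_upwards [compl_lattice_mem_nhds L hw] with u hu using L.derivWeierstrassP_sq u hu
    have d1 := ((L.analyticOnNhd_derivWeierstrassP w hw).differentiableAt.hasDerivAt.pow 2)
    have d0 := hasDerivAt_weierstrassP L hw
    have d2 := (((d0.pow 3).const_mul 4).sub (d0.const_mul L.g₂)).sub_const L.g₃
    have := d1.unique (d2.congr_of_eventuallyEq e)
    push_cast at this
    linear_combination this / 2
  have hF : AnalyticAt ℂ (fun w => deriv L.derivWeierstrassP w -
      (6 * L.weierstrassP w ^ 2 - L.g₂ / 2)) z := by
    have := hP'.deriv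
    fun_prop
  rcases hP'.eventually_eq_zero_or_eventually_ne_zero with h | h
  · exact absurd h (not_eventually_derivWeierstrassP_eq_zero L hz)
  · have : ∃ᶠ w in 𝓝[≠] z, deriv L.derivWeierstrassP w -
      (6 * L.weierstrassP w ^ 2 - L.g₂ / 2) = 0 := by
      apply Eventually.frequently
      filter_upwards [h, nhdsWithin_le_nhds hmul] with w hw hm
      exact (mul_eq_zero.mp hm).resolve_left hw
    have := (hF.frequently_zero_iff_eventually_zero.mp this).self_of_nhds
    exact sub_eq_zero.mp this

/-- Points with equal `℘` and opposite `℘'` are opposite modulo the lattice. -/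
lemma add_mem_lattice_of_weierstrassP_eq {z w : ℂ} (hz : z ∉ L.lattice) (hw : w ∉ L.lattice)
    (h : L.weierstrassP z = L.weierstrassP w)
    (h' : L.derivWeierstrassP z = -L.derivWeierstrassP w) : z + w ∈ L.lattice := by
  set P := L.weierstrassP
  have hz1 : ∀ᶠ u in 𝓝 (0 : ℂ), z + u ∉ L.lattice := by
    have : ContinuousAt (fun u : ℂ => z + u) 0 := by fun_prop
    exact this (by simpa using compl_lattice_mem_nhds L hz)
  have hw1 : ∀ᶠ u in 𝓝 (0 : ℂ), w - u ∉ L.lattice := by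
    have : ContinuousAt (fun u : ℂ => w - u) 0 := by fun_prop
    exact this (by simpa using compl_lattice_mem_nhds L hw)
  have dP : ∀ u, z + u ∉ L.lattice → w - u ∉ L.lattice → HasDerivAt (fun u => P (z + u) - P (w - u))
      (L.derivWeierstrassP (z + u) + L.derivWeierstrassP (w - u)) u := by
    intro u h1 h2
    have e1 := (hasDerivAt_weierstrassP L h1).comp_const_add z u
    have e2 := (hasDerivAt_weierstrassP L h2).comp_const_sub w u
    simpa using e1.fun_sub e2
  have hev : deriv (fun u => P (z + u) - P (w - u)) =ᶠ[𝓝 0]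
      fun u => L.derivWeierstrassP (z + u) + L.derivWeierstrassP (w - u) := by
    filter_upwards [hz1, hw1] with u h1 h2 using (dP u h1 h2).deriv
  have hPz : AnalyticAt ℂ (fun u => P (z + u)) 0 :=
    AnalyticAt.comp (g := P) (f := fun u => z + u)
      (by simpa using L.analyticOnNhd_weierstrassP z hz) (by fun_prop)
  have hPw : AnalyticAt ℂ (fun u => P (w - u)) 0 :=
    AnalyticAt.comp (g := P) (f := fun u => w - u)
      (by simpa using L.analyticOnNhd_weierstrassP w hw) (by fun_prop)
  -- Since ℘'' = 6℘² − g₂/2, the difference of ℘(z + u) and ℘(w − u) solves a linear second order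
  -- equation in u with zero initial data.
  have key := eventually_eq_zero_of_deriv_deriv_eq (D := fun u => P (z + u) - P (w - u))
    (E := fun u => 6 * (P (z + u) + P (w - u))) (z₀ := 0) (hPz.fun_sub hPw)
    (analyticAt_const.fun_mul (hPz.fun_add hPw))
    (by
      filter_upwards [hev.eventually_nhds, hz1, hw1] with u hu h1 h2
      rw [EventuallyEq.deriv_eq hu]
      have e1 := (L.analyticOnNhd_derivWeierstrassP _ h1).differentiableAt.hasDerivAt.comp_const_add
        z u
      have e2 := (L.analyticOnNhd_derivWeierstrassP _ h2).differentiableAt.hasDerivAt.comp_const_sub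
        w u
      rw [(e1.fun_add e2).deriv, deriv_derivWeierstrassP L h1, deriv_derivWeierstrassP L h2]
      ring)
    (by simp [h]) (by rw [hev.self_of_nhds]; simp [h'])
  by_contra hzw
  -- the identity `℘ (z + w - v) = ℘ v` near `v = w` extends to the punctured neighbourhood of `0`
  let U : Set ℂ := ((L.lattice : Set ℂ) ∪ (fun v => z + w - v) ⁻¹' (L.lattice : Set ℂ))ᶜ
  have hcount : ((L.lattice : Set ℂ) ∪ (fun v => z + w - v) ⁻¹' (L.lattice : Set ℂ)).Countable := by
    refine (countable_lattice L).union ((countable_lattice L).preimage_of_injOn ?_)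
    intro a _ b _ hab
    simpa using hab
  have hU : IsPreconnected U :=
    (hcount.isPathConnected_compl_of_one_lt_rank (by simp)).isConnected.isPreconnected
  have hA1 : AnalyticOnNhd ℂ P U := fun v hv => L.analyticOnNhd_weierstrassP v (fun h => hv (.inl h))
  have hA2 : AnalyticOnNhd ℂ (fun v => P (z + w - v)) U := fun v hv =>
    AnalyticAt.comp (g := P) (f := fun v => z + w - v)
      (L.analyticOnNhd_weierstrassP _ (fun h => hv (.inr h))) (by fun_prop)
  have hwU : w ∈ U := by simp [U, hw, hz]
  have hnear : (fun v => P (z + w - v)) =ᶠ[𝓝 w] P := by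
    have ht : Tendsto (fun v : ℂ => w - v) (𝓝 w) (𝓝 0) := by
      have : ContinuousAt (fun v : ℂ => w - v) w := by fun_prop
      simpa using this.tendsto
    filter_upwards [ht.eventually key] with v hv
    have := sub_eq_zero.mp hv
    rw [add_sub_assoc, this]; congr 1; ring
  have hEq := hA2.eqOn_of_preconnected_of_eventuallyEq hA1 hU hwU hnear
  have h0 : ContinuousAt (fun v => P (z + w - v)) 0 := by
    refine (AnalyticAt.comp (𝕜 := ℂ) (g := P) (f := fun v => z + w - v) ?_
      (by fun_prop)).continuousAt
    simpa using L.analyticOnNhd_weierstrassP _ hzw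
  have h3 : ∀ᶠ v in 𝓝 (0 : ℂ), z + w - v ∉ L.lattice := by
    have : ContinuousAt (fun u : ℂ => z + w - u) 0 := by fun_prop
    exact this (by simpa using compl_lattice_mem_nhds L hzw)
  -- The contradiction: ℘(v) has a double pole at v = 0, while ℘(z + w − v) is regular there.
  have h4 : ∀ᶠ v in 𝓝[≠] (0 : ℂ),
      P (z + w - v) * v ^ 2 = L.weierstrassPExcept 0 v * v ^ 2 + 1 := by
    filter_upwards [punctured_compl_lattice L, nhdsWithin_le_nhds h3, self_mem_nhdsWithin]
      with v hv hv' hv0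
    have hv0 : v ≠ 0 := hv0
    have := hEq (x := v) (by simp [U, hv, hv'])
    simp only at this
    rw [this]
    simp only [P]
    rw [weierstrassP_eq_except]
    field_simp
  have h5 : Tendsto (fun v => P (z + w - v) * v ^ 2) (𝓝[≠] 0) (𝓝 (P (z + w - 0) * 0 ^ 2)) :=
    tendsto_nhdsWithin_of_tendsto_nhds (h0.mul (continuousAt_id.pow 2)).tendsto
  have h6 : Tendsto (fun v => L.weierstrassPExcept 0 v * v ^ 2 + 1) (𝓝[≠] 0)
      (𝓝 (L.weierstrassPExcept 0 0 * 0 ^ 2 + 1)) :=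
    tendsto_nhdsWithin_of_tendsto_nhds
      (((L.analyticAt_weierstrassPExcept 0).continuousAt.mul (continuousAt_id.pow 2)).add
        continuousAt_const).tendsto
  have := tendsto_nhds_unique (h5.congr' h4) h6
  norm_num at this

lemma sub_mem_lattice_of_weierstrassP_eq {z w : ℂ} (hz : z ∉ L.lattice) (hw : w ∉ L.lattice)
    (h : L.weierstrassP z = L.weierstrassP w)
    (h' : L.derivWeierstrassP z = L.derivWeierstrassP w) : z - w ∈ L.lattice := by
  rw [sub_eq_add_neg]
  exact add_mem_lattice_of_weierstrassP_eq L hz (by simpa using hw)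
    (by rw [h, L.weierstrassP_neg]) (by rw [h', L.derivWeierstrassP_neg, neg_neg])

end General

end HitchinCP2

namespace HitchinCP2

open Filter Topology

/-! ### Lattices with equal invariants coincide. -/

section General

variable (L M : PeriodPair)

lemma tendsto_sq_mul_weierstrassP :
    Tendsto (fun z => z ^ 2 * L.weierstrassP z) (𝓝[≠] 0) (𝓝 1) := by
  have h1 : Tendsto (fun z => z ^ 2 * L.weierstrassPExcept 0 z + 1) (𝓝[≠] 0)
      (𝓝 (0 ^ 2 * L.weierstrassPExcept 0 0 + 1)) :=
    tendsto_nhdsWithin_of_tendsto_nhds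
      (((continuousAt_id.pow 2).mul (L.analyticAt_weierstrassPExcept 0).continuousAt).add
        continuousAt_const).tendsto
  simp only [ne_eq, OfNat.ofNat_ne_zero, not_false_eq_true, zero_pow, zero_mul, zero_add] at h1
  refine h1.congr' ?_
  filter_upwards [self_mem_nhdsWithin] with z hz
  have hz : z ≠ 0 := hz
  rw [weierstrassP_eq_except]
  field_simp

lemma eventually_deriv_weierstrassPExcept :
    ∀ᶠ z in 𝓝 (0 : ℂ), deriv (L.weierstrassPExcept 0) z = L.derivWeierstrassPExcept 0 z := by
  filter_upwards [L.compl_lattice_sdiff_singleton_mem_nhds 0] with z hz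
  exact L.eqOn_deriv_weierstrassPExcept_derivWeierstrassPExcept 0 hz

variable {L M}

/-- Lattices with the same invariants have the same `℘`-function near the origin. -/
lemma weierstrassP_eventuallyEq (h2 : L.g₂ = M.g₂) (h3 : L.g₃ = M.g₃) :
    ∀ᶠ z in 𝓝 (0 : ℂ), L.weierstrassPExcept 0 z - M.weierstrassPExcept 0 z = 0 := by
  set f := L.weierstrassPExcept 0 with hf
  set g := M.weierstrassPExcept 0 with hg
  set f' := L.derivWeierstrassPExcept 0 with hf'
  set g' := M.derivWeierstrassPExcept 0 with hg'
  have af : AnalyticAt ℂ f 0 := L.analyticAt_weierstrassPExcept 0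
  have ag : AnalyticAt ℂ g 0 := M.analyticAt_weierstrassPExcept 0
  have af' : AnalyticAt ℂ f' 0 := L.analyticAt_derivWeierstrassPExcept 0
  have ag' : AnalyticAt ℂ g' 0 := M.analyticAt_derivWeierstrassPExcept 0
  -- Subtracting the two cubics, with ℘ = z⁻² + f and ℘ = z⁻² + g, gives such an equation with A(0)
  -- = −4 and B(0) = 12. Its only index is n = −3, which is not an order of vanishing.
  refine eventually_eq_zero_of_mul_deriv_eq (D := fun z => f z - g z)
    (A := fun z => -4 + z ^ 3 * (f' z + g' z))
    (B := fun z => 4 * ((1 + z ^ 2 * f z) ^ 2 + (1 + z ^ 2 * f z) * (1 + z ^ 2 * g z) +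
      (1 + z ^ 2 * g z) ^ 2) - L.g₂ * z ^ 4) (af.fun_sub ag) ?_ ?_ ?_ ?_
  · have := af'.continuousAt; have := ag'.continuousAt; fun_prop
  · have := af.continuousAt; have := ag.continuousAt; fun_prop
  · filter_upwards [nhdsWithin_le_nhds (eventually_deriv_weierstrassPExcept L),
      nhdsWithin_le_nhds (eventually_deriv_weierstrassPExcept M), self_mem_nhdsWithin,
      punctured_compl_lattice L, punctured_compl_lattice M,
      nhdsWithin_le_nhds af.eventually_analyticAt, nhdsWithin_le_nhds ag.eventually_analyticAt]
      with z h4 h5 hz0 hzL hzM h6 h7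
    have hz0 : z ≠ 0 := hz0
    have hd : deriv (fun z => f z - g z) z = f' z - g' z := by
      rw [deriv_fun_sub h6.differentiableAt h7.differentiableAt, h4, h5]
    rw [hd]
    have e1 := L.derivWeierstrassP_sq z hzL
    have e2 := M.derivWeierstrassP_sq z hzM
    rw [weierstrassP_eq_except, derivWeierstrassP_eq_except, ← hf, ← hf'] at e1
    rw [weierstrassP_eq_except, derivWeierstrassP_eq_except, ← hg, ← hg', ← h2, ← h3] at e2
    field_simp at e1 e2
    apply mul_left_cancel₀ (pow_ne_zero 2 hz0)
    linear_combination e1 - e2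
  · intro n _ h
    norm_num at h
    have : ((4 * n + 12 : ℕ) : ℂ) = 0 := by push_cast; linear_combination -h
    norm_cast at this

/-- The two ℘-functions agree off both lattices by the identity theorem, and a lattice is the set of
poles: at a point of the first lattice outside the second, one side would be regular. -/
lemma lattice_le_of_invariants (h2 : L.g₂ = M.g₂) (h3 : L.g₃ = M.g₃) {l : ℂ}
    (hl : l ∈ L.lattice) : l ∈ M.lattice := by
  have h0 := weierstrassP_eventuallyEq h2 h3
  set U : Set ℂ := ((L.lattice : Set ℂ) ∪ (M.lattice : Set ℂ))ᶜ with hUdef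
  have hU : IsPreconnected U :=
    (((countable_lattice L).union (countable_lattice M)).isPathConnected_compl_of_one_lt_rank
      (by simp)).isConnected.isPreconnected
  have aL : AnalyticOnNhd ℂ L.weierstrassP U :=
    fun v hv => L.analyticOnNhd_weierstrassP v (fun h => hv (.inl h))
  have aM : AnalyticOnNhd ℂ M.weierstrassP U :=
    fun v hv => M.analyticOnNhd_weierstrassP v (fun h => hv (.inr h))
  obtain ⟨z, hz, hzL, hzM⟩ : ∃ z, (∀ᶠ u in 𝓝 z, L.weierstrassPExcept 0 u -
      M.weierstrassPExcept 0 u = 0) ∧ z ∉ L.lattice ∧ z ∉ M.lattice :=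
    ((h0.eventually_nhds.filter_mono nhdsWithin_le_nhds).and
      ((punctured_compl_lattice L).and (punctured_compl_lattice M))).exists
  have hEq : EqOn L.weierstrassP M.weierstrassP U := by
    refine aL.eqOn_of_preconnected_of_eventuallyEq aM hU (z₀ := z) (by simp [hUdef, hzL, hzM]) ?_
    filter_upwards [hz] with u hu
    rw [weierstrassP_eq_except, weierstrassP_eq_except, sub_eq_zero.mp hu]
  by_contra hlM
  have hcont : Tendsto (fun v : ℂ => l + v) (𝓝 0) (𝓝 l) := by
    have : ContinuousAt (fun v : ℂ => l + v) 0 := by fun_prop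
    simpa using this.tendsto
  have h4 : Tendsto (fun v => v ^ 2 * M.weierstrassP (l + v)) (𝓝[≠] 0)
      (𝓝 (0 ^ 2 * M.weierstrassP l)) :=
    tendsto_nhdsWithin_of_tendsto_nhds
      ((continuousAt_id.pow 2).tendsto.mul
        ((M.analyticOnNhd_weierstrassP l hlM).continuousAt.tendsto.comp hcont))
  have h5 : (fun v => v ^ 2 * M.weierstrassP (l + v)) =ᶠ[𝓝[≠] 0]
      fun v => v ^ 2 * L.weierstrassP v := by
    filter_upwards [punctured_compl_lattice L,
      nhdsWithin_le_nhds (hcont (compl_lattice_mem_nhds M hlM))] with v hv hv'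
    have hlv : l + v ∉ L.lattice := fun h => hv (by simpa using sub_mem h hl)
    have e := hEq (x := l + v) (by
      simp only [hUdef, mem_compl_iff, mem_union, not_or]; exact ⟨hlv, hv'⟩)
    rw [← e, add_comm l v, L.weierstrassP_add_coe v ⟨l, hl⟩]
  have := tendsto_nhds_unique (h4.congr' h5) (tendsto_sq_mul_weierstrassP L)
  norm_num at this

end General

/-! ### Rectangular lattices -/

section Rectangular

variable (p : HalfPeriods)

lemma mem_rect_lattice {z : ℂ} : z ∈ p.lattice.lattice ↔
    (∃ m : ℤ, z.re = 2 * m * p.1.1) ∧ ∃ n : ℤ, z.im = 2 * n * p.1.2 := by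
  rw [PeriodPair.mem_lattice]
  constructor
  · rintro ⟨m, n, rfl⟩
    refine ⟨⟨m, ?_⟩, ⟨n, ?_⟩⟩ <;> simp [HalfPeriods.lattice] <;> ring
  · rintro ⟨⟨m, hm⟩, ⟨n, hn⟩⟩
    refine ⟨m, n, ?_⟩
    apply Complex.ext
    · simp [HalfPeriods.lattice, hm]; ring
    · simp [HalfPeriods.lattice, hn]; ring

lemma conj_mem_rect_lattice {z : ℂ} (h : z ∈ p.lattice.lattice) :
    (starRingEnd ℂ) z ∈ p.lattice.lattice := by
  rw [mem_rect_lattice] at h ⊢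
  obtain ⟨⟨m, hm⟩, n, hn⟩ := h
  exact ⟨⟨m, by simpa using hm⟩, ⟨-n, by push_cast; simp [hn]⟩⟩

/-- Complex conjugation of a rectangular lattice. -/
def conjRectLattice : p.lattice.lattice ≃ p.lattice.lattice where
  toFun l := ⟨(starRingEnd ℂ) l, conj_mem_rect_lattice p l.2⟩
  invFun l := ⟨(starRingEnd ℂ) l, conj_mem_rect_lattice p l.2⟩
  left_inv l := by simp
  right_inv l := by simp

lemma conj_weierstrassP (z : ℂ) : (starRingEnd ℂ) (p.lattice.weierstrassP z) =
    p.lattice.weierstrassP ((starRingEnd ℂ) z) := by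
  simp only [PeriodPair.weierstrassP]
  rw [Complex.conj_tsum, ← (conjRectLattice p).tsum_eq]
  simp [conjRectLattice]

lemma conj_derivWeierstrassP (z : ℂ) : (starRingEnd ℂ) (p.lattice.derivWeierstrassP z) =
    p.lattice.derivWeierstrassP ((starRingEnd ℂ) z) := by
  simp only [PeriodPair.derivWeierstrassP]
  rw [map_neg, Complex.conj_tsum, ← (conjRectLattice p).tsum_eq]
  simp [conjRectLattice, Complex.conj_ofNat]

lemma conj_G (n : ℕ) : (starRingEnd ℂ) (p.lattice.G n) = p.lattice.G n := by
  simp only [PeriodPair.G]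
  rw [Complex.conj_tsum, ← (conjRectLattice p).tsum_eq]
  simp [conjRectLattice]

lemma g₂_real : ((p.lattice.g₂).re : ℂ) = p.lattice.g₂ := by
  rw [← Complex.conj_eq_iff_re, PeriodPair.g₂, map_mul, conj_G, Complex.conj_ofNat]

lemma g₃_real : ((p.lattice.g₃).re : ℂ) = p.lattice.g₃ := by
  rw [← Complex.conj_eq_iff_re, PeriodPair.g₃, map_mul, conj_G, Complex.conj_ofNat]

lemma two_mul_fst_mem : (2 * p.1.1 : ℂ) ∈ p.lattice.lattice :=
  (mem_rect_lattice p).mpr ⟨⟨1, by simp⟩, ⟨0, by simp⟩⟩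

lemma two_mul_snd_mem : (2 * (p.1.2 * Complex.I) : ℂ) ∈ p.lattice.lattice :=
  (mem_rect_lattice p).mpr ⟨⟨0, by simp⟩, ⟨1, by simp⟩⟩

lemma real_notMem_lattice {x : ℝ} (h0 : 0 < x) (h1 : x < 2 * p.1.1) :
    (x : ℂ) ∉ p.lattice.lattice := by
  rw [mem_rect_lattice]
  rintro ⟨⟨m, hm⟩, -⟩
  have ha := p.2.1
  simp only [Complex.ofReal_re] at hm
  have h2 : (0 : ℝ) < m := by by_contra h; push Not at h; nlinarith
  have h3 : (m : ℝ) < 1 := by by_contra h; push Not at h; nlinarith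
  norm_cast at h2 h3
  omega

lemma imag_notMem_lattice {x : ℝ} (h0 : 0 < x) (h1 : x < 2 * p.1.2) :
    (x * Complex.I : ℂ) ∉ p.lattice.lattice := by
  rw [mem_rect_lattice]
  rintro ⟨-, ⟨m, hm⟩⟩
  have ha := p.2.2
  simp only [Complex.mul_I_im, Complex.ofReal_re] at hm
  have h2 : (0 : ℝ) < m := by by_contra h; push Not at h; nlinarith
  have h3 : (m : ℝ) < 1 := by by_contra h; push Not at h; nlinarith
  norm_cast at h2 h3
  omega

lemma line_notMem_lattice (x : ℝ) : (p.1.2 * Complex.I + x : ℂ) ∉ p.lattice.lattice := by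
  rw [mem_rect_lattice]
  rintro ⟨-, ⟨n, hn⟩⟩
  have hb := p.2.2
  simp at hn
  have : (1 : ℝ) = 2 * n := by
    apply mul_right_cancel₀ hb.ne'
    linarith
  norm_cast at this
  omega

lemma weierstrassP_real (x : ℝ) :
    ((p.lattice.weierstrassP x).re : ℂ) = p.lattice.weierstrassP x := by
  rw [← Complex.conj_eq_iff_re, conj_weierstrassP]; simp

lemma derivWeierstrassP_real (x : ℝ) :
    ((p.lattice.derivWeierstrassP x).re : ℂ) = p.lattice.derivWeierstrassP x := by
  rw [← Complex.conj_eq_iff_re, conj_derivWeierstrassP]; simp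

lemma weierstrassP_imag (x : ℝ) :
    ((p.lattice.weierstrassP (x * Complex.I)).re : ℂ) = p.lattice.weierstrassP (x * Complex.I) := by
  rw [← Complex.conj_eq_iff_re, conj_weierstrassP]
  simp [p.lattice.weierstrassP_neg]

lemma weierstrassP_line (x : ℝ) : ((p.lattice.weierstrassP (p.1.2 * Complex.I + x)).re : ℂ) =
    p.lattice.weierstrassP (p.1.2 * Complex.I + x) := by
  rw [← Complex.conj_eq_iff_re, conj_weierstrassP,
    ← p.lattice.weierstrassP_add_coe _ ⟨_, two_mul_snd_mem p⟩]
  congr 1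
  simp; ring

lemma derivWeierstrassP_line (x : ℝ) :
    ((p.lattice.derivWeierstrassP (p.1.2 * Complex.I + x)).re : ℂ) =
    p.lattice.derivWeierstrassP (p.1.2 * Complex.I + x) := by
  rw [← Complex.conj_eq_iff_re, conj_derivWeierstrassP,
    ← p.lattice.derivWeierstrassP_add_coe _ ⟨_, two_mul_snd_mem p⟩]
  congr 1
  simp; ring

lemma derivWeierstrassP_half {L : PeriodPair} {w : ℂ} (h : 2 * w ∈ L.lattice) :
    L.derivWeierstrassP w = 0 := by
  have h1 := L.derivWeierstrassP_sub_coe w ⟨_, h⟩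
  rw [show w - 2 * w = -w by ring, L.derivWeierstrassP_neg] at h1
  linear_combination -h1 / 2

/-- The numbers 2ω₁ and 2|ω₂| are recovered as the least positive elements of the lattice on the
real axis and on the imaginary axis. -/
lemma halfPeriods_eq_of_lattice_eq {p q : HalfPeriods}
    (h : ∀ z, z ∈ p.lattice.lattice ↔ z ∈ q.lattice.lattice) : p = q := by
  have key : ∀ p q : HalfPeriods, (∀ z, z ∈ p.lattice.lattice → z ∈ q.lattice.lattice) →
      q.1.1 ≤ p.1.1 ∧ q.1.2 ≤ p.1.2 := by
    intro p q h
    constructor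
    · by_contra hlt
      push Not at hlt
      have := h _ (two_mul_fst_mem p)
      have h2 := real_notMem_lattice q (x := 2 * p.1.1) (by linarith [p.2.1]) (by linarith)
      push_cast at h2
      exact h2 this
    · by_contra hlt
      push Not at hlt
      have := h _ (two_mul_snd_mem p)
      have h2 := imag_notMem_lattice q (x := 2 * p.1.2) (by linarith [p.2.2]) (by linarith)
      push_cast at h2
      rw [mul_assoc] at h2
      exact h2 this
  have h1 := key p q (fun z => (h z).mp)
  have h2 := key q p (fun z => (h z).mpr)
  exact Subtype.ext (Prod.ext (le_antisymm h2.1 h1.1) (le_antisymm h2.2 h1.2))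

/-- A rectangular lattice is determined by its invariants. -/
lemma halfPeriods_eq_of_invariants {p q : HalfPeriods} (h2 : p.lattice.g₂ = q.lattice.g₂)
    (h3 : p.lattice.g₃ = q.lattice.g₃) : p = q :=
  halfPeriods_eq_of_lattice_eq fun _ =>
    ⟨lattice_le_of_invariants h2 h3, lattice_le_of_invariants h2.symm h3.symm⟩

end Rectangular

end HitchinCP2

namespace HitchinCP2

open Filter Topology

/-! ### Translation by a third of the real period. -/

section Translation

variable {c : ℝ} {p : HalfPeriods}

/-- With q = 1/12 − ℘ the right-hand side is q² times the discriminant of Y² − (1 − c/q)Y + q, the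
quadratic whose roots will be two of the y^k. The invariants are chosen for this. -/
lemma IsHalfPeriods.cubic (h : IsHalfPeriods c p) {z : ℂ} (hz : z ∉ p.lattice.lattice) :
    p.lattice.derivWeierstrassP z ^ 2 =
      (c - (1 / 12 - p.lattice.weierstrassP z)) ^ 2 - 4 * (1 / 12 - p.lattice.weierstrassP z) ^ 3 := by
  rw [p.lattice.derivWeierstrassP_sq z hz, h.1, h.2]
  ring

lemma IsHalfPeriods.second_order (h : IsHalfPeriods c p) {z : ℂ} (hz : z ∉ p.lattice.lattice) :
    deriv p.lattice.derivWeierstrassP z = c - (1 / 12 - p.lattice.weierstrassP z) +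
      6 * (1 / 12 - p.lattice.weierstrassP z) ^ 2 := by
  rw [deriv_derivWeierstrassP _ hz, h.1]
  ring

lemma hasDerivAt_re_weierstrassP {x : ℝ} (hx : (x : ℂ) ∉ p.lattice.lattice) :
    HasDerivAt (fun x : ℝ => (p.lattice.weierstrassP x).re) (p.lattice.derivWeierstrassP x).re x :=
  (hasDerivAt_weierstrassP _ hx).real_of_complex

/-- At a zero of ℘' the point is its own opposite modulo the lattice, but 0 < 2x < 2ω₁. -/
lemma derivWeierstrassP_ne_zero {x : ℝ} (h0 : 0 < x) (h1 : x < p.1.1) :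
    p.lattice.derivWeierstrassP x ≠ 0 := by
  intro h
  have hx := real_notMem_lattice p h0 (by linarith)
  have h2 := add_mem_lattice_of_weierstrassP_eq _ hx hx rfl (by rw [h, neg_zero])
  have h3 := real_notMem_lattice p (x := x + x) (by linarith) (by linarith)
  push_cast at h3
  exact h3 h2

/-- The point of the real period segment where `℘ = 1/12` and `℘' < 0`. -/
lemma IsHalfPeriods.exists_third (h : IsHalfPeriods c p) (hc : 0 < c) :
    ∃ t : ℝ, 0 < t ∧ t < p.1.1 ∧ p.lattice.weierstrassP t = 1 / 12 ∧
      p.lattice.derivWeierstrassP t = -c := by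
  set a := p.1.1 with ha
  have ha0 : 0 < a := p.2.1
  set f : ℝ → ℝ := fun x => (p.lattice.weierstrassP x).re with hf
  set f' : ℝ → ℝ := fun x => (p.lattice.derivWeierstrassP x).re with hf'
  have hne : ∀ x : ℝ, 0 < x → x ≤ a → (x : ℂ) ∉ p.lattice.lattice := fun x h1 h2 =>
    real_notMem_lattice p h1 (by linarith)
  have hd : ∀ x : ℝ, 0 < x → x ≤ a → HasDerivAt f (f' x) x := fun x h1 h2 =>
    hasDerivAt_re_weierstrassP (hne x h1 h2)
  -- At ω₁ the derivative vanishes, so (c − q)² = 4q³ there; this fails for q ≤ 0 because c > 0.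
  have hfa : f a < 1 / 12 := by
    have h1 := h.cubic (hne a ha0 le_rfl)
    rw [derivWeierstrassP_half (two_mul_fst_mem p), ← weierstrassP_real] at h1
    have h2 : (0 : ℝ) = (c - (1 / 12 - f a)) ^ 2 - 4 * (1 / 12 - f a) ^ 3 := by
      apply Complex.ofReal_injective
      push_cast
      rw [← h1]; norm_num
    by_contra hlt
    push Not at hlt
    have h3 : 0 ≤ -(1 / 12 - f a) := by linarith
    have h4 := pow_nonneg h3 3
    have h5 : 0 < c - (1 / 12 - f a) := by linarith
    have h6 := pow_pos h5 2
    nlinarith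
  obtain ⟨e, he0, hea, hfe⟩ : ∃ e : ℝ, 0 < e ∧ e < a ∧ 1 / 12 < f e := by
    have ht : Tendsto (fun x : ℝ => (x : ℂ)) (𝓝[>] 0) (𝓝[≠] 0) := by
      apply tendsto_nhdsWithin_iff.mpr
      constructor
      · have : ContinuousAt (fun x : ℝ => (x : ℂ)) 0 := by fun_prop
        have := this.tendsto.mono_left (nhdsWithin_le_nhds (s := Ioi 0))
        simpa using this
      · filter_upwards [self_mem_nhdsWithin] with x hx
        have hx : 0 < x := hx
        simp [hx.ne']
    have h1 := (Complex.continuous_re.tendsto _).comp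
      ((tendsto_sq_mul_weierstrassP p.lattice).comp ht)
    have h2 : Tendsto (fun x : ℝ => x ^ 2 * f x) (𝓝[>] 0) (𝓝 1) := by
      refine (h1.congr fun x => ?_)
      simp only [Function.comp, hf]
      rw [← Complex.ofReal_pow, Complex.re_ofReal_mul]
    have h3 : ∀ᶠ x : ℝ in 𝓝[>] 0, 1 / 2 < x ^ 2 * f x := h2.eventually (lt_mem_nhds (by norm_num))
    have h4 : ∀ᶠ x : ℝ in 𝓝[>] 0, x < min a 1 :=
      nhdsWithin_le_nhds (gt_mem_nhds (lt_min ha0 one_pos))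
    obtain ⟨x, ⟨h5, h6⟩, h7⟩ := ((h3.and h4).and self_mem_nhdsWithin).exists
    have h7 : 0 < x := h7
    refine ⟨x, h7, h6.trans_le (min_le_left _ _), ?_⟩
    have h8 : x < 1 := h6.trans_le (min_le_right _ _)
    by_contra hlt
    push Not at hlt
    nlinarith [mul_le_mul_of_nonneg_left hlt (sq_nonneg x)]
  have hcont : ContinuousOn f (Icc e a) := fun x hx =>
    (hd x (he0.trans_le hx.1) hx.2).continuousAt.continuousWithinAt
  obtain ⟨t, ht, hft⟩ := intermediate_value_Ioo' hea.le hcont ⟨hfa, hfe⟩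
  have ht0 : 0 < t := he0.trans ht.1
  -- The mean value theorem gives one point with ℘' < 0. As ℘' has no zero on (0, ω₁), it is
  -- negative at t too, which picks −c from ℘'(t)² = c².
  obtain ⟨x, hx, hfx⟩ := exists_hasDerivAt_eq_slope f f' ht.1
    (hcont.mono (Icc_subset_Icc_right ht.2.le))
    (fun x hx => hd x (he0.trans hx.1) (hx.2.trans ht.2).le)
  have hx0 : 0 < x := he0.trans hx.1
  have hneg : f' x < 0 := by
    rw [hfx]
    exact div_neg_of_neg_of_pos (by linarith) (by linarith [ht.1])
  have hc' : ContinuousOn f' (Icc x t) := by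
    intro u hu
    have := ((p.lattice.analyticOnNhd_derivWeierstrassP u
      (hne u (hx0.trans_le hu.1) (hu.2.trans ht.2.le)))).continuousAt
    exact ((Complex.continuous_re.continuousAt).comp
      (this.comp Complex.continuous_ofReal.continuousAt)).continuousWithinAt
  have hneg' : f' t ≤ 0 := by
    by_contra hpos
    push Not at hpos
    obtain ⟨u, hu, hu0⟩ := intermediate_value_Ioo hx.2.le hc' ⟨hneg, hpos⟩
    apply derivWeierstrassP_ne_zero (p := p) (hx0.trans hu.1) (hu.2.trans ht.2)
    rw [← derivWeierstrassP_real]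
    simpa using hu0
  refine ⟨t, ht0, ht.2, ?_, ?_⟩
  · rw [← weierstrassP_real]
    have : f t = 1 / 12 := hft
    simp only [hf] at this
    rw [this]; norm_num
  · have h1 := h.cubic (hne t ht0 ht.2.le)
    rw [← derivWeierstrassP_real, ← weierstrassP_real] at h1
    have h2 : f' t ^ 2 = (c - (1 / 12 - f t)) ^ 2 - 4 * (1 / 12 - f t) ^ 3 := by
      apply Complex.ofReal_injective
      push_cast
      exact h1
    have hft' : f t = 1 / 12 := hft
    rw [hft'] at h2
    have h3 : f' t = -c := by
      have h4 : (f' t - c) * (f' t + c) = 0 := by ring_nf at h2 ⊢; linarith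
      rcases mul_eq_zero.mp h4 with h5 | h5 <;> linarith
    rw [← derivWeierstrassP_real]
    have : (p.lattice.derivWeierstrassP t).re = -c := h3
    rw [this]; norm_num

/-- Translation by a point `t` with `℘(t) = 1/12` and `℘'(t) = -c`. -/
lemma IsHalfPeriods.translation (h : IsHalfPeriods c p) (hc : 0 < c) {t : ℂ}
    (ht : t ∉ p.lattice.lattice) (ht1 : p.lattice.weierstrassP t = 1 / 12)
    (ht2 : p.lattice.derivWeierstrassP t = -c) {z : ℂ} (hz : z ∉ p.lattice.lattice)
    (hzt : z + t ∉ p.lattice.lattice) :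
    (1 / 12 - p.lattice.weierstrassP (z + t)) *
      (1 / 12 - p.lattice.weierstrassP z - c + p.lattice.derivWeierstrassP z) =
      2 * c * (1 / 12 - p.lattice.weierstrassP z) := by
  set L := p.lattice with hL
  have hc0 : (c : ℂ) ≠ 0 := by exact_mod_cast hc.ne'
  set P := L.weierstrassP with hP
  set P' := L.derivWeierstrassP with hP'
  set f := L.weierstrassPExcept 0 with hf
  set g := L.derivWeierstrassPExcept 0 with hg
  have af : AnalyticAt ℂ f 0 := L.analyticAt_weierstrassPExcept 0
  have ag : AnalyticAt ℂ g 0 := L.analyticAt_derivWeierstrassPExcept 0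
  -- `N` and `M` are q and q − c + ℘' multiplied by z³, so that their quotient extends analytically
  -- over the pole at 0.
  set N : ℂ → ℂ := fun z => z ^ 3 / 12 - z - z ^ 3 * f z with hN
  set M : ℂ → ℂ := fun z => z ^ 3 * (1 / 12 - f z - c + g z) - z - 2 with hM
  have aN : AnalyticAt ℂ N 0 := by fun_prop
  have aM : AnalyticAt ℂ M 0 := by fun_prop
  have hM0 : M 0 = -2 := by simp [hM]
  have hN0 : N 0 = 0 := by simp [hN]
  set W : ℂ → ℂ := fun z => 2 * N z / M z with hW
  set w : ℂ → ℂ := fun z => (1 / 12 - P (z + t)) / c with hw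
  have aW : AnalyticAt ℂ W 0 := (analyticAt_const.fun_mul aN).fun_div aM (by rw [hM0]; norm_num)
  have aPt : AnalyticAt ℂ (fun z => P (z + t)) 0 :=
    AnalyticAt.comp (g := P) (f := fun z => z + t)
      (by simpa using L.analyticOnNhd_weierstrassP t ht) (by fun_prop)
  have aw : AnalyticAt ℂ w 0 := (analyticAt_const.fun_sub aPt).fun_div analyticAt_const hc0
  have hmulN : ∀ u : ℂ, u ≠ 0 → N u = u ^ 3 * (1 / 12 - P u) := by
    intro u hu
    simp only [hN, hP]; rw [weierstrassP_eq_except]; field_simp; ring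
  have hmulM : ∀ u : ℂ, u ≠ 0 → M u = u ^ 3 * (1 / 12 - P u - c + P' u) := by
    intro u hu
    simp only [hM, hP, hP']; rw [weierstrassP_eq_except, derivWeierstrassP_eq_except]; field_simp
    ring
  have hWu : ∀ u : ℂ, u ≠ 0 → W u = 2 * (1 / 12 - P u) / (1 / 12 - P u - c + P' u) := by
    intro u hu
    simp only [hW]
    rw [hmulN u hu, hmulM u hu, mul_left_comm, mul_div_mul_left _ _ (pow_ne_zero 3 hu)]
  have hMne : ∀ᶠ u in 𝓝 (0 : ℂ), M u ≠ 0 :=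
    aM.continuousAt.eventually_ne (by rw [hM0]; norm_num)
  have hlt : ∀ᶠ u in 𝓝 (0 : ℂ), u + t ∉ L.lattice := by
    have : ContinuousAt (fun u : ℂ => u + t) 0 := by fun_prop
    exact this (by simpa using compl_lattice_mem_nhds L ht)
  have hne0 : ∀ u : ℂ, u ∉ L.lattice → u ≠ 0 := by
    rintro u hu rfl; exact hu L.lattice.zero_mem
  -- both `W` and `w` solve the same first order equation
  have odeW : ∀ u, u ∉ L.lattice → M u ≠ 0 → deriv W u ^ 2 = (1 - W u) ^ 2 - 4 * c * W u ^ 3 := by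
    intro u hu hMu
    have hu0 := hne0 u hu
    have hE : 1 / 12 - P u - c + P' u ≠ 0 := by
      intro h0; apply hMu; rw [hmulM u hu0, h0, mul_zero]
    have d0 := hasDerivAt_weierstrassP L hu
    have d1 := (L.analyticOnNhd_derivWeierstrassP u hu).differentiableAt.hasDerivAt
    rw [h.second_order hu] at d1
    have d2 := ((d0.const_sub (1 / 12)).const_mul 2).fun_div
      (((d0.const_sub (1 / 12)).sub_const (c : ℂ)).fun_add d1) hE
    have d3 : HasDerivAt W _ u := d2.congr_of_eventuallyEq (by
      filter_upwards [compl_lattice_mem_nhds L hu] with v hv using hWu v (hne0 v hv))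
    rw [d3.deriv, hWu u hu0]
    have hX := h.cubic hu
    change P' u ^ 2 = (c - (1 / 12 - P u)) ^ 2 - 4 * (1 / 12 - P u) ^ 3 at hX
    simp only [← hP, ← hP', ← hL] at hE ⊢
    generalize hq : 1 / 12 - P u = q at hE hX ⊢
    generalize P' u = X at hE hX ⊢
    have e1 : (q - c + X) * (q - c + X - 2 * q) = (c - q) ^ 2 - 4 * q ^ 3 - 2 * c * X + c ^ 2 - q ^ 2 := by
      linear_combination hX
    have e2 : -X * (q - c + X) - q * (-X + (c - q + 6 * q ^ 2)) = c * X - (c ^ 2 - c * q + 2 * q ^ 3) := by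
      linear_combination -hX
    have e3 : (2 * -X * (q - c + X) - 2 * q * (-X + (c - q + 6 * q ^ 2))) ^ 2 =
        ((q - c + X) * (q - c + X - 2 * q)) ^ 2 - 32 * c * q ^ 3 * (q - c + X) := by
      rw [e1]
      have : 2 * -X * (q - c + X) - 2 * q * (-X + (c - q + 6 * q ^ 2)) =
        2 * (c * X - (c ^ 2 - c * q + 2 * q ^ 3)) := by rw [← e2]; ring
      rw [this]
      ring
    field_simp
    linear_combination e3
  have odew : ∀ u, u + t ∉ L.lattice → deriv w u ^ 2 = (1 - w u) ^ 2 - 4 * c * w u ^ 3 := by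
    intro u hu
    have d0 := (((hasDerivAt_weierstrassP L hu).comp_add_const u t).const_sub (1 / 12)).div_const
      (c : ℂ)
    have hX := h.cubic hu
    rw [d0.deriv]
    simp only [hw]
    change P' (u + t) ^ 2 = _ at hX
    change (-P' (u + t) / c) ^ 2 = _
    field_simp
    linear_combination 12 ^ 3 * hX
  have dW0 : deriv W 0 = 1 := by
    have dN : HasDerivAt N (-1) 0 := by
      have d1 := ((hasDerivAt_pow 3 (0 : ℂ)).div_const 12).fun_sub (hasDerivAt_id (0 : ℂ))
      have d2 := (hasDerivAt_pow 3 (0 : ℂ)).fun_mul af.differentiableAt.hasDerivAt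
      have := d1.fun_sub d2
      simpa using this
    have := (dN.const_mul 2).fun_div aM.differentiableAt.hasDerivAt (by rw [hM0]; norm_num)
    rw [this.deriv, hM0, hN0]; norm_num
  have dw0 : deriv w 0 = 1 := by
    have d0 := (((hasDerivAt_weierstrassP L (z := 0 + t) (by simpa)).comp_add_const 0 t).const_sub
      (1 / 12)).div_const (c : ℂ)
    rw [d0.deriv, zero_add]
    change -(P' t) / c = 1
    rw [ht2]; field_simp
  -- The first order equation is quadratic in the derivative, and u' = 0 is excluded by W'(0) =
  -- w'(0) = 1. Subtracting yields A(0) = 2 and B(0) = 0, so the only index is n = 0, which W(0) =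
  -- w(0) = 0 rules out.
  have key := eventually_eq_zero_of_mul_deriv_eq (D := fun z => W z - w z)
    (A := fun z => deriv W z + deriv w z)
    (B := fun z => z * (W z + w z - 2 - 4 * c * (W z ^ 2 + W z * w z + w z ^ 2)))
    (aW.fun_sub aw) (aW.deriv.continuousAt.add aw.deriv.continuousAt)
    (by have := aW.continuousAt; have := aw.continuousAt; fun_prop)
    (by
      filter_upwards [punctured_compl_lattice L, nhdsWithin_le_nhds hMne, nhdsWithin_le_nhds hlt,
        nhdsWithin_le_nhds aW.eventually_analyticAt, nhdsWithin_le_nhds aw.eventually_analyticAt]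
        with u h1 h2 h3 h4 h5
      rw [deriv_fun_sub h4.differentiableAt h5.differentiableAt]
      linear_combination u * odeW u h1 h2 - u * odew u h3)
    (by
      intro n hn
      have h1 : 1 ≤ n := hn (by simp [hW, hN0, hw, ht1])
      rw [dW0, dw0]
      simp only [zero_mul]
      have : (n : ℂ) ≠ 0 := by exact_mod_cast (by omega : n ≠ 0)
      exact mul_ne_zero this (by norm_num))
  -- extension to the whole plane
  set U : Set ℂ := ((L.lattice : Set ℂ) ∪ (fun v => v + t) ⁻¹' (L.lattice : Set ℂ))ᶜ with hUdef
  have hcount : ((L.lattice : Set ℂ) ∪ (fun v => v + t) ⁻¹' (L.lattice : Set ℂ)).Countable := by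
    refine (countable_lattice L).union ((countable_lattice L).preimage_of_injOn ?_)
    intro a _ b _ hab
    simpa using hab
  have hU : IsPreconnected U :=
    (hcount.isPathConnected_compl_of_one_lt_rank (by simp)).isConnected.isPreconnected
  have aP : AnalyticOnNhd ℂ P U := fun v hv => L.analyticOnNhd_weierstrassP v (fun h => hv (.inl h))
  have aP' : AnalyticOnNhd ℂ P' U :=
    fun v hv => L.analyticOnNhd_derivWeierstrassP v (fun h => hv (.inl h))
  have aP2 : AnalyticOnNhd ℂ (fun v => P (v + t)) U := fun v hv =>
    AnalyticAt.comp (g := P) (f := fun v => v + t)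
      (L.analyticOnNhd_weierstrassP _ (fun h => hv (.inr h))) (by fun_prop)
  obtain ⟨y, hy, hyU⟩ : ∃ y, (∀ᶠ u in 𝓝 y, (W u - w u = 0 ∧ M u ≠ 0)) ∧ y ∈ U := by
    obtain ⟨y, h1, h2, h3⟩ := (((key.and hMne).eventually_nhds.filter_mono nhdsWithin_le_nhds).and
      ((punctured_compl_lattice L).and (hlt.filter_mono nhdsWithin_le_nhds))).exists
    exact ⟨y, h1, by simp only [hUdef, mem_compl_iff, mem_union, not_or]; exact ⟨h2, h3⟩⟩
  have hEq : EqOn (fun z => (1 / 12 - P (z + t)) * (1 / 12 - P z - c + P' z))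
      (fun z => 2 * c * (1 / 12 - P z)) U := by
    refine AnalyticOnNhd.eqOn_of_preconnected_of_eventuallyEq (𝕜 := ℂ) (z₀ := y) ?_ ?_ hU hyU ?_
    · exact fun v hv => (analyticAt_const.fun_sub (aP2 v hv)).fun_mul
        (((analyticAt_const.fun_sub (aP v hv)).fun_sub analyticAt_const).fun_add (aP' v hv))
    · exact fun v hv => analyticAt_const.fun_mul (analyticAt_const.fun_sub (aP v hv))
    · filter_upwards [hy, compl_lattice_mem_nhds L (fun h => hyU (.inl h))] with u hu huL
      have hu0 := hne0 u huL
      have hE : 1 / 12 - P u - c + P' u ≠ 0 := by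
        intro h0; apply hu.2; rw [hmulM u hu0, h0, mul_zero]
      have e := sub_eq_zero.mp hu.1
      rw [hWu u hu0] at e
      simp only [hw] at e
      rw [div_eq_div_iff hE hc0] at e
      linear_combination -e
  exact hEq (x := z) (by simp only [hUdef, mem_compl_iff, mem_union, not_or]; exact ⟨hz, hzt⟩)

/-- The point `2 ω₁ / 3`. -/
lemma IsHalfPeriods.third (h : IsHalfPeriods c p) (hc : 0 < c) :
    p.lattice.weierstrassP (2 * p.1.1 / 3 : ℝ) = 1 / 12 ∧
      p.lattice.derivWeierstrassP (2 * p.1.1 / 3 : ℝ) = -c := by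
  obtain ⟨t, ht0, hta, ht1, ht2⟩ := h.exists_third hc
  have ha := p.2.1
  have hc0 : (c : ℂ) ≠ 0 := by exact_mod_cast hc.ne'
  have htL := real_notMem_lattice p ht0 (by linarith)
  have h2t := real_notMem_lattice p (x := t + t) (by linarith) (by linarith)
  push_cast at h2t
  -- Translating t by itself gives ℘(2t) = 1/12, so ℘'(2t) = ±c and 2t ≡ ±t. The sign + would put t
  -- in the lattice. Hence 3t is a period in (0, 3ω₁), and 2ω₁ is the only one.
  have h3 := h.translation hc htL ht1 ht2 htL h2t
  rw [ht1, ht2] at h3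
  have h4 : p.lattice.weierstrassP (t + t) = 1 / 12 := by
    have h5 : (1 / 12 - p.lattice.weierstrassP (t + t)) * (-2 * c) = 0 := by linear_combination h3
    have := (mul_eq_zero.mp h5).resolve_right (by simp [hc0])
    linear_combination -this
  have h5 := h.cubic h2t
  rw [h4] at h5
  have h6 : (p.lattice.derivWeierstrassP (t + t) + c) *
      (p.lattice.derivWeierstrassP (t + t) - c) = 0 := by linear_combination h5
  rcases mul_eq_zero.mp h6 with h7 | h7
  · have := sub_mem_lattice_of_weierstrassP_eq _ h2t htL (h4.trans ht1.symm)
      (by rw [ht2]; linear_combination h7)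
    rw [add_sub_cancel_right] at this
    exact absurd this htL
  · have := add_mem_lattice_of_weierstrassP_eq _ h2t htL (h4.trans ht1.symm)
      (by rw [ht2]; linear_combination h7)
    rw [mem_rect_lattice] at this
    obtain ⟨⟨m, hm⟩, -⟩ := this
    simp at hm
    have hm1 : (0 : ℝ) < m := by by_contra h; push Not at h; nlinarith
    have hm2 : (m : ℝ) < 2 := by by_contra h; push Not at h; nlinarith
    have hm3 : m = 1 := by norm_cast at hm1 hm2; omega
    subst hm3
    have : t = 2 * p.1.1 / 3 := by push_cast at hm; linarith
    rw [← this]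
    exact ⟨ht1, ht2⟩

end Translation

end HitchinCP2

namespace HitchinCP2

open Filter Topology

/-! ### The functions on the horizontal line through `ω₂` -/

section Line

/-- `1/12 - ℘(ω₂ + x)`. -/
noncomputable def lineQ (p : HalfPeriods) (x : ℝ) : ℝ :=
  1 / 12 - (p.lattice.weierstrassP (p.1.2 * Complex.I + x)).re

/-- The derivative of `lineQ`. -/
noncomputable def lineQ' (p : HalfPeriods) (x : ℝ) : ℝ :=
  -(p.lattice.derivWeierstrassP (p.1.2 * Complex.I + x)).re

/-- The function `c / (1/12 - ℘(ω₂ + x))`. -/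
noncomputable def lineY (c : ℝ) (p : HalfPeriods) (x : ℝ) : ℝ := c / lineQ p x

variable {c : ℝ} {p : HalfPeriods}

lemma ofReal_lineQ (p : HalfPeriods) (x : ℝ) :
    (lineQ p x : ℂ) = 1 / 12 - p.lattice.weierstrassP (p.1.2 * Complex.I + x) := by
  rw [lineQ]; push_cast; rw [weierstrassP_line]

lemma ofReal_lineQ' (p : HalfPeriods) (x : ℝ) :
    (lineQ' p x : ℂ) = -p.lattice.derivWeierstrassP (p.1.2 * Complex.I + x) := by
  rw [lineQ']; push_cast; rw [derivWeierstrassP_line]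

lemma hasDerivAt_lineQ (p : HalfPeriods) (x : ℝ) : HasDerivAt (lineQ p) (lineQ' p x) x := by
  have h := (hasDerivAt_weierstrassP p.lattice (line_notMem_lattice p x)).comp_const_add
    (p.1.2 * Complex.I : ℂ) (x : ℂ)
  exact h.real_of_complex.const_sub (1 / 12)

lemma continuous_lineQ (p : HalfPeriods) : Continuous (lineQ p) :=
  continuous_iff_continuousAt.mpr fun x => (hasDerivAt_lineQ p x).continuousAt

lemma lineQ_periodic (p : HalfPeriods) : Function.Periodic (lineQ p) (2 * p.1.1) := by
  intro x
  rw [lineQ, lineQ]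
  have := p.lattice.weierstrassP_add_coe (p.1.2 * Complex.I + x) ⟨_, two_mul_fst_mem p⟩
  rw [← this]
  push_cast
  rw [add_assoc]

lemma lineQ_neg (p : HalfPeriods) (x : ℝ) : lineQ p (-x) = lineQ p x := by
  rw [lineQ, lineQ, ← p.lattice.weierstrassP_neg,
    ← p.lattice.weierstrassP_add_coe _ ⟨_, two_mul_snd_mem p⟩]
  congr 3
  push_cast; ring

lemma lineQ'_neg (p : HalfPeriods) (x : ℝ) : lineQ' p (-x) = -lineQ' p x := by
  have h1 := (hasDerivAt_lineQ p (-x)).deriv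
  have h2 := deriv_comp_neg (f := lineQ p) (x := x)
  simp only [lineQ_neg] at h2
  rw [(hasDerivAt_lineQ p x).deriv, h1] at h2
  linarith

lemma lineQ'_half (p : HalfPeriods) : lineQ' p p.1.1 = 0 := by
  have : p.lattice.derivWeierstrassP (p.1.2 * Complex.I + (p.1.1 : ℂ)) = 0 := by
    apply derivWeierstrassP_half
    have := add_mem (two_mul_snd_mem p) (two_mul_fst_mem p)
    rwa [← mul_add] at this
  rw [lineQ', this]; simp

lemma exists_lineQ_le (p : HalfPeriods) : ∃ m, (∀ x, lineQ p m ≤ lineQ p x) ∧ lineQ' p m = 0 := by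
  have hcpt := (lineQ_periodic p).compact_of_continuous
    (by have := p.2.1; positivity) (continuous_lineQ p)
  obtain ⟨_, ⟨m, rfl⟩, hm⟩ := hcpt.exists_isLeast (range_nonempty _)
  have hm' : ∀ x, lineQ p m ≤ lineQ p x := fun x => hm ⟨x, rfl⟩
  refine ⟨m, hm', ?_⟩
  exact (IsLocalMin.hasDerivAt_eq_zero (Eventually.of_forall hm') (hasDerivAt_lineQ p m))

lemma exists_le_lineQ (p : HalfPeriods) : ∃ m, (∀ x, lineQ p x ≤ lineQ p m) ∧ lineQ' p m = 0 := by
  have hcpt := (lineQ_periodic p).compact_of_continuous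
    (by have := p.2.1; positivity) (continuous_lineQ p)
  obtain ⟨_, ⟨m, rfl⟩, hm⟩ := hcpt.exists_isGreatest (range_nonempty _)
  have hm' : ∀ x, lineQ p x ≤ lineQ p m := fun x => hm ⟨x, rfl⟩
  refine ⟨m, hm', ?_⟩
  exact (IsLocalMax.hasDerivAt_eq_zero (Eventually.of_forall hm') (hasDerivAt_lineQ p m))

/-- Constancy on a real line would give ℘' an accumulation point of zeros. -/
lemma not_forall_lineQ_eq (p : HalfPeriods) (C : ℝ) : ¬ ∀ x, lineQ p x = C := by
  intro h
  have h' : ∀ x, lineQ' p x = 0 := fun x =>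
    (hasDerivAt_lineQ p x).unique ((hasDerivAt_const x C).congr_of_eventuallyEq
      (Eventually.of_forall h))
  have h0 := line_notMem_lattice p 0
  have ha := p.lattice.analyticOnNhd_derivWeierstrassP _ h0
  refine not_eventually_derivWeierstrassP_eq_zero _ h0 (ha.frequently_zero_iff_eventually_zero.mp ?_)
  have ht : Tendsto (fun x : ℝ => (p.1.2 * Complex.I + x : ℂ)) (𝓝[≠] 0)
      (𝓝[≠] (p.1.2 * Complex.I + (0 : ℝ))) := by
    apply tendsto_nhdsWithin_iff.mpr
    constructor
    · have : ContinuousAt (fun x : ℝ => (p.1.2 * Complex.I + x : ℂ)) 0 := by fun_prop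
      exact this.tendsto.mono_left nhdsWithin_le_nhds
    · filter_upwards [self_mem_nhdsWithin] with x hx
      have hx : x ≠ 0 := hx
      simpa using hx
  refine ht.frequently (Eventually.frequently (Eventually.of_forall fun x => ?_))
  have := ofReal_lineQ' p x
  rw [h'] at this
  simpa using this.symm

/-- The invariant `g₂` of a rectangular lattice is positive. -/
lemma g₂_re_pos (p : HalfPeriods) : 0 < (p.lattice.g₂).re := by
  have hcub : ∀ x, lineQ' p x ^ 2 = 4 * (1 / 12 - lineQ p x) ^ 3 -
      (p.lattice.g₂).re * (1 / 12 - lineQ p x) - (p.lattice.g₃).re := by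
    intro x
    have h1 := p.lattice.derivWeierstrassP_sq _ (line_notMem_lattice p x)
    apply Complex.ofReal_injective
    push_cast
    rw [ofReal_lineQ, ofReal_lineQ', g₂_real, g₃_real]
    linear_combination h1
  obtain ⟨m, hm, hm'⟩ := exists_lineQ_le p
  obtain ⟨M, hM, hM'⟩ := exists_le_lineQ p
  have hlt : lineQ p m < lineQ p M := by
    refine lt_of_le_of_ne (hm M) fun he => ?_
    exact not_forall_lineQ_eq p (lineQ p m) fun x => le_antisymm (he ▸ hM x) (hm x)
  -- At the minimum and the maximum ℘ takes two distinct real values e, e' that are roots of the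
  -- cubic; hence g₂ = 4(e² + ee' + e'²) > 0.
  have e3 : (lineQ p M - lineQ p m) * ((p.lattice.g₂).re - 4 * ((1 / 12 - lineQ p m) ^ 2 +
      (1 / 12 - lineQ p m) * (1 / 12 - lineQ p M) + (1 / 12 - lineQ p M) ^ 2)) = 0 := by
    have e1 := hcub m
    have e2 := hcub M
    rw [hm'] at e1
    rw [hM'] at e2
    linear_combination e1 - e2
  have e4 := (mul_eq_zero.mp e3).resolve_left (by linarith)
  nlinarith [sq_nonneg ((1 / 12 - lineQ p m) + (1 / 12 - lineQ p M)),
    mul_pos (sub_pos.mpr hlt) (sub_pos.mpr hlt), sq_nonneg (1 / 12 - lineQ p m),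
    sq_nonneg (1 / 12 - lineQ p M)]

namespace IsHalfPeriods

lemma lineQ'_sq (h : IsHalfPeriods c p) (x : ℝ) :
    lineQ' p x ^ 2 = (c - lineQ p x) ^ 2 - 4 * lineQ p x ^ 3 := by
  have h1 := h.cubic (line_notMem_lattice p x)
  apply Complex.ofReal_injective
  push_cast
  rw [ofReal_lineQ, ofReal_lineQ']
  linear_combination h1

/-- At the minimum q' = 0, so (c − q)² = 4q³. For q ≤ 0 the left side would be positive and the
right side not. -/
lemma lineQ_pos (h : IsHalfPeriods c p) (hc : 0 < c) (x : ℝ) : 0 < lineQ p x := by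
  obtain ⟨m, hm, hm'⟩ := exists_lineQ_le p
  refine lt_of_lt_of_le ?_ (hm x)
  have h1 := h.lineQ'_sq m
  rw [hm'] at h1
  by_contra hlt
  push Not at hlt
  have h3 : 0 ≤ -lineQ p m := by linarith
  have h4 := pow_nonneg h3 3
  have h5 : 0 < c - lineQ p m := by linarith
  have h6 := pow_pos h5 2
  nlinarith

lemma lineQ_add_third (h : IsHalfPeriods c p) (hc : 0 < c) (x : ℝ) :
    lineQ p (x + 2 * p.1.1 / 3) * (lineQ p x - c - lineQ' p x) = 2 * c * lineQ p x := by
  have hL := line_notMem_lattice p (x + 2 * p.1.1 / 3)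
  obtain ⟨h1, h2⟩ := h.third hc
  have h3 := h.translation hc (t := (2 * p.1.1 / 3 : ℝ))
    (real_notMem_lattice p (by have := p.2.1; positivity) (by have := p.2.1; linarith)) h1 h2
    (line_notMem_lattice p x) (by push_cast at hL ⊢; rwa [add_assoc])
  apply Complex.ofReal_injective
  push_cast
  rw [ofReal_lineQ, ofReal_lineQ, ofReal_lineQ']
  rw [add_assoc, ← Complex.ofReal_add] at h3
  linear_combination h3

lemma lineY_pos (h : IsHalfPeriods c p) (hc : 0 < c) (x : ℝ) : 0 < lineY c p x :=
  div_pos hc (h.lineQ_pos hc x)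

/-- This value and the one at x − 2ω₁/3 are the two roots of Y² − (1 − c/q)Y + q, written with q' as
square root of the cubic. Sum, product and the differential equation follow from this pair of
formulas. -/
lemma lineY_add_third (h : IsHalfPeriods c p) (hc : 0 < c) (x : ℝ) :
    lineY c p (x + 2 * p.1.1 / 3) = (lineQ p x - c - lineQ' p x) / (2 * lineQ p x) := by
  have h1 := h.lineQ_add_third hc x
  have h2 := h.lineQ_pos hc x
  have h3 := h.lineQ_pos hc (x + 2 * p.1.1 / 3)
  rw [lineY, div_eq_div_iff h3.ne' (by positivity)]
  linear_combination -h1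

lemma lineY_sub_third (h : IsHalfPeriods c p) (hc : 0 < c) (x : ℝ) :
    lineY c p (x - 2 * p.1.1 / 3) = (lineQ p x - c + lineQ' p x) / (2 * lineQ p x) := by
  have h1 := h.lineY_add_third hc (-x)
  rw [lineQ_neg, lineQ'_neg] at h1
  rw [show x - 2 * p.1.1 / 3 = -(-x + 2 * p.1.1 / 3) by ring, lineY, lineQ_neg]
  rw [lineY] at h1
  rw [h1]; ring

end IsHalfPeriods

lemma lineY_periodic (c : ℝ) (p : HalfPeriods) : Function.Periodic (lineY c p) (2 * p.1.1) := by
  intro x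
  rw [lineY, lineQ_periodic p x, lineY]

lemma lineY_neg (c : ℝ) (p : HalfPeriods) (x : ℝ) : lineY c p (-x) = lineY c p x := by
  rw [lineY, lineQ_neg, lineY]

namespace IsHalfPeriods

lemma lineY_sum (h : IsHalfPeriods c p) (hc : 0 < c) (x : ℝ) :
    lineY c p (x + 2 * p.1.1 / 3) + lineY c p (x - 2 * p.1.1 / 3) + lineY c p x = 1 := by
  have h2 := h.lineQ_pos hc x
  rw [h.lineY_add_third hc, h.lineY_sub_third hc, lineY]
  field_simp
  ring

lemma lineY_mul (h : IsHalfPeriods c p) (hc : 0 < c) (x : ℝ) :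
    lineY c p (x + 2 * p.1.1 / 3) * lineY c p (x - 2 * p.1.1 / 3) = lineQ p x := by
  have h2 := h.lineQ_pos hc x
  rw [h.lineY_add_third hc, h.lineY_sub_third hc]
  field_simp
  linear_combination -h.lineQ'_sq x

lemma lineY_prod (h : IsHalfPeriods c p) (hc : 0 < c) (x : ℝ) :
    lineY c p (x + 2 * p.1.1 / 3) * lineY c p (x - 2 * p.1.1 / 3) * lineY c p x = c := by
  have h2 := h.lineQ_pos hc x
  rw [h.lineY_mul hc, lineY]
  field_simp

/-- The Lotka-Volterra equation: (c/q)' = (c/q)·(−q'/q), and −q'/q is the difference of the two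
shifted values. -/
lemma hasDerivAt_lineY (h : IsHalfPeriods c p) (hc : 0 < c) (x : ℝ) :
    HasDerivAt (lineY c p)
      (lineY c p x * (lineY c p (x + 2 * p.1.1 / 3) - lineY c p (x - 2 * p.1.1 / 3))) x := by
  have h2 := h.lineQ_pos hc x
  have := (hasDerivAt_const x c).fun_div (hasDerivAt_lineQ p x) h2.ne'
  convert! this using 1
  rw [h.lineY_add_third hc, h.lineY_sub_third hc, lineY]
  field_simp
  ring

lemma lineY_add_two_thirds (x : ℝ) :
    lineY c p (x + 2 * p.1.1 / 3 + 2 * p.1.1 / 3) = lineY c p (x - 2 * p.1.1 / 3) := by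
  rw [← lineY_periodic c p (x - 2 * p.1.1 / 3)]; congr 1; ring

lemma lineY_sub_two_thirds (x : ℝ) :
    lineY c p (x - 2 * p.1.1 / 3 - 2 * p.1.1 / 3) = lineY c p (x + 2 * p.1.1 / 3) := by
  rw [← lineY_periodic c p (x - 2 * p.1.1 / 3 - 2 * p.1.1 / 3)]; congr 1; ring

lemma hasDerivAt_lineY_add (h : IsHalfPeriods c p) (hc : 0 < c) (x : ℝ) :
    HasDerivAt (fun x => lineY c p (x + 2 * p.1.1 / 3))
      (lineY c p (x + 2 * p.1.1 / 3) * (lineY c p (x - 2 * p.1.1 / 3) - lineY c p x)) x := by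
  have := (h.hasDerivAt_lineY hc (x + 2 * p.1.1 / 3)).comp_add_const x (2 * p.1.1 / 3)
  rwa [lineY_add_two_thirds, add_sub_cancel_right] at this

lemma hasDerivAt_lineY_sub (h : IsHalfPeriods c p) (hc : 0 < c) (x : ℝ) :
    HasDerivAt (fun x => lineY c p (x - 2 * p.1.1 / 3))
      (lineY c p (x - 2 * p.1.1 / 3) * (lineY c p x - lineY c p (x + 2 * p.1.1 / 3))) x := by
  have := (h.hasDerivAt_lineY hc (x - 2 * p.1.1 / 3)).comp_sub_const x (2 * p.1.1 / 3)
  rwa [lineY_sub_two_thirds, sub_add_cancel] at this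

/-- On the imaginary axis `1/12 - ℘` stays above `3 c`. -/
lemma three_mul_lt_lineQ_zero (h : IsHalfPeriods c p) (hc : 0 < c) (hc' : c < 1 / 27) :
    3 * c < lineQ p 0 := by
  set b := p.1.2 with hb
  have hb0 : 0 < b := p.2.2
  set f : ℝ → ℝ := fun x => 1 / 12 - (p.lattice.weierstrassP (x * Complex.I)).re with hf
  have hne : ∀ x : ℝ, 0 < x → x ≤ b → (x * Complex.I : ℂ) ∉ p.lattice.lattice := fun x h1 h2 =>
    imag_notMem_lattice p h1 (by linarith)
  -- On the imaginary axis ℘' is imaginary, so ℘'² ≤ 0. The value q = 3c would give 4c² ≤ 108c³,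
  -- against c < 1/27; since q → +∞ at the pole, it stays above 3c.
  have hcub : ∀ x : ℝ, 0 < x → x ≤ b → (c - f x) ^ 2 ≤ 4 * f x ^ 3 := by
    intro x h1 h2
    have e := h.cubic (hne x h1 h2)
    have hre : (p.lattice.derivWeierstrassP (x * Complex.I)).re = 0 := by
      have h3 := conj_derivWeierstrassP p (x * Complex.I)
      have h4 : (starRingEnd ℂ) (x * Complex.I) = -(x * Complex.I) := by simp
      rw [h4, p.lattice.derivWeierstrassP_neg] at h3
      have := congrArg Complex.re h3
      simp only [Complex.conj_re, Complex.neg_re] at this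
      linarith
    rw [← weierstrassP_imag] at e
    have e2 : ((p.lattice.derivWeierstrassP (x * Complex.I)) ^ 2).re =
        (c - f x) ^ 2 - 4 * f x ^ 3 := by
      rw [e, ← Complex.ofReal_re ((c - f x) ^ 2 - 4 * f x ^ 3)]
      simp only [hf]; push_cast; rfl
    rw [sq (p.lattice.derivWeierstrassP (x * Complex.I)), Complex.mul_re, hre] at e2
    nlinarith [sq_nonneg (p.lattice.derivWeierstrassP (x * Complex.I)).im]
  have hfb : lineQ p 0 = f b := by simp [lineQ, hf, hb]
  rw [hfb]
  obtain ⟨e, he0, hea, hfe⟩ : ∃ e : ℝ, 0 < e ∧ e < b ∧ 3 * c < f e := by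
    have ht : Tendsto (fun x : ℝ => (x * Complex.I : ℂ)) (𝓝[>] 0) (𝓝[≠] 0) := by
      apply tendsto_nhdsWithin_iff.mpr
      constructor
      · have : ContinuousAt (fun x : ℝ => (x * Complex.I : ℂ)) 0 := by fun_prop
        have := this.tendsto.mono_left (nhdsWithin_le_nhds (s := Ioi 0))
        simpa using this
      · filter_upwards [self_mem_nhdsWithin] with x hx
        have hx : 0 < x := hx
        simp [hx.ne']
    have h1 := (Complex.continuous_re.tendsto _).comp
      ((tendsto_sq_mul_weierstrassP p.lattice).comp ht)
    have h2 : Tendsto (fun x : ℝ => x ^ 2 * (f x - 1 / 12)) (𝓝[>] 0) (𝓝 1) := by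
      refine (h1.congr fun x => ?_)
      simp only [Function.comp, hf]
      rw [mul_pow, Complex.I_sq, mul_neg_one, ← Complex.ofReal_pow, neg_mul, Complex.neg_re,
        Complex.re_ofReal_mul]
      ring
    have h3 : ∀ᶠ x : ℝ in 𝓝[>] 0, 1 / 2 < x ^ 2 * (f x - 1 / 12) :=
      h2.eventually (lt_mem_nhds (by norm_num))
    have h4 : ∀ᶠ x : ℝ in 𝓝[>] 0, x < min b 1 :=
      nhdsWithin_le_nhds (gt_mem_nhds (lt_min hb0 one_pos))
    obtain ⟨x, ⟨h5, h6⟩, h7⟩ := ((h3.and h4).and self_mem_nhdsWithin).exists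
    have h7 : 0 < x := h7
    refine ⟨x, h7, h6.trans_le (min_le_left _ _), ?_⟩
    have h8 : x < 1 := h6.trans_le (min_le_right _ _)
    by_contra hlt
    push Not at hlt
    nlinarith [mul_le_mul_of_nonneg_left hlt (sq_nonneg x)]
  have hcont : ContinuousOn f (Icc e b) := by
    intro x hx
    have h1 := (p.lattice.analyticOnNhd_weierstrassP _
      (hne x (he0.trans_le hx.1) hx.2)).continuousAt
    have h2 : ContinuousAt (fun x : ℝ => (x * Complex.I : ℂ)) x := by fun_prop
    have h3 := Complex.continuous_re.continuousAt.comp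
      (ContinuousAt.comp (f := fun x : ℝ => (x * Complex.I : ℂ)) (x := x) h1 h2)
    exact (continuousAt_const.sub h3).continuousWithinAt
  by_contra hlt
  push Not at hlt
  obtain ⟨x, hx, hfx⟩ := intermediate_value_Icc' hea.le hcont ⟨hlt, hfe.le⟩
  have := hcub x (he0.trans_le hx.1) hx.2
  rw [hfx] at this
  nlinarith [mul_pos hc hc]

/-- Fixes the branch of the initial value: y³ < 1/3 at x = 0, hence y¹ = y² > 1/3 there. -/
lemma lineY_zero_lt (h : IsHalfPeriods c p) (hc : 0 < c) (hc' : c < 1 / 27) :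
    lineY c p 0 < 1 / 3 := by
  have := h.three_mul_lt_lineQ_zero hc hc'
  rw [lineY, div_lt_iff₀ (by linarith)]
  linarith

end IsHalfPeriods

end Line

end HitchinCP2

namespace HitchinCP2

open Filter Topology

/-! ### Existence of the half-periods -/

section Existence

lemma G_eq_tsum (p : HalfPeriods) (n : ℕ) : p.lattice.G n =
    ∑' x : ℤ × ℤ, ((x.1 * (2 * p.1.1) + x.2 * (2 * (p.1.2 * Complex.I)) : ℂ) ^ n)⁻¹ := by
  rw [PeriodPair.G, ← p.lattice.latticeEquivProd.symm.toEquiv.tsum_eq]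
  refine tsum_congr fun x => ?_
  have := p.lattice.latticeEquiv_symm_apply x
  simp only [HalfPeriods.lattice] at this
  simp only [LinearEquiv.coe_toEquiv]
  rw [← this]
  rfl

lemma G_smul {p q : HalfPeriods} {r : ℝ} (h1 : q.1.1 = r * p.1.1)
    (h2 : q.1.2 = r * p.1.2) (n : ℕ) : q.lattice.G n = ((r : ℂ) ^ n)⁻¹ * p.lattice.G n := by
  rw [G_eq_tsum, G_eq_tsum, ← tsum_mul_left]
  refine tsum_congr fun x => ?_
  rw [h1, h2, ← mul_inv, ← mul_pow]
  push_cast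
  ring_nf

/-- Interchanging the half-periods amounts to multiplying the lattice by i. -/
lemma G_swap {p q : HalfPeriods} (h1 : q.1.1 = p.1.2) (h2 : q.1.2 = p.1.1) (n : ℕ) :
    q.lattice.G n = (Complex.I ^ n)⁻¹ * p.lattice.G n := by
  rw [G_eq_tsum, G_eq_tsum, ← tsum_mul_left,
    ← ((Equiv.prodComm ℤ ℤ).trans ((Equiv.neg ℤ).prodCongr (Equiv.refl ℤ))).tsum_eq]
  refine tsum_congr fun x => ?_
  rw [h1, h2, ← mul_inv, ← mul_pow]
  simp only [Equiv.trans_apply, Equiv.prodComm_apply, Equiv.prodCongr_apply, Prod.map,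
    Equiv.refl_apply, Equiv.neg_apply, Prod.fst_swap, Prod.snd_swap]
  congr 2
  push_cast
  linear_combination (-(x.2 : ℂ) * (2 * p.1.2)) * Complex.I_sq

/-- The half-periods `1` and `exp r`. -/
noncomputable def expPair (r : ℝ) : HalfPeriods := ⟨(1, exp r), one_pos, exp_pos r⟩

lemma summable_latticeTerm {n : ℕ} (hn : 2 < n) :
    Summable fun x : ℤ × ℤ => ‖((x.1 * 2 + x.2 * (2 * Complex.I) : ℂ) ^ n)⁻¹‖ := by
  have h1 := ZLattice.summable_norm_pow_inv (expPair 0).lattice.lattice n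
    (by rw [ZLattice.rank ℝ]; simpa using hn)
  have h2 := (expPair 0).lattice.latticeEquivProd.symm.toEquiv.summable_iff.mpr h1
  refine h2.congr fun x => ?_
  have := (expPair 0).lattice.latticeEquiv_symm_apply x
  simp only [HalfPeriods.lattice, expPair] at this
  simp only [Function.comp, LinearEquiv.coe_toEquiv, norm_inv, norm_pow, inv_pow]
  congr 2
  refine (congrArg norm this).trans ?_
  simp

/-- Comparison with the square lattice, uniform in t ≥ d. It dominates the series both for
continuity in t and for the limit t → ∞. -/
lemma norm_latticeTerm_le {d t : ℝ} (hd : 0 < d) (hd1 : d ≤ 1) (ht : d ≤ t) (n : ℕ) (x : ℤ × ℤ) :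
    ‖((x.1 * 2 + x.2 * (2 * (t * Complex.I)) : ℂ) ^ n)⁻¹‖ ≤
      (d ^ n)⁻¹ * ‖((x.1 * 2 + x.2 * (2 * Complex.I) : ℂ) ^ n)⁻¹‖ := by
  by_cases hx : x = 0
  · subst hx; simp
    rcases Nat.eq_zero_or_pos n with rfl | hn
    · simp
    · rw [zero_pow hn.ne']; simp
  have hpos : 0 < ‖(x.1 * 2 + x.2 * (2 * Complex.I) : ℂ)‖ := by
    rw [norm_pos_iff]
    intro h
    have h1 := congrArg Complex.re h
    have h2 := congrArg Complex.im h
    simp at h1 h2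
    exact hx (Prod.ext h1 h2)
  have hle : d * ‖(x.1 * 2 + x.2 * (2 * Complex.I) : ℂ)‖ ≤
      ‖(x.1 * 2 + x.2 * (2 * (t * Complex.I)) : ℂ)‖ := by
    apply le_of_sq_le_sq _ (norm_nonneg _)
    rw [mul_pow, Complex.sq_norm, Complex.sq_norm, Complex.normSq_apply, Complex.normSq_apply]
    simp
    have h1 : d ^ 2 ≤ 1 := by nlinarith
    have h2 : d ^ 2 ≤ t ^ 2 := by nlinarith
    nlinarith [mul_le_mul_of_nonneg_left h1 (sq_nonneg (x.1 : ℝ)),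
      mul_le_mul_of_nonneg_left h2 (sq_nonneg (x.2 : ℝ))]
  rw [norm_inv, norm_inv, norm_pow, norm_pow, ← mul_inv, ← mul_pow]
  gcongr

lemma G_expPair (n : ℕ) (r : ℝ) : (expPair r).lattice.G n =
    ∑' x : ℤ × ℤ, ((x.1 * 2 + x.2 * (2 * ((exp r : ℝ) * Complex.I)) : ℂ) ^ n)⁻¹ := by
  rw [G_eq_tsum]
  simp [expPair]

lemma continuous_G {n : ℕ} (hn : 2 < n) : Continuous fun r => (expPair r).lattice.G n := by
  simp only [G_expPair]
  rw [continuous_iff_continuousAt]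
  intro r₀
  set d := min 1 (exp (r₀ - 1)) with hd
  have hd0 : 0 < d := lt_min one_pos (exp_pos _)
  have hcont : ContinuousOn (fun r : ℝ => ∑' x : ℤ × ℤ,
      ((x.1 * 2 + x.2 * (2 * ((exp r : ℝ) * Complex.I)) : ℂ) ^ n)⁻¹) (Ioi (r₀ - 1)) := by
    refine continuousOn_tsum (fun x => ?_) ((summable_latticeTerm hn).mul_left ((d ^ n)⁻¹))
      (fun x r hr => norm_latticeTerm_le hd0 (min_le_left _ _)
        ((min_le_right _ _).trans (exp_le_exp.mpr (le_of_lt hr))) n x)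
    by_cases hx : x = 0
    · subst hx; simp; exact continuousOn_const
    refine Continuous.continuousOn (Continuous.inv₀ (by fun_prop) fun r => pow_ne_zero n fun h => ?_)
    have h1 := congrArg Complex.re h
    have h2 := congrArg Complex.im h
    simp [-Complex.ofReal_exp] at h1 h2
    exact hx (Prod.ext h1 h2)
  exact hcont.continuousAt (Ioi_mem_nhds (by linarith))

/-- As the imaginary period escapes to infinity, only the row of real lattice points survives. -/
lemma tendsto_G {n : ℕ} (hn : 2 < n) (he : Even n) :
    Tendsto (fun r => (expPair r).lattice.G n) atTop (𝓝 ((2 ^ n)⁻¹ * (2 * riemannZeta n))) := by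
  simp only [G_expPair]
  have hlim : ((2 ^ n)⁻¹ * (2 * riemannZeta n) : ℂ) =
      ∑' x : ℤ × ℤ, if x.2 = 0 then ((x.1 * 2 : ℂ) ^ n)⁻¹ else 0 := by
    rw [two_mul_riemannZeta_eq_tsum_int_inv_pow_of_even (by omega) he, ← tsum_mul_left,
      ← (Prod.mk_left_injective (0 : ℤ)).tsum_eq (f := fun x : ℤ × ℤ => if x.2 = 0 then
        ((x.1 * 2 : ℂ) ^ n)⁻¹ else 0)]
    · refine tsum_congr fun m => ?_
      simp [mul_pow]
    · intro x hx
      have : x.2 = 0 := by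
        by_contra h
        simp [h] at hx
      exact ⟨x.1, by ext <;> simp [this]⟩
  rw [hlim]
  refine tendsto_tsum_of_dominated_convergence ((summable_latticeTerm hn).mul_left ((1 ^ n)⁻¹))
    (fun x => ?_) ?_
  · by_cases hx : x.2 = 0
    · simp [hx]
    · simp only [hx, if_false]
      rw [tendsto_zero_iff_norm_tendsto_zero]
      have h1 : Tendsto (fun r : ℝ => (exp r)⁻¹) atTop (𝓝 0) := tendsto_exp_atTop.inv_tendsto_atTop
      refine squeeze_zero' (Eventually.of_forall fun _ => norm_nonneg _) ?_ h1
      filter_upwards [eventually_ge_atTop 0] with r hr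
      rw [norm_inv, norm_pow]
      have hr1 : 1 ≤ exp r := one_le_exp hr
      have h2 : exp r ≤ ‖(x.1 * 2 + x.2 * (2 * ((exp r : ℝ) * Complex.I)) : ℂ)‖ := by
        refine le_trans ?_ (Complex.abs_im_le_norm _)
        simp [-Complex.ofReal_exp]
        have h3 : (1 : ℝ) ≤ |(x.2 : ℝ)| := by exact_mod_cast Int.one_le_abs hx
        nlinarith [exp_pos r]
      gcongr
      exact h2.trans (le_self_pow₀ (hr1.trans h2) (by omega))
  · filter_upwards [eventually_ge_atTop 0] with r hr x
    exact norm_latticeTerm_le one_pos le_rfl (one_le_exp hr) n x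

lemma riemannZeta_six : riemannZeta 6 = π ^ 6 / 945 := by
  have h := riemannZeta_two_mul_nat (k := 3) (by norm_num)
  have h5 : bernoulli' 5 = 0 := by
    rw [bernoulli'_def]; norm_num [Finset.sum_range_succ, Nat.choose]
  have h6 : bernoulli' 6 = 1 / 42 := by
    rw [bernoulli'_def]; norm_num [Finset.sum_range_succ, Nat.choose, h5]
  rw [bernoulli_eq_bernoulli'_of_ne_one (by decide), h6] at h
  norm_num [Nat.factorial] at h
  rw [h]; ring

/-- The normalized invariant `g₃ / g₂^{3/2}` of the lattice with half-periods `1`, `i exp r`. -/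
noncomputable def modInv (r : ℝ) : ℝ :=
  ((expPair r).lattice.g₃).re / (((expPair r).lattice.g₂).re * √((expPair r).lattice.g₂).re)

lemma continuous_modInv : Continuous modInv := by
  have h2 : Continuous fun r => ((expPair r).lattice.g₂).re :=
    Complex.continuous_re.comp ((continuous_G (n := 4) (by norm_num)).const_mul 60)
  have h3 : Continuous fun r => ((expPair r).lattice.g₃).re :=
    Complex.continuous_re.comp ((continuous_G (n := 6) (by norm_num)).const_mul 140)
  refine h3.div (h2.mul (Real.continuous_sqrt.comp h2)) fun r => ?_
  have := g₂_re_pos (expPair r)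
  positivity

/-- The limit is 27^{-1/2}, the value at which the discriminant g₂³ − 27g₃² degenerates. -/
lemma tendsto_modInv : Tendsto modInv atTop (𝓝 (π ^ 6 / 216 / (π ^ 4 / 12 * √(π ^ 4 / 12)))) := by
  have h4 := (tendsto_G (n := 4) (by norm_num) (by decide)).const_mul 60
  have h6 := (tendsto_G (n := 6) (by norm_num) (by decide)).const_mul 140
  have e2 : Tendsto (fun r => ((expPair r).lattice.g₂).re) atTop (𝓝 (π ^ 4 / 12)) := by
    have := (Complex.continuous_re.tendsto _).comp h4
    convert! this using 2
    rw [Nat.cast_ofNat, riemannZeta_four, show (60 * ((2 ^ 4)⁻¹ * (2 * (π ^ 4 / 90))) : ℂ) =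
      ((π ^ 4 / 12 : ℝ) : ℂ) by push_cast; ring, Complex.ofReal_re]
  have e3 : Tendsto (fun r => ((expPair r).lattice.g₃).re) atTop (𝓝 (π ^ 6 / 216)) := by
    have := (Complex.continuous_re.tendsto _).comp h6
    convert! this using 2
    rw [Nat.cast_ofNat, riemannZeta_six, show (140 * ((2 ^ 6)⁻¹ * (2 * (π ^ 6 / 945))) : ℂ) =
      ((π ^ 6 / 216 : ℝ) : ℂ) by push_cast; ring, Complex.ofReal_re]
  exact e3.div (e2.mul ((Real.continuous_sqrt.tendsto _).comp e2)) (by positivity)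

lemma g₂_re_smul {p q : HalfPeriods} {r : ℝ} (h1 : q.1.1 = r * p.1.1) (h2 : q.1.2 = r * p.1.2) :
    (q.lattice.g₂).re = (p.lattice.g₂).re / r ^ 4 := by
  rw [PeriodPair.g₂, PeriodPair.g₂, G_smul h1 h2, show 60 * (((r : ℂ) ^ 4)⁻¹ * p.lattice.G 4) =
    ((r ^ 4)⁻¹ : ℝ) * (60 * p.lattice.G 4) by push_cast; ring, Complex.re_ofReal_mul]
  ring

lemma g₃_re_smul {p q : HalfPeriods} {r : ℝ} (h1 : q.1.1 = r * p.1.1) (h2 : q.1.2 = r * p.1.2) :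
    (q.lattice.g₃).re = (p.lattice.g₃).re / r ^ 6 := by
  rw [PeriodPair.g₃, PeriodPair.g₃, G_smul h1 h2, show 140 * (((r : ℂ) ^ 6)⁻¹ * p.lattice.G 6) =
    ((r ^ 6)⁻¹ : ℝ) * (140 * p.lattice.G 6) by push_cast; ring, Complex.re_ofReal_mul]
  ring

lemma sqrt_sqrt_pow_four {u : ℝ} (hu : 0 ≤ u) : √(√u) ^ 4 = u := by
  rw [show √(√u) ^ 4 = (√(√u) ^ 2) ^ 2 by ring, sq_sqrt (sqrt_nonneg u), sq_sqrt hu]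

/-- Any rectangular lattice is a multiple of one with half-periods `1`, `i exp r`; the normalized
invariant determines the ratio of the third to the second invariant. -/
lemma modInv_of_smul {p : HalfPeriods} {r : ℝ} (h : p.1.2 = p.1.1 * exp r) :
    modInv r = (p.lattice.g₃).re / ((p.lattice.g₂).re * √(p.lattice.g₂).re) := by
  have ha := p.2.1
  have h1 : p.1.1 = p.1.1 * (expPair r).1.1 := by simp [expPair]
  have h2 : p.1.2 = p.1.1 * (expPair r).1.2 := h
  have hg := g₂_re_pos (expPair r)
  rw [g₂_re_smul h1 h2, g₃_re_smul h1 h2, modInv, sqrt_div hg.le,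
    show p.1.1 ^ 4 = (p.1.1 ^ 2) ^ 2 by ring, sqrt_sq (by positivity)]
  have : 0 < √((expPair r).lattice.g₂).re := sqrt_pos.mpr hg
  field_simp

/-- Since g₂ has weight −4, scaling one lattice by the fourth root of the quotient equates both
invariants. The lattices then coincide, which forces the scale to be 1. -/
lemma injective_modInv : Function.Injective modInv := by
  intro r s hrs
  have hr := g₂_re_pos (expPair r)
  have hs := g₂_re_pos (expPair s)
  set u := ((expPair r).lattice.g₂).re with hu
  set v := ((expPair s).lattice.g₂).re with hv
  have hl : 0 < √(√(u / v)) := by positivity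
  set l := √(√(u / v)) with hldef
  let q : HalfPeriods := ⟨(l * 1, l * exp r), by simpa using hl, mul_pos hl (exp_pos r)⟩
  have e2 : (q.lattice.g₂).re = v := by
    rw [g₂_re_smul (p := expPair r) (q := q) (r := l) rfl rfl, ← hu, hldef,
      sqrt_sqrt_pow_four (by positivity)]
    field_simp
  have e3 : (q.lattice.g₃).re = ((expPair s).lattice.g₃).re := by
    have h1 := modInv_of_smul (p := q) (r := r) (by simp [q])
    rw [hrs, e2, modInv, ← hv] at h1
    have : 0 < v * √v := by positivity
    field_simp at h1
    linarith
  have hq : q = expPair s := by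
    apply halfPeriods_eq_of_invariants
    · rw [← g₂_real q, ← g₂_real (expPair s), e2]
    · rw [← g₃_real q, ← g₃_real (expPair s), e3]
  have h1 : l * 1 = 1 := congrArg (fun p : HalfPeriods => p.1.1) hq
  have h2 : l * exp r = exp s := congrArg (fun p : HalfPeriods => p.1.2) hq
  rw [mul_one] at h1
  rw [h1, one_mul] at h2
  exact exp_injective h2

/-- Inverting the ratio of periods multiplies the lattice by i up to scale, which preserves g₂ and
changes the sign of g₃. -/
lemma modInv_neg (r : ℝ) : modInv (-r) = -modInv r := by
  let q : HalfPeriods := ⟨(exp r, 1), exp_pos r, one_pos⟩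
  rw [modInv_of_smul (p := q) (r := -r) (by simp [q, ← exp_add]), modInv]
  have h2 : q.lattice.g₂ = (expPair r).lattice.g₂ := by
    rw [PeriodPair.g₂, PeriodPair.g₂, G_swap (p := expPair r) (q := q) rfl rfl, Complex.I_pow_four]
    simp
  have h3 : q.lattice.g₃ = -(expPair r).lattice.g₃ := by
    rw [PeriodPair.g₃, PeriodPair.g₃, G_swap (p := expPair r) (q := q) rfl rfl,
      show 6 = 4 + 2 by norm_num, pow_add, Complex.I_pow_four]
    simp
  rw [h2, h3, Complex.neg_re, neg_div]

end Existence

end HitchinCP2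

namespace HitchinCP2

open Filter Topology

/-! ### Solving for the half-periods, and their continuity in c. -/

section Existence

/-- The prescribed normalized invariant. -/
noncomputable def modInvOf (c : ℝ) : ℝ :=
  (c / 6 - 1 / 216 - c ^ 2) / ((1 / 12 - 2 * c) * √(1 / 12 - 2 * c))

lemma isHalfPeriods_iff {c : ℝ} {p : HalfPeriods} : IsHalfPeriods c p ↔
    (p.lattice.g₂).re = 1 / 12 - 2 * c ∧ (p.lattice.g₃).re = c / 6 - 1 / 216 - c ^ 2 := by
  have e2 : (p.lattice.g₂ = 1 / 12 - 2 * (c : ℂ)) ↔ (p.lattice.g₂).re = 1 / 12 - 2 * c := by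
    rw [← g₂_real p, ← Complex.ofReal_inj]; push_cast; simp only [Complex.ofReal_re]
  have e3 : (p.lattice.g₃ = (c : ℂ) / 6 - 1 / 216 - (c : ℂ) ^ 2) ↔
      (p.lattice.g₃).re = c / 6 - 1 / 216 - c ^ 2 := by
    rw [← g₃_real p, ← Complex.ofReal_inj]; push_cast; simp only [Complex.ofReal_re]
  rw [IsHalfPeriods, e2, e3]

/-- The identity g₂³ − 27g₃² = c³(1 − 27c) puts the prescribed value strictly between the limits
±27^{-1/2} at ±∞. -/
lemma exists_modInv_eq {c : ℝ} (hc : 0 < c) (hc' : c < 1 / 27) : ∃ r, modInv r = modInvOf c := by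
  set l := π ^ 6 / 216 / (π ^ 4 / 12 * √(π ^ 4 / 12)) with hl
  have hl0 : 0 < l := by have := pi_pos; positivity
  have hl2 : l ^ 2 = 1 / 27 := by
    have hp := pi_pos
    rw [hl, div_pow, mul_pow, sq_sqrt (by positivity)]
    field_simp
    norm_num
  have hA : 0 < 1 / 12 - 2 * c := by linarith
  have hJ : modInvOf c ^ 2 < l ^ 2 := by
    rw [hl2, modInvOf, div_pow, mul_pow, sq_sqrt hA.le, div_lt_div_iff₀ (by positivity) (by norm_num)]
    have : 0 < c ^ 3 * (1 - 27 * c) := mul_pos (pow_pos hc 3) (by linarith)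
    nlinarith
  have hJ' : |modInvOf c| < l := abs_lt_of_sq_lt_sq hJ hl0.le
  obtain ⟨R, hR⟩ := (tendsto_modInv.eventually (lt_mem_nhds hJ')).exists
  refine mem_range_of_exists_le_of_exists_ge continuous_modInv ⟨-R, ?_⟩ ⟨R, ?_⟩
  · rw [modInv_neg]
    linarith [neg_abs_le (modInvOf c)]
  · linarith [le_abs_self (modInvOf c)]

lemma exists_isHalfPeriods {c : ℝ} (hc : 0 < c) (hc' : c < 1 / 27) :
    ∃ p, IsHalfPeriods c p := by
  obtain ⟨r, hr⟩ := exists_modInv_eq hc hc'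
  have hA : 0 < 1 / 12 - 2 * c := by linarith
  have hg := g₂_re_pos (expPair r)
  set u := ((expPair r).lattice.g₂).re with hu
  have hl : 0 < √(√(u / (1 / 12 - 2 * c))) := by positivity
  set l := √(√(u / (1 / 12 - 2 * c))) with hldef
  let q : HalfPeriods := ⟨(l * 1, l * exp r), by simpa using hl, mul_pos hl (exp_pos r)⟩
  have e2 : (q.lattice.g₂).re = 1 / 12 - 2 * c := by
    rw [g₂_re_smul (p := expPair r) (q := q) (r := l) rfl rfl, ← hu, hldef,
      sqrt_sqrt_pow_four (by positivity)]
    field_simp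
  refine ⟨q, isHalfPeriods_iff.mpr ⟨e2, ?_⟩⟩
  have h1 := modInv_of_smul (p := q) (r := r) (by simp [q])
  rw [hr, e2, modInvOf] at h1
  have : 0 < (1 / 12 - 2 * c) * √(1 / 12 - 2 * c) := by positivity
  rw [div_left_inj' this.ne'] at h1
  exact h1.symm

lemma isHalfPeriods_halfPeriods {c : ℝ} (hc : c ∈ Ioo (0 : ℝ) (1 / 27)) :
    IsHalfPeriods c (halfPeriods c) :=
  Classical.epsilon_spec (exists_isHalfPeriods hc.1 hc.2)

lemma isHalfPeriods_iff_eq {c : ℝ} (hc : c ∈ Ioo (0 : ℝ) (1 / 27)) (p : HalfPeriods) :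
    IsHalfPeriods c p ↔ p = halfPeriods c := by
  have h := isHalfPeriods_halfPeriods hc
  refine ⟨fun hp => ?_, fun hp => hp ▸ h⟩
  exact halfPeriods_eq_of_invariants (hp.1.trans h.1.symm) (hp.2.trans h.2.symm)

/-- The logarithm of the ratio of the half-periods. -/
noncomputable def logRatio (c : ℝ) : ℝ := log ((halfPeriods c).1.2 / (halfPeriods c).1.1)

lemma snd_halfPeriods (c : ℝ) :
    (halfPeriods c).1.2 = (halfPeriods c).1.1 * exp (logRatio c) := by
  have h1 := (halfPeriods c).2.1
  have h2 := (halfPeriods c).2.2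
  rw [logRatio, exp_log (div_pos h2 h1)]
  field_simp

lemma modInv_logRatio {c : ℝ} (hc : c ∈ Ioo (0 : ℝ) (1 / 27)) :
    modInv (logRatio c) = modInvOf c := by
  have h := isHalfPeriods_iff.mp (isHalfPeriods_halfPeriods hc)
  rw [modInv_of_smul (snd_halfPeriods c), h.1, h.2, modInvOf]

lemma continuousAt_of_strictMono_comp {j r : ℝ → ℝ} {c₀ : ℝ} (hj : StrictMono j)
    (h : ContinuousAt (fun c => j (r c)) c₀) : ContinuousAt r c₀ := by
  rw [ContinuousAt, tendsto_order]
  refine ⟨fun a ha => ?_, fun a ha => ?_⟩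
  · filter_upwards [h.eventually (lt_mem_nhds (hj ha))] with c hc using hj.lt_iff_lt.mp hc
  · filter_upwards [h.eventually (gt_mem_nhds (hj ha))] with c hc using hj.lt_iff_lt.mp hc

/-- `modInv` is continuous and injective, hence strictly monotone, so its inverse is continuous. -/
lemma continuousAt_logRatio {c : ℝ} (hc : c ∈ Ioo (0 : ℝ) (1 / 27)) :
    ContinuousAt logRatio c := by
  have hA : 0 < 1 / 12 - 2 * c := by linarith [hc.2]
  have h1 : ContinuousAt modInvOf c := by
    unfold modInvOf
    refine ContinuousAt.div (by fun_prop) (by fun_prop) ?_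
    have : 0 < √(1 / 12 - 2 * c) := sqrt_pos.mpr hA
    positivity
  have h2 : ContinuousAt (fun c => modInv (logRatio c)) c := by
    refine h1.congr ?_
    filter_upwards [Ioo_mem_nhds hc.1 hc.2] with d hd using (modInv_logRatio hd).symm
  rcases continuous_modInv.strictMono_of_inj injective_modInv with h | h
  · exact continuousAt_of_strictMono_comp h h2
  · refine continuousAt_of_strictMono_comp (j := fun r => -modInv r) (fun a b hab => ?_) h2.neg
    exact neg_lt_neg (h hab)

lemma omega1_pos (c : ℝ) : 0 < omega1 c := (halfPeriods c).2.1

lemma omega1_eq {c : ℝ} (hc : c ∈ Ioo (0 : ℝ) (1 / 27)) : omega1 c =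
    √(√(((expPair (logRatio c)).lattice.g₂).re / (1 / 12 - 2 * c))) := by
  have h := (isHalfPeriods_iff.mp (isHalfPeriods_halfPeriods hc)).1
  have ha := omega1_pos c
  rw [g₂_re_smul (p := expPair (logRatio c)) (r := omega1 c) (by simp [expPair, omega1])
    (snd_halfPeriods c)] at h
  have hA : 0 < 1 / 12 - 2 * c := by linarith [hc.2]
  have h1 : ((expPair (logRatio c)).lattice.g₂).re / (1 / 12 - 2 * c) = (omega1 c ^ 2) ^ 2 := by
    rw [div_eq_iff hA.ne', ← h]
    field_simp
  rw [h1, sqrt_sq (by positivity), sqrt_sq ha.le]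

/-- Continuity is needed before smoothness: it tells the implicit function theorem which zero of y¹
− y² to follow. -/
lemma continuousAt_omega1 {c : ℝ} (hc : c ∈ Ioo (0 : ℝ) (1 / 27)) : ContinuousAt omega1 c := by
  have hA : 0 < 1 / 12 - 2 * c := by linarith [hc.2]
  have h2 : Continuous fun r => ((expPair r).lattice.g₂).re :=
    Complex.continuous_re.comp ((continuous_G (n := 4) (by norm_num)).const_mul 60)
  have h3 : ContinuousAt (fun c => ((expPair (logRatio c)).lattice.g₂).re) c :=
    h2.continuousAt.comp (continuousAt_logRatio hc)
  have h4 : ContinuousAt (fun c =>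
      √(√(((expPair (logRatio c)).lattice.g₂).re / (1 / 12 - 2 * c)))) c :=
    (h3.div (by fun_prop) hA.ne').sqrt.sqrt
  refine h4.congr ?_
  filter_upwards [Ioo_mem_nhds hc.1 hc.2] with d hd using (omega1_eq hd).symm

end Existence

end HitchinCP2

namespace HitchinCP2

open Filter Topology

/-! ### The Weierstrass zeta function -/

section Zeta

variable (L : PeriodPair)

/-- The three parts of a summand combine to z²/(l²(z − l)), which is O(|l|⁻³) for |l| ≥ 2|z|. -/
lemma hasSum_weierstrassZeta (z : ℂ) : HasSum
    (fun l : L.lattice => 1 / (z - (l : ℂ)) + 1 / (l : ℂ) + z / (l : ℂ) ^ 2)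
    (weierstrassZeta L z) := by
  have : HasSumLocallyUniformly
      (fun (l : L.lattice) (z : ℂ) => 1 / (z - (l : ℂ)) + 1 / (l : ℂ) + z / (l : ℂ) ^ 2)
      (weierstrassZeta L) := by
    refine L.hasSumLocallyUniformly_aux (u := (2 * · ^ 2 * ‖·‖ ^ (-3 : ℝ))) _
      (fun r _ => (ZLattice.summable_norm_rpow _ _ (by simp; norm_num)).mul_left _) fun r hr => ?_
    filter_upwards [eventually_ge_atTop (2 * r)] with R hR x hx l hl
    have hl' : 2 * r ≤ ‖(l : ℂ)‖ := hl ▸ hR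
    have hlpos : 0 < ‖(l : ℂ)‖ := by linarith
    have hl0 : (l : ℂ) ≠ 0 := norm_pos_iff.mp hlpos
    have hxl : ‖(l : ℂ)‖ / 2 ≤ ‖x - (l : ℂ)‖ := by
      have := norm_sub_norm_le (l : ℂ) x
      rw [norm_sub_rev]
      linarith
    have hxl0 : x - (l : ℂ) ≠ 0 := norm_pos_iff.mp (by linarith)
    have e : 1 / (x - (l : ℂ)) + 1 / (l : ℂ) + x / (l : ℂ) ^ 2 =
        x ^ 2 / ((l : ℂ) ^ 2 * (x - l)) := by
      field_simp; ring
    rw [e, norm_div, norm_mul, norm_pow, norm_pow]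
    have e2 : 2 * r ^ 2 * ‖l‖ ^ (-3 : ℝ) = r ^ 2 / (‖(l : ℂ)‖ ^ 2 * (‖(l : ℂ)‖ / 2)) := by
      rw [rpow_neg (norm_nonneg _), show (3 : ℝ) = ((3 : ℕ) : ℝ) by norm_num, rpow_natCast]
      change 2 * r ^ 2 * (‖(l : ℂ)‖ ^ 3)⁻¹ = _
      field_simp
    rw [e2]
    gcongr
  exact this.hasSum

lemma hasDerivAt_weierstrassZeta {z : ℂ} (hz : z ∉ L.lattice) :
    HasDerivAt (weierstrassZeta L) (-L.weierstrassP z) z := by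
  have h1 := (L.hasSumLocallyUniformly_weierstrassP.tendstoLocallyUniformlyOn
    (s := (L.lattice : Set ℂ)ᶜ)).fun_neg
  refine hasDerivAt_of_tendstoLocallyUniformlyOn (s := (L.lattice : Set ℂ)ᶜ)
    (f := fun (s : Finset L.lattice) z => ∑ l ∈ s, (1 / (z - (l : ℂ)) + 1 / (l : ℂ) +
      z / (l : ℂ) ^ 2)) L.isClosed_lattice.isOpen_compl h1
    (Eventually.of_forall fun s x hx => ?_) (fun x _ => hasSum_weierstrassZeta L x) hz
  rw [← Finset.sum_neg_distrib]
  refine HasDerivAt.fun_sum fun l _ => ?_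
  have hxl : x - (l : ℂ) ≠ 0 := by
    intro h
    rw [sub_eq_zero] at h
    exact hx (h ▸ l.2)
  have h2 := ((hasDerivAt_const x (1 : ℂ)).fun_div ((hasDerivAt_id x).sub_const (l : ℂ)) hxl)
  have h3 := (h2.add_const (1 / (l : ℂ))).fun_add ((hasDerivAt_id x).div_const ((l : ℂ) ^ 2))
  convert! h3 using 1
  simp
  ring

lemma weierstrassZeta_neg (z : ℂ) : weierstrassZeta L (-z) = -weierstrassZeta L z := by
  rw [weierstrassZeta, weierstrassZeta, ← tsum_neg, ← (Equiv.neg L.lattice).tsum_eq]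
  refine tsum_congr fun l => ?_
  simp only [Equiv.neg_apply, NegMemClass.coe_neg]
  rw [show -z - -(l : ℂ) = -(z - l) by ring, one_div_neg_eq_neg_one_div,
    one_div_neg_eq_neg_one_div, neg_sq]
  ring

/-- The increment over a period has zero derivative on the connected complement of the lattice.
Evaluated at −w, oddness gives 2ζ(w). -/
lemma weierstrassZeta_add {w z : ℂ} (hw : 2 * w ∈ L.lattice) (hw' : w ∉ L.lattice)
    (hz : z ∉ L.lattice) :
    weierstrassZeta L (z + 2 * w) = weierstrassZeta L z + 2 * weierstrassZeta L w := by
  have hmem : ∀ u, u ∉ L.lattice → u + 2 * w ∉ L.lattice := fun u hu h =>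
    hu (by simpa using sub_mem h hw)
  have hd : ∀ u, u ∉ L.lattice →
      HasDerivAt (fun u => weierstrassZeta L (u + 2 * w) - weierstrassZeta L u) 0 u := by
    intro u hu
    have h1 := ((hasDerivAt_weierstrassZeta L (hmem u hu)).comp_add_const u (2 * w)).fun_sub
      (hasDerivAt_weierstrassZeta L hu)
    rw [L.weierstrassP_add_coe u ⟨_, hw⟩] at h1
    simpa using h1
  obtain ⟨C, hC⟩ := L.isClosed_lattice.isOpen_compl.exists_is_const_of_deriv_eq_zero
    (isPreconnected_compl_lattice L)
    (fun u hu => (hd u hu).differentiableAt.differentiableWithinAt) (fun u hu => (hd u hu).deriv)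
  have h1 := hC z hz
  have h2 := hC (-w) (by simpa using hw')
  simp only [weierstrassZeta_neg] at h1 h2
  rw [show -w + 2 * w = w by ring] at h2
  linear_combination h1 - h2

/-- `ζ(ω₂ + x) - ζ(ω₂) + x / 12`. -/
noncomputable def lineZ (p : HalfPeriods) (x : ℝ) : ℝ :=
  (weierstrassZeta p.lattice (p.1.2 * Complex.I + x) -
    weierstrassZeta p.lattice (p.1.2 * Complex.I)).re + x / 12

lemma hasDerivAt_weierstrassZeta_line (p : HalfPeriods) (x : ℝ) :
    HasDerivAt (fun x : ℝ => weierstrassZeta p.lattice (p.1.2 * Complex.I + x) -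
      weierstrassZeta p.lattice (p.1.2 * Complex.I)) ((lineQ p x - 1 / 12 : ℝ) : ℂ) x := by
  have h := ((hasDerivAt_weierstrassZeta p.lattice (line_notMem_lattice p x)).comp_const_add
    (p.1.2 * Complex.I : ℂ) (x : ℂ)).comp_ofReal
  convert! h.sub_const _ using 1
  push_cast
  rw [ofReal_lineQ]; ring

lemma hasDerivAt_lineZ (p : HalfPeriods) (x : ℝ) : HasDerivAt (lineZ p) (lineQ p x) x := by
  have h1 := hasDerivAt_weierstrassZeta_line p x
  have h2 := Complex.reCLM.hasFDerivAt.comp_hasDerivAt x h1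
  have h3 := h2.add ((hasDerivAt_id x).div_const 12)
  convert! h3 using 1
  simp

/-- The derivative q − 1/12 along the line is real and the difference vanishes at x = 0, so its
imaginary part is zero. -/
lemma ofReal_lineZ (p : HalfPeriods) (x : ℝ) : ((lineZ p x - x / 12 : ℝ) : ℂ) =
    weierstrassZeta p.lattice (p.1.2 * Complex.I + x) -
      weierstrassZeta p.lattice (p.1.2 * Complex.I) := by
  have him : ∀ x : ℝ, HasDerivAt (fun x : ℝ => (weierstrassZeta p.lattice (p.1.2 * Complex.I + x) -
      weierstrassZeta p.lattice (p.1.2 * Complex.I)).im) 0 x := by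
    intro x
    have := Complex.imCLM.hasFDerivAt.comp_hasDerivAt x (hasDerivAt_weierstrassZeta_line p x)
    rwa [Complex.imCLM_apply, Complex.ofReal_im] at this
  have h0 := is_const_of_deriv_eq_zero (fun x => (him x).differentiableAt)
    (fun x => (him x).deriv) x 0
  apply Complex.ext
  · simp [lineZ]
  · rw [Complex.ofReal_im, h0]; simp

lemma lineZ_zero (p : HalfPeriods) : lineZ p 0 = 0 := by simp [lineZ]

lemma lineZ_period (p : HalfPeriods) : ((lineZ p (2 * p.1.1) - p.1.1 / 6 : ℝ) : ℂ) =
    2 * weierstrassZeta p.lattice p.1.1 := by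
  have h1 := ofReal_lineZ p (2 * p.1.1)
  have h2 := line_notMem_lattice p 0
  have h3 := weierstrassZeta_add p.lattice (two_mul_fst_mem p)
    (real_notMem_lattice p p.2.1 (by linarith [p.2.1])) h2
  push_cast at h1 h3 ⊢
  simp only [add_zero] at h3
  rw [h3] at h1
  linear_combination h1

end Zeta

end HitchinCP2

namespace HitchinCP2

open Filter Topology

/-! ### Differentiable dependence of integral curves on a parameter -/

section Parameter

variable {E : Type*} [NormedAddCommGroup E] [NormedSpace ℝ E]

/-- First order perturbation with a quantitative remainder: f and g are integral curves and V solves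
the equation linearised along g. Gronwall is used twice, for f − g and then for f − g − hV, whose
forcing is quadratic in f − g. -/
lemma gronwall_remainder {G : E → E} {G' : E → E →L[ℝ] E} {S : Set E} {K : NNReal} {C : ℝ}
    (hK : 0 < K) (hC : 0 ≤ C) (hLip : LipschitzOnWith K G S) (hG' : ∀ w ∈ S, ‖G' w‖ ≤ K)
    (hQ : ∀ w ∈ S, ∀ w' ∈ S, ‖G w' - G w - G' w (w' - w)‖ ≤ C * ‖w' - w‖ ^ 2)
    {f g V : ℝ → E} (hf : ∀ x, HasDerivAt f (G (f x)) x) (hfS : ∀ x, f x ∈ S)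
    (hg : ∀ x, HasDerivAt g (G (g x)) x) (hgS : ∀ x, g x ∈ S)
    (hV : ∀ x, HasDerivAt V (G' (g x) (V x)) x) (h : ℝ) {T x : ℝ} (hx : x ∈ Icc 0 T) :
    ‖f x - g x - h • V x‖ ≤ (‖f 0 - g 0 - h • V 0‖ +
      C * ‖f 0 - g 0‖ ^ 2 * exp (2 * K * T) / K) * exp (K * T) := by
  have hK' : (0 : ℝ) < K := hK
  have hT : 0 ≤ T := hx.1.trans hx.2
  have hΔ : ∀ x ∈ Icc 0 T, ‖f x - g x‖ ≤ ‖f 0 - g 0‖ * exp (K * T) := by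
    intro x hx
    have := dist_le_of_trajectories_ODE_of_mem (v := fun _ => G) (s := fun _ => S) (K := K)
      (f := f) (g := g) (a := 0) (b := T) (δ := dist (f 0) (g 0))
      (fun _ _ => hLip) (fun x _ => (hf x).continuousAt.continuousWithinAt)
      (fun x _ => (hf x).hasDerivWithinAt) (fun x _ => hfS x)
      (fun x _ => (hg x).continuousAt.continuousWithinAt)
      (fun x _ => (hg x).hasDerivWithinAt) (fun x _ => hgS x) le_rfl x hx
    rw [dist_eq_norm, dist_eq_norm] at this
    refine this.trans ?_
    gcongr
    linarith [hx.2]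
  set ε := C * ‖f 0 - g 0‖ ^ 2 * exp (2 * K * T) with hε
  have hε0 : 0 ≤ ε := by positivity
  have hR : ∀ x, HasDerivAt (fun x => f x - g x - h • V x)
      (G (f x) - G (g x) - h • G' (g x) (V x)) x := fun x =>
    ((hf x).fun_sub (hg x)).fun_sub ((hV x).const_smul h)
  have hbound := norm_le_gronwallBound_of_norm_deriv_right_le (f := fun x => f x - g x - h • V x)
    (f' := fun x => G (f x) - G (g x) - h • G' (g x) (V x)) (δ := ‖f 0 - g 0 - h • V 0‖)
    (K := K) (ε := ε) (a := 0) (b := T) (fun x _ => (hR x).continuousAt.continuousWithinAt)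
    (fun x _ => (hR x).hasDerivWithinAt) le_rfl (fun y hy => by
      have e : G (f y) - G (g y) - h • G' (g y) (V y) = G' (g y) (f y - g y - h • V y) +
          (G (f y) - G (g y) - G' (g y) (f y - g y)) := by
        simp only [map_sub, map_smul]; abel
      rw [e]
      refine (norm_add_le _ _).trans (add_le_add ?_ ?_)
      · exact (G' (g y)).le_of_opNorm_le (hG' _ (hgS y)) _
      · refine (hQ _ (hgS y) _ (hfS y)).trans ?_
        have h1 := hΔ y (Ico_subset_Icc_self hy)
        rw [hε, mul_assoc, show exp (2 * K * T) = exp (K * T) ^ 2 by rw [← exp_nat_mul]; ring_nf,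
          ← mul_pow]
        gcongr) x hx
  refine hbound.trans ?_
  rw [gronwallBound_of_K_ne_0 hK'.ne', sub_zero]
  have h1 : exp (K * x) ≤ exp (K * T) := by gcongr; exact hx.2
  have h2 : 0 ≤ ε / K := by positivity
  calc _ ≤ ‖f 0 - g 0 - h • V 0‖ * exp (K * x) + ε / K * exp (K * x) := by
        beta_reduce; rw [mul_sub]; linarith
    _ ≤ ‖f 0 - g 0 - h • V 0‖ * exp (K * T) + ε / K * exp (K * T) := by gcongr
    _ = _ := by ring

/-- Negative times follow by reversing the field. -/
lemma gronwall_remainder_abs {G : E → E} {G' : E → E →L[ℝ] E} {S : Set E} {K : NNReal} {C : ℝ}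
    (hK : 0 < K) (hC : 0 ≤ C) (hLip : LipschitzOnWith K G S) (hG' : ∀ w ∈ S, ‖G' w‖ ≤ K)
    (hQ : ∀ w ∈ S, ∀ w' ∈ S, ‖G w' - G w - G' w (w' - w)‖ ≤ C * ‖w' - w‖ ^ 2)
    {f g V : ℝ → E} (hf : ∀ x, HasDerivAt f (G (f x)) x) (hfS : ∀ x, f x ∈ S)
    (hg : ∀ x, HasDerivAt g (G (g x)) x) (hgS : ∀ x, g x ∈ S)
    (hV : ∀ x, HasDerivAt V (G' (g x) (V x)) x) (h : ℝ) {T x : ℝ} (hx : |x| ≤ T) :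
    ‖f x - g x - h • V x‖ ≤ (‖f 0 - g 0 - h • V 0‖ +
      C * ‖f 0 - g 0‖ ^ 2 * exp (2 * K * T) / K) * exp (K * T) := by
  rcases le_total 0 x with h0 | h0
  · exact gronwall_remainder hK hC hLip hG' hQ hf hfS hg hgS hV h ⟨h0, (le_abs_self x).trans hx⟩
  · have hneg : ∀ (u : ℝ → E) (u' : E) (y : ℝ), HasDerivAt u u' (-y) →
        HasDerivAt (fun z => u (-z)) (-u') y := by
      intro u u' y hu
      have := hu.scomp y (hasDerivAt_neg y)
      simpa [Function.comp_def] using this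
    have key := gronwall_remainder (G := fun w => -G w) (G' := fun w => -G' w) (S := S) (K := K)
      (C := C) hK hC hLip.neg (fun w hw => by rw [norm_neg]; exact hG' w hw)
      (fun w hw w' hw' => by
        rw [← norm_neg]
        convert! hQ w hw w' hw' using 2
        simp only [neg_apply]; abel)
      (f := fun x => f (-x)) (g := fun x => g (-x)) (V := fun x => V (-x))
      (fun x => hneg _ _ _ (hf (-x))) (fun x => hfS _) (fun x => hneg _ _ _ (hg (-x)))
      (fun x => hgS _) (fun x => hneg _ _ _ (hV (-x))) h (T := T) (x := -x)
      ⟨by linarith, (neg_le_abs x).trans hx⟩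
    simpa using key

/-- Differentiability of the general integral curve jointly in the parameter and the time. -/
theorem hasFDerivAt_integralCurve {G : E → E} {G' : E → E →L[ℝ] E} {S : Set E} {K : NNReal} {C : ℝ}
    (hK : 0 < K) (hC : 0 ≤ C) (hLip : LipschitzOnWith K G S) (hG' : ∀ w ∈ S, ‖G' w‖ ≤ K)
    (hQ : ∀ w ∈ S, ∀ w' ∈ S, ‖G w' - G w - G' w (w' - w)‖ ≤ C * ‖w' - w‖ ^ 2)
    {W : ℝ → ℝ → E} {c₀ : ℝ} {V : ℝ → E}
    (hW : ∀ᶠ c in 𝓝 c₀, ∀ x, HasDerivAt (W c) (G (W c x)) x ∧ W c x ∈ S)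
    (hV : ∀ x, HasDerivAt V (G' (W c₀ x) (V x)) x) (h0 : HasDerivAt (fun c => W c 0) (V 0) c₀)
    (x₀ : ℝ) : HasFDerivAt (fun z : ℝ × ℝ => W z.1 z.2)
      ((ContinuousLinearMap.fst ℝ ℝ ℝ).smulRight (V x₀) +
        (ContinuousLinearMap.snd ℝ ℝ ℝ).smulRight (G (W c₀ x₀))) (c₀, x₀) := by
  have hW0 := hW.self_of_nhds
  set T := |x₀| + 1 with hT
  set B : ℝ → ℝ := fun c => (‖W c 0 - W c₀ 0 - (c - c₀) • V 0‖ +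
      C * ‖W c 0 - W c₀ 0‖ ^ 2 * exp (2 * K * T) / K) * exp (K * T) with hB
  -- The bound is little-o because V(0) is the derivative of the initial value and the second
  -- summand is quadratic in its increment.
  have hBo : B =o[𝓝 c₀] fun c => c - c₀ := by
    have o1 : (fun c => ‖W c 0 - W c₀ 0 - (c - c₀) • V 0‖) =o[𝓝 c₀] fun c => c - c₀ :=
      (hasDerivAt_iff_isLittleO.mp h0).norm_left
    have o2 : (fun c => W c 0 - W c₀ 0) =O[𝓝 c₀] fun c => c - c₀ := h0.isBigO_sub
    have o3 : (fun c => ‖W c 0 - W c₀ 0‖ ^ 2) =o[𝓝 c₀] fun c => c - c₀ := by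
      have h1 : (fun c => ‖W c 0 - W c₀ 0‖) =o[𝓝 c₀] fun _ => (1 : ℝ) := by
        rw [Asymptotics.isLittleO_one_iff]
        have := (h0.continuousAt.sub continuousAt_const).norm (f := fun c => W c 0 - W c₀ 0)
        simpa [ContinuousAt] using this
      have := h1.mul_isBigO o2.norm_left
      simpa [sq] using this
    have o4 : (fun c => C * ‖W c 0 - W c₀ 0‖ ^ 2 * exp (2 * K * T) / K) =o[𝓝 c₀]
        fun c => c - c₀ := by
      have := o3.const_mul_left (C * exp (2 * K * T) / K)
      refine this.congr_left fun c => by ring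
    have := (o1.add o4).const_mul_left (exp (K * T))
    exact this.congr_left fun c => by simp only [hB]; ring
  rw [hasFDerivAt_iff_isLittleO]
  have hfst : Tendsto (fun z : ℝ × ℝ => z.1) (𝓝 (c₀, x₀)) (𝓝 c₀) := continuous_fst.tendsto _
  have hsnd : Tendsto (fun z : ℝ × ℝ => z.2) (𝓝 (c₀, x₀)) (𝓝 x₀) := continuous_snd.tendsto _
  have b1 : (fun z : ℝ × ℝ => z.1 - c₀) =O[𝓝 (c₀, x₀)] fun z => z - (c₀, x₀) :=
    Asymptotics.IsBigO.of_bound 1 (Eventually.of_forall fun z => by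
      rw [one_mul]; exact norm_fst_le (z - (c₀, x₀)))
  have b2 : (fun z : ℝ × ℝ => z.2 - x₀) =O[𝓝 (c₀, x₀)] fun z => z - (c₀, x₀) :=
    Asymptotics.IsBigO.of_bound 1 (Eventually.of_forall fun z => by
      rw [one_mul]; exact norm_snd_le (z - (c₀, x₀)))
  -- The total increment splits into the parameter remainder at fixed time, the variation of V in
  -- time, and the time remainder at fixed parameter. Only the first needs the bound uniform in |x|
  -- ≤ T.
  have r1 : (fun z : ℝ × ℝ => W z.1 z.2 - W c₀ z.2 - (z.1 - c₀) • V z.2) =o[𝓝 (c₀, x₀)]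
      fun z => z - (c₀, x₀) := by
    refine Asymptotics.IsBigO.trans_isLittleO ?_ ((hBo.comp_tendsto hfst).trans_isBigO b1)
    refine Asymptotics.IsBigO.of_bound 1 ?_
    have hx : ∀ᶠ z : ℝ × ℝ in 𝓝 (c₀, x₀), |z.2| < T :=
      hsnd.eventually ((continuous_abs.tendsto x₀).eventually (gt_mem_nhds (by simp [hT])))
    filter_upwards [hfst.eventually hW, hx] with z hz hx
    rw [one_mul]
    refine (gronwall_remainder_abs hK hC hLip hG' hQ (fun x => (hz x).1) (fun x => (hz x).2)
      (fun x => (hW0 x).1) (fun x => (hW0 x).2) hV (z.1 - c₀) hx.le).trans (le_abs_self _)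
  have r2 : (fun z : ℝ × ℝ => (z.1 - c₀) • (V z.2 - V x₀)) =o[𝓝 (c₀, x₀)]
      fun z => z - (c₀, x₀) := by
    have h1 : (fun z : ℝ × ℝ => V z.2 - V x₀) =o[𝓝 (c₀, x₀)] fun _ => (1 : ℝ) := by
      rw [Asymptotics.isLittleO_one_iff]
      have := ((hV x₀).continuousAt.tendsto.comp hsnd).sub_const (V x₀)
      simpa using this
    have := b1.norm_right.smul_isLittleO h1
    simp only [smul_eq_mul, mul_one] at this
    exact this.of_norm_right
  have r3 : (fun z : ℝ × ℝ => W c₀ z.2 - W c₀ x₀ - (z.2 - x₀) • G (W c₀ x₀)) =o[𝓝 (c₀, x₀)]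
      fun z => z - (c₀, x₀) :=
    ((hasDerivAt_iff_isLittleO.mp (hW0 x₀).1).comp_tendsto hsnd).trans_isBigO b2
  refine ((r1.add r2).add r3).congr_left fun z => ?_
  simp only [add_apply, ContinuousLinearMap.smulRight_apply,
    ContinuousLinearMap.coe_fst', ContinuousLinearMap.coe_snd', Prod.fst_sub, Prod.snd_sub,
    smul_sub]
  abel

end Parameter

/-! ### Bootstrapping regularity -/

/-- A solution of a total differential equation with smooth right-hand side is smooth. -/
lemma contDiffOn_of_hasFDerivAt {E F : Type*} [NormedAddCommGroup E] [NormedSpace ℝ E]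
    [NormedAddCommGroup F] [NormedSpace ℝ F] {U : Set E} (hU : IsOpen U) {f : E → F}
    {A : E × F → E →L[ℝ] F} {S : Set (E × F)} (hA : ContDiffOn ℝ ∞ A S)
    (hS : ∀ x ∈ U, (x, f x) ∈ S) (hf : ∀ x ∈ U, HasFDerivAt f (A (x, f x)) x) :
    ContDiffOn ℝ ∞ f U := by
  rw [contDiffOn_infty]
  intro n
  induction n with
  | zero =>
    rw [Nat.cast_zero, contDiffOn_zero]
    exact fun x hx => (hf x hx).continuousAt.continuousWithinAt
  | succ n ih =>
    rw [Nat.cast_add, Nat.cast_one, contDiffOn_succ_iff_fderiv_of_isOpen hU]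
    refine ⟨fun x hx => (hf x hx).differentiableAt.differentiableWithinAt, by simp, ?_⟩
    have h1 : ContDiffOn ℝ n (fun x => A (x, f x)) U :=
      (hA.of_le (by exact_mod_cast le_top)).comp (contDiffOn_id.prodMk ih) hS
    exact h1.congr fun x hx => (hf x hx).fderiv

end HitchinCP2

namespace HitchinCP2

open Filter Topology

/-! ### The Lotka-Volterra system -/

section LotkaVolterra

/-- The Lotka-Volterra vector field for `(y¹, y²)`, augmented by the primitive of `y¹ y²`. -/
def lvField (w : ℝ × ℝ × ℝ) : ℝ × ℝ × ℝ :=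
  (w.1 * (w.1 + 2 * w.2.1 - 1), w.2.1 * (1 - 2 * w.1 - w.2.1), w.1 * w.2.1)

/-- The derivative of `lvField`. -/
noncomputable def lvDeriv (w : ℝ × ℝ × ℝ) : ℝ × ℝ × ℝ →L[ℝ] ℝ × ℝ × ℝ :=
  let a := ContinuousLinearMap.fst ℝ ℝ (ℝ × ℝ)
  let b := (ContinuousLinearMap.fst ℝ ℝ ℝ).comp (ContinuousLinearMap.snd ℝ ℝ (ℝ × ℝ))
  ((2 * w.1 + 2 * w.2.1 - 1) • a + (2 * w.1) • b).prod
    (((-2 * w.2.1) • a + (1 - 2 * w.1 - 2 * w.2.1) • b).prod (w.2.1 • a + w.1 • b))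

lemma lvDeriv_apply (w v : ℝ × ℝ × ℝ) : lvDeriv w v =
    ((2 * w.1 + 2 * w.2.1 - 1) * v.1 + 2 * w.1 * v.2.1,
      -2 * w.2.1 * v.1 + (1 - 2 * w.1 - 2 * w.2.1) * v.2.1, w.2.1 * v.1 + w.1 * v.2.1) := by
  simp [lvDeriv]

/-- The region `0 ≤ y¹, y² ≤ 1`. -/
def lvRegion : Set (ℝ × ℝ × ℝ) := {w | (0 ≤ w.1 ∧ w.1 ≤ 1) ∧ 0 ≤ w.2.1 ∧ w.2.1 ≤ 1}

lemma abs_fst_le_norm (v : ℝ × ℝ × ℝ) : |v.1| ≤ ‖v‖ := norm_fst_le v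

lemma abs_snd_le_norm (v : ℝ × ℝ × ℝ) : |v.2.1| ≤ ‖v‖ := (norm_fst_le v.2).trans (norm_snd_le v)

lemma norm_triple_le {a b c r : ℝ} (ha : |a| ≤ r) (hb : |b| ≤ r) (hc : |c| ≤ r) :
    ‖((a, b, c) : ℝ × ℝ × ℝ)‖ ≤ r :=
  norm_prod_le_iff.mpr ⟨ha, norm_prod_le_iff.mpr ⟨hb, hc⟩⟩

lemma norm_lvDeriv_apply_le {w : ℝ × ℝ × ℝ} (hw : w ∈ lvRegion) (v : ℝ × ℝ × ℝ) :
    ‖lvDeriv w v‖ ≤ 5 * ‖v‖ := by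
  obtain ⟨⟨h1, h2⟩, h3, h4⟩ := hw
  have e1 := abs_fst_le_norm v
  have e2 := abs_snd_le_norm v
  have e0 := norm_nonneg v
  have key : ∀ s t : ℝ, |s| ≤ 3 → |t| ≤ 2 → |s * v.1 + t * v.2.1| ≤ 5 * ‖v‖ := by
    intro s t hs ht
    calc _ ≤ |s| * |v.1| + |t| * |v.2.1| := by rw [← abs_mul, ← abs_mul]; exact abs_add_le _ _
      _ ≤ 3 * ‖v‖ + 2 * ‖v‖ := by gcongr
      _ = _ := by ring
  rw [lvDeriv_apply]
  refine norm_triple_le (key _ _ ?_ ?_) ?_ (key _ _ ?_ ?_)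
  · rw [abs_le]; constructor <;> linarith
  · rw [abs_le]; constructor <;> linarith
  · rw [add_comm]
    calc _ ≤ |1 - 2 * w.1 - 2 * w.2.1| * |v.2.1| + |-2 * w.2.1| * |v.1| := by
          rw [← abs_mul, ← abs_mul]; exact abs_add_le _ _
      _ ≤ 3 * ‖v‖ + 2 * ‖v‖ := by
          have h5 : |1 - 2 * w.1 - 2 * w.2.1| ≤ 3 := by rw [abs_le]; constructor <;> linarith
          have h6 : |-2 * w.2.1| ≤ 2 := by rw [abs_le]; constructor <;> linarith
          gcongr
      _ = _ := by ring
  · rw [abs_le]; constructor <;> linarith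
  · rw [abs_le]; constructor <;> linarith

lemma norm_lvDeriv_le {w : ℝ × ℝ × ℝ} (hw : w ∈ lvRegion) : ‖lvDeriv w‖ ≤ (5 : NNReal) :=
  (lvDeriv w).opNorm_le_bound (by positivity) (norm_lvDeriv_apply_le hw)

lemma lipschitzOnWith_lvField : LipschitzOnWith 5 lvField lvRegion := by
  refine LipschitzOnWith.of_dist_le_mul fun w hw w' hw' => ?_
  -- The field is quadratic, so an increment equals the derivative at the midpoint exactly. The
  -- third coordinate does not enter the derivative, hence the 0.
  have hm : ((w.1 + w'.1) / 2, (w.2.1 + w'.2.1) / 2, (0 : ℝ)) ∈ lvRegion := by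
    obtain ⟨⟨h1, h2⟩, h3, h4⟩ := hw
    obtain ⟨⟨h5, h6⟩, h7, h8⟩ := hw'
    refine ⟨⟨?_, ?_⟩, ?_, ?_⟩ <;> simp only <;> linarith
  have e : lvField w - lvField w' =
      lvDeriv ((w.1 + w'.1) / 2, (w.2.1 + w'.2.1) / 2, 0) (w - w') := by
    rw [lvDeriv_apply]
    simp only [lvField, Prod.mk_sub_mk, Prod.fst_sub, Prod.snd_sub]
    refine Prod.ext ?_ (Prod.ext ?_ ?_) <;> simp only <;> ring
  rw [dist_eq_norm, dist_eq_norm, e]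
  exact norm_lvDeriv_apply_le hm _

lemma norm_lvField_sub_le (w w' : ℝ × ℝ × ℝ) :
    ‖lvField w' - lvField w - lvDeriv w (w' - w)‖ ≤ 3 * ‖w' - w‖ ^ 2 := by
  have e1 := abs_fst_le_norm (w' - w)
  have e2 := abs_snd_le_norm (w' - w)
  have e0 := norm_nonneg (w' - w)
  have e : lvField w' - lvField w - lvDeriv w (w' - w) =
      ((w' - w).1 * (w' - w).1 + 2 * ((w' - w).1 * (w' - w).2.1),
        -(2 * ((w' - w).1 * (w' - w).2.1)) - (w' - w).2.1 * (w' - w).2.1,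
        (w' - w).1 * (w' - w).2.1) := by
    rw [lvDeriv_apply]
    simp only [lvField, Prod.mk_sub_mk, Prod.fst_sub, Prod.snd_sub]
    refine Prod.ext ?_ (Prod.ext ?_ ?_) <;> simp only <;> ring
  rw [e]
  generalize w' - w = v at e1 e2 e0
  have f1 : |v.1 * v.1| ≤ ‖v‖ ^ 2 := by
    rw [abs_mul, sq]; gcongr
  have f2 : |v.1 * v.2.1| ≤ ‖v‖ ^ 2 := by
    rw [abs_mul, sq]; gcongr
  have f3 : |v.2.1 * v.2.1| ≤ ‖v‖ ^ 2 := by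
    rw [abs_mul, sq]; gcongr
  rw [abs_le] at f1 f2 f3
  refine norm_triple_le ?_ ?_ ?_ <;> rw [abs_le] <;> constructor <;> linarith [f1.1, f2.1, f3.1]

/-- The numerator of the derivative of the Lotka-Volterra solution with respect to `c`. -/
noncomputable def lvNum (z : ℝ × ℝ) (w : ℝ × ℝ × ℝ) : ℝ × ℝ × ℝ :=
  let p := w.1
  let q := w.2.1
  let A := 1 + 3 * q - 18 * p * q
  let B := 1 + 3 * p - 18 * p * q
  -- The coefficient of the flow direction: its term in x is secular, that is, it grows with time
  -- because the period depends on c.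
  let f := 3 * w.2.2 - 9 * z.1 * z.2
  (p * (A - (A * p + B * q)) / 2 + f * (p * (p + 2 * q - 1)),
    q * (B - (A * p + B * q)) / 2 + f * (q * (1 - 2 * p - q)),
    -(3 / 2) * p * q * (p - q) - 9 * z.1 * w.2.2 + z.1 * z.2 + f * (p * q))

/-- The derivative of the Lotka-Volterra solution with respect to `c`. -/
noncomputable def lvVar (z : ℝ × ℝ) (w : ℝ × ℝ × ℝ) : ℝ × ℝ × ℝ :=
  (z.1 * (1 - 27 * z.1))⁻¹ • lvNum z w

/-- The closed form solves the variational equation along any orbit on the level c: after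
differentiation, both sides differ by multiples of y¹y²y³ − c. -/
lemma hasDerivAt_lvVar {c x : ℝ} {w : ℝ → ℝ × ℝ × ℝ} (hw : HasDerivAt w (lvField (w x)) x)
    (hc : (w x).1 * (w x).2.1 * (1 - (w x).1 - (w x).2.1) = c) :
    HasDerivAt (fun x => lvVar (c, x) (w x)) (lvDeriv (w x) (lvVar (c, x) (w x))) x := by
  have hp : HasDerivAt (fun x => (w x).1) _ x := hw.fst
  have hq : HasDerivAt (fun x => (w x).2.1) _ x := hw.snd.fst
  have hz : HasDerivAt (fun x => (w x).2.2) _ x := hw.snd.snd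
  have hA := ((hq.const_mul 3).const_add 1).fun_sub ((hp.const_mul 18).fun_mul hq)
  have hB := ((hp.const_mul 3).const_add 1).fun_sub ((hp.const_mul 18).fun_mul hq)
  have hf := (hz.const_mul 3).fun_sub ((hasDerivAt_id x).const_mul (9 * c))
  have hS := (hA.fun_mul hp).fun_add (hB.fun_mul hq)
  have h1 := ((hp.fun_mul (hA.fun_sub hS)).div_const 2).fun_add
    (hf.fun_mul (hp.fun_mul ((hp.fun_add (hq.const_mul 2)).sub_const 1)))
  have h2 := ((hq.fun_mul (hB.fun_sub hS)).div_const 2).fun_add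
    (hf.fun_mul (hq.fun_mul (((hp.const_mul 2).const_sub 1).fun_sub hq)))
  have h3 := (((((hp.const_mul (-(3 / 2))).fun_mul hq).fun_mul (hp.fun_sub hq)).fun_sub
    (hz.const_mul (9 * c))).fun_add ((hasDerivAt_id x).const_mul c)).fun_add
    (hf.fun_mul (hp.fun_mul hq))
  have h := (h1.prodMk (h2.prodMk h3)).const_smul (c * (1 - 27 * c))⁻¹
  convert! h using 1
  rw [lvVar, map_smul, lvDeriv_apply]
  simp only [lvNum, lvField, id]
  congr 1
  generalize (w x).1 = p at hc
  generalize (w x).2.1 = q at hc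
  generalize (w x).2.2 = Z
  refine Prod.ext ?_ (Prod.ext ?_ ?_) <;> simp only
  · linear_combination (-9 * p * (p + 2 * q - 1)) * hc
  · linear_combination (-9 * q * (1 - 2 * p - q)) * hc
  · linear_combination (1 - 18 * p * q) * hc

end LotkaVolterra

end HitchinCP2

namespace HitchinCP2

open Filter Topology

/-! ### The elliptic solution as a smooth function of c and x. -/

section Solution

/-- The functions `y¹, y²` and the normalized zeta function, as functions of the real time `x`. -/
noncomputable def lvSol (c x : ℝ) : ℝ × ℝ × ℝ :=
  (lineY c (halfPeriods c) (x + 2 * (halfPeriods c).1.1 / 3),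
    lineY c (halfPeriods c) (x - 2 * (halfPeriods c).1.1 / 3), lineZ (halfPeriods c) x)

variable {c : ℝ}

lemma lvSol_third (hc : c ∈ Ioo (0 : ℝ) (1 / 27)) (x : ℝ) :
    1 - (lvSol c x).1 - (lvSol c x).2.1 = lineY c (halfPeriods c) x := by
  have := (isHalfPeriods_halfPeriods hc).lineY_sum hc.1 x
  simp only [lvSol]
  linarith

lemma lvSol_fst_pos (hc : c ∈ Ioo (0 : ℝ) (1 / 27)) (x : ℝ) : 0 < (lvSol c x).1 :=
  (isHalfPeriods_halfPeriods hc).lineY_pos hc.1 _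

lemma lvSol_snd_pos (hc : c ∈ Ioo (0 : ℝ) (1 / 27)) (x : ℝ) : 0 < (lvSol c x).2.1 :=
  (isHalfPeriods_halfPeriods hc).lineY_pos hc.1 _

lemma lvSol_third_pos (hc : c ∈ Ioo (0 : ℝ) (1 / 27)) (x : ℝ) :
    0 < 1 - (lvSol c x).1 - (lvSol c x).2.1 := by
  rw [lvSol_third hc]
  exact (isHalfPeriods_halfPeriods hc).lineY_pos hc.1 _

lemma lvSol_prod (hc : c ∈ Ioo (0 : ℝ) (1 / 27)) (x : ℝ) :
    (lvSol c x).1 * (lvSol c x).2.1 * (1 - (lvSol c x).1 - (lvSol c x).2.1) = c := by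
  rw [lvSol_third hc]
  exact (isHalfPeriods_halfPeriods hc).lineY_prod hc.1 x

lemma lvSol_mem (hc : c ∈ Ioo (0 : ℝ) (1 / 27)) (x : ℝ) : lvSol c x ∈ lvRegion := by
  have h1 := lvSol_fst_pos hc x
  have h2 := lvSol_snd_pos hc x
  have h3 := lvSol_third_pos hc x
  exact ⟨⟨h1.le, by linarith⟩, h2.le, by linarith⟩

lemma hasDerivAt_lvSol (hc : c ∈ Ioo (0 : ℝ) (1 / 27)) (x : ℝ) :
    HasDerivAt (lvSol c) (lvField (lvSol c x)) x := by
  have h := isHalfPeriods_halfPeriods hc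
  have := (h.hasDerivAt_lineY_add hc.1 x).prodMk
    ((h.hasDerivAt_lineY_sub hc.1 x).prodMk (hasDerivAt_lineZ (halfPeriods c) x))
  convert! this using 1
  have h3 := lvSol_third hc x
  have h4 := h.lineY_mul hc.1 x
  rw [← h4, ← h3]
  simp only [lvField, lvSol]
  refine Prod.ext ?_ (Prod.ext ?_ ?_) <;> simp only <;> ring

/-- The common initial value of `y¹` and `y²`. -/
noncomputable def lvInit (c : ℝ) : ℝ := (lvSol c 0).1

lemma lvSol_zero (c : ℝ) : lvSol c 0 = (lvInit c, lvInit c, 0) := by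
  have h : lineY c (halfPeriods c) (0 - 2 * (halfPeriods c).1.1 / 3) =
      lineY c (halfPeriods c) (0 + 2 * (halfPeriods c).1.1 / 3) := by
    rw [← lineY_neg]; congr 1; ring
  rw [lvInit, lvSol, lineZ_zero, h]

lemma lvInit_eq (hc : c ∈ Ioo (0 : ℝ) (1 / 27)) : lvInit c ^ 2 * (1 - 2 * lvInit c) = c := by
  have := lvSol_prod hc 0
  rw [lvSol_zero] at this
  linear_combination this

lemma lt_lvInit (hc : c ∈ Ioo (0 : ℝ) (1 / 27)) : 1 / 3 < lvInit c := by
  have h1 := lvSol_third hc 0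
  have h2 := (isHalfPeriods_halfPeriods hc).lineY_zero_lt hc.1 hc.2
  rw [lvSol_zero] at h1
  simp only at h1
  linarith

lemma lvInit_lt (hc : c ∈ Ioo (0 : ℝ) (1 / 27)) : lvInit c < 1 / 2 := by
  have h1 := lvSol_third_pos hc 0
  rw [lvSol_zero] at h1
  simp only at h1
  linarith

/-- Strict monotonicity of t²(1 − 2t) beyond t = 1/3 in quantitative form. It supplies the
continuity that the derivative of an inverse function requires. -/
lemma abs_lvInit_sub_le {c d : ℝ} (hc : c ∈ Ioo (0 : ℝ) (1 / 27)) (hd : d ∈ Ioo (0 : ℝ) (1 / 27)) :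
    (lvInit c - 1 / 3) / 3 * |lvInit d - lvInit c| ≤ |d - c| := by
  have h1 := lt_lvInit hc
  have h2 := lt_lvInit hd
  have e : d - c = -((lvInit d * (2 * lvInit d + lvInit c - 1) +
      lvInit c * (2 * lvInit c + lvInit d - 1)) * (lvInit d - lvInit c)) := by
    linear_combination -lvInit_eq hd + lvInit_eq hc
  have hge : (lvInit c - 1 / 3) / 3 ≤ lvInit d * (2 * lvInit d + lvInit c - 1) +
      lvInit c * (2 * lvInit c + lvInit d - 1) := by
    have h3 : (lvInit c - 1 / 3) / 3 ≤ lvInit d * (2 * lvInit d + lvInit c - 1) := by nlinarith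
    have h4 : 0 ≤ lvInit c * (2 * lvInit c + lvInit d - 1) := by
      apply mul_nonneg <;> linarith
    linarith
  rw [e, abs_neg, abs_mul]
  gcongr
  exact hge.trans (le_abs_self _)

lemma hasDerivAt_lvInit (hc : c ∈ Ioo (0 : ℝ) (1 / 27)) :
    HasDerivAt lvInit (2 * lvInit c * (1 - 3 * lvInit c))⁻¹ c := by
  have h1 := lt_lvInit hc
  have hcont : ContinuousAt lvInit c := by
    rw [ContinuousAt, tendsto_iff_norm_sub_tendsto_zero]
    have hk : 0 < (lvInit c - 1 / 3) / 3 := by linarith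
    have ht : Tendsto (fun d => |d - c| / ((lvInit c - 1 / 3) / 3)) (𝓝 c) (𝓝 0) := by
      have : ContinuousAt (fun d => |d - c| / ((lvInit c - 1 / 3) / 3)) c := by fun_prop
      simpa [ContinuousAt] using this
    refine squeeze_zero' (Eventually.of_forall fun _ => norm_nonneg _) ?_ ht
    filter_upwards [Ioo_mem_nhds hc.1 hc.2] with d hd
    rw [le_div_iff₀ hk, mul_comm]
    exact abs_lvInit_sub_le hc hd
  refine HasDerivAt.of_local_left_inverse (f := fun t => t ^ 2 * (1 - 2 * t)) hcont ?_ ?_ ?_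
  · have := (hasDerivAt_pow 2 (lvInit c)).fun_mul (((hasDerivAt_id (lvInit c)).const_mul 2).const_sub 1)
    convert! this using 1
    simp
    ring
  · have : 0 < 2 * lvInit c := by linarith
    exact mul_ne_zero this.ne' (by linarith)
  · filter_upwards [Ioo_mem_nhds hc.1 hc.2] with d hd using lvInit_eq hd

lemma hasDerivAt_lvSol_zero (hc : c ∈ Ioo (0 : ℝ) (1 / 27)) :
    HasDerivAt (fun c => lvSol c 0) (lvVar (c, 0) (lvSol c 0)) c := by
  have h := hasDerivAt_lvInit hc
  have h' := h.prodMk (h.prodMk (hasDerivAt_const c (0 : ℝ)))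
  simp only [lvSol_zero]
  convert! h' using 1
  have h1 := lt_lvInit hc
  have h2 := lvInit_lt hc
  have h3 := lvInit_eq hc
  generalize lvInit c = a at h1 h2 h3
  have e1 : 1 - 3 * a ≠ 0 := by linarith
  have e2 : 1 - 2 * a ≠ 0 := by linarith
  have e3 : a ≠ 0 := by linarith
  have e4 : 1 + 6 * a ≠ 0 := by linarith
  -- With c = a²(1 − 2a) one has 1 − 27c = (1 − 3a)²(1 + 6a), so one factor 1 − 3a cancels against
  -- the numerator.
  have hD : c * (1 - 27 * c) =
      (2 * a * (1 - 3 * a)) * (a * (1 - 2 * a) * ((1 - 3 * a) * (1 + 6 * a)) / 2) := by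
    rw [← h3]; ring
  have hN : lvNum (c, 0) (a, a, 0) = (a * (1 - 2 * a) * ((1 - 3 * a) * (1 + 6 * a)) / 2,
      a * (1 - 2 * a) * ((1 - 3 * a) * (1 + 6 * a)) / 2, 0) := by
    simp only [lvNum]
    refine Prod.ext ?_ (Prod.ext ?_ ?_) <;> simp only <;> ring
  have e5 : a * (1 - 2 * a) * ((1 - 3 * a) * (1 + 6 * a)) / 2 ≠ 0 := by positivity
  rw [lvVar, hN]
  simp only [hD, Prod.smul_mk, smul_eq_mul, mul_inv_rev, mul_zero]
  generalize a * (1 - 2 * a) * ((1 - 3 * a) * (1 + 6 * a)) / 2 = n at e5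
  refine Prod.ext ?_ (Prod.ext ?_ rfl) <;> simp only <;> field_simp

/-- The strip where the solution is defined. -/
def strip : Set (ℝ × ℝ) := {z | z.1 ∈ Ioo (0 : ℝ) (1 / 27)}

lemma isOpen_strip : IsOpen strip := isOpen_Ioo.preimage continuous_fst

/-- The right-hand side of the total differential equation for `lvSol`. -/
noncomputable def lvTotal (u : (ℝ × ℝ) × (ℝ × ℝ × ℝ)) : ℝ × ℝ →L[ℝ] ℝ × ℝ × ℝ :=
  (ContinuousLinearMap.fst ℝ ℝ ℝ).smulRight (lvVar u.1 u.2) +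
    (ContinuousLinearMap.snd ℝ ℝ ℝ).smulRight (lvField u.2)

/-- All curves are orbits of one field inside `lvRegion`, so the c-derivative is the solution of the
variational equation with the correct initial value. -/
lemma hasFDerivAt_lvSol {z : ℝ × ℝ} (hz : z ∈ strip) :
    HasFDerivAt (fun z : ℝ × ℝ => lvSol z.1 z.2) (lvTotal (z, lvSol z.1 z.2)) z := by
  have hz' : z.1 ∈ Ioo (0 : ℝ) (1 / 27) := hz
  refine hasFDerivAt_integralCurve (G' := lvDeriv) (S := lvRegion) (K := 5) (C := 3) (by norm_num)
    (by norm_num) lipschitzOnWith_lvField (fun w hw => norm_lvDeriv_le hw)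
    (fun w _ w' _ => norm_lvField_sub_le w w') (V := fun x => lvVar (z.1, x) (lvSol z.1 x))
    ?_ (fun x => hasDerivAt_lvVar (hasDerivAt_lvSol hz' x) (lvSol_prod hz' x))
    (hasDerivAt_lvSol_zero hz') z.2
  filter_upwards [Ioo_mem_nhds hz'.1 hz'.2] with c hc x
    using ⟨hasDerivAt_lvSol hc x, lvSol_mem hc x⟩

lemma contDiffOn_lvTotal : ContDiffOn ℝ ∞ lvTotal {u | u.1 ∈ strip} := by
  have h1 : ContDiffOn ℝ ∞ (fun u : (ℝ × ℝ) × (ℝ × ℝ × ℝ) => lvVar u.1 u.2) {u | u.1 ∈ strip} := by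
    have hD : ContDiff ℝ ∞ (fun u : (ℝ × ℝ) × (ℝ × ℝ × ℝ) => u.1.1 * (1 - 27 * u.1.1)) := by
      fun_prop
    have hN : ContDiff ℝ ∞ (fun u : (ℝ × ℝ) × (ℝ × ℝ × ℝ) => lvNum u.1 u.2) := by
      unfold lvNum
      fun_prop
    refine (hD.contDiffOn.inv fun u hu => ?_).smul hN.contDiffOn
    have hu' : u.1.1 ∈ Ioo (0 : ℝ) (1 / 27) := hu
    exact mul_ne_zero hu'.1.ne' (by linarith [hu'.2])
  have h2 : ContDiff ℝ ∞ (fun u : (ℝ × ℝ) × (ℝ × ℝ × ℝ) => lvField u.2) := by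
    unfold lvField
    fun_prop
  exact (contDiffOn_const.smulRight h1).add (contDiffOn_const.smulRight h2.contDiffOn)

lemma contDiffOn_lvSol : ContDiffOn ℝ ∞ (fun z : ℝ × ℝ => lvSol z.1 z.2) strip :=
  contDiffOn_of_hasFDerivAt isOpen_strip contDiffOn_lvTotal (fun _ hz => hz)
    fun _ hz => hasFDerivAt_lvSol hz

end Solution

end HitchinCP2

namespace HitchinCP2

open Filter Topology

/-! ### Smoothness and derivative of the real half-period. -/

section RealHalfPeriod

lemma det_prod (f : ℝ × ℝ →L[ℝ] ℝ × ℝ) :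
    f.det = (f (1, 0)).1 * (f (0, 1)).2 - (f (0, 1)).1 * (f (1, 0)).2 := by
  rw [ContinuousLinearMap.det, ← LinearMap.det_toMatrix (Module.Basis.finTwoProd ℝ),
    Matrix.det_fin_two]
  simp [LinearMap.toMatrix_apply]

variable {c : ℝ}

lemma lineZ_neg (p : HalfPeriods) (x : ℝ) : lineZ p (-x) = -lineZ p x := by
  have h : ∀ x, HasDerivAt (fun x => lineZ p (-x) + lineZ p x) 0 x := by
    intro x
    have := ((hasDerivAt_lineZ p (-x)).comp x (hasDerivAt_neg x)).add (hasDerivAt_lineZ p x)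
    convert! this using 1
    rw [lineQ_neg]; ring
  have := is_const_of_deriv_eq_zero (fun x => (h x).differentiableAt) (fun x => (h x).deriv) x 0
  simp only [neg_zero, lineZ_zero] at this
  linarith

lemma lineZ_add_period (p : HalfPeriods) (x : ℝ) :
    lineZ p (x + 2 * p.1.1) = lineZ p x + lineZ p (2 * p.1.1) := by
  have h : ∀ x, HasDerivAt (fun x => lineZ p (x + 2 * p.1.1) - lineZ p x) 0 x := by
    intro x
    have := ((hasDerivAt_lineZ p (x + 2 * p.1.1)).comp_add_const x _).sub (hasDerivAt_lineZ p x)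
    convert! this using 1
    rw [lineQ_periodic]; ring
  have := is_const_of_deriv_eq_zero (fun x => (h x).differentiableAt) (fun x => (h x).deriv) x 0
  simp only [zero_add, lineZ_zero] at this
  linarith

lemma ofReal_lineZ_half (p : HalfPeriods) :
    ((lineZ p p.1.1 - p.1.1 / 12 : ℝ) : ℂ) = weierstrassZeta p.lattice p.1.1 := by
  have h1 := lineZ_add_period p (-p.1.1)
  rw [lineZ_neg, show -p.1.1 + 2 * p.1.1 = p.1.1 by ring] at h1
  have h2 := lineZ_period p
  rw [show lineZ p (2 * p.1.1) - p.1.1 / 6 = 2 * (lineZ p p.1.1 - p.1.1 / 12) by linarith] at h2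
  push_cast at h2 ⊢
  exact mul_left_cancel₀ two_ne_zero h2

lemma lvSol_half (hc : c ∈ Ioo (0 : ℝ) (1 / 27)) :
    (lvSol c (omega1 c)).2.1 = (lvSol c (omega1 c)).1 := by
  have h := isHalfPeriods_halfPeriods hc
  have h1 := lineQ'_half (halfPeriods c)
  simp only [lvSol, omega1]
  rw [h.lineY_add_third hc.1, h.lineY_sub_third hc.1, h1]
  ring

/-- Nondegeneracy for the implicit function theorem: y¹ = y² = 1/3 would force c = 1/27. -/
lemma lvSol_half_ne (hc : c ∈ Ioo (0 : ℝ) (1 / 27)) : 3 * (lvSol c (omega1 c)).1 - 1 ≠ 0 := by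
  intro h0
  have h1 := lvSol_prod hc (omega1 c)
  rw [lvSol_half hc, show (lvSol c (omega1 c)).1 = 1 / 3 by linarith] at h1
  have := hc.2
  norm_num at h1
  linarith

/-- The difference `y¹ - y²` and its zero `ω₁`. -/
noncomputable def lvDiff (z : ℝ × ℝ) : ℝ × ℝ := (z.1, (lvSol z.1 z.2).1 - (lvSol z.1 z.2).2.1)

lemma lvDiff_half (hc : c ∈ Ioo (0 : ℝ) (1 / 27)) : lvDiff (c, omega1 c) = (c, 0) := by
  simp [lvDiff, lvSol_half hc]

/-- The derivative of `lvDiff`. -/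
noncomputable def lvDiffDeriv (z : ℝ × ℝ) : ℝ × ℝ →L[ℝ] ℝ × ℝ :=
  let L := lvTotal (z, lvSol z.1 z.2)
  (ContinuousLinearMap.fst ℝ ℝ ℝ).prod ((ContinuousLinearMap.fst ℝ ℝ (ℝ × ℝ)).comp L -
    ((ContinuousLinearMap.fst ℝ ℝ ℝ).comp (ContinuousLinearMap.snd ℝ ℝ (ℝ × ℝ))).comp L)

lemma hasFDerivAt_lvDiff {z : ℝ × ℝ} (hz : z ∈ strip) :
    HasFDerivAt lvDiff (lvDiffDeriv z) z :=
  hasFDerivAt_fst.prodMk ((hasFDerivAt_lvSol hz).fst.sub (hasFDerivAt_lvSol hz).snd.fst)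

lemma contDiffOn_lvDiff : ContDiffOn ℝ ∞ lvDiff strip :=
  contDiff_fst.contDiffOn.prodMk (contDiffOn_lvSol.fst.sub contDiffOn_lvSol.snd.fst)

lemma lvDiffDeriv_apply (z v : ℝ × ℝ) : lvDiffDeriv z v =
    (v.1, v.1 * ((lvVar z (lvSol z.1 z.2)).1 - (lvVar z (lvSol z.1 z.2)).2.1) +
      v.2 * ((lvField (lvSol z.1 z.2)).1 - (lvField (lvSol z.1 z.2)).2.1)) := by
  simp [lvDiffDeriv, lvTotal]
  ring

/-- The derivative of `ω₁`. -/
noncomputable def omega1Deriv (c : ℝ) : ℝ :=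
  -(3 * lineZ (halfPeriods c) (omega1 c) - 9 * c * omega1 c) / (c * (1 - 27 * c))

/-- Where y¹ = y², the non-secular parts of the two c-derivatives agree and cancel. Only the flow
direction remains, and its coefficient yields the derivative of ω₁. -/
lemma lvDiffDeriv_half (hc : c ∈ Ioo (0 : ℝ) (1 / 27)) (v : ℝ × ℝ) :
    lvDiffDeriv (c, omega1 c) v = (v.1, 2 * (lvSol c (omega1 c)).1 *
      (3 * (lvSol c (omega1 c)).1 - 1) * (v.2 - v.1 * omega1Deriv c)) := by
  rw [lvDiffDeriv_apply, omega1Deriv]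
  simp only [lvVar, lvNum, lvField, lvSol_half hc, Prod.smul_mk, smul_eq_mul]
  rw [show (lvSol c (omega1 c)).2.2 = lineZ (halfPeriods c) (omega1 c) from rfl, div_eq_mul_inv]
  refine Prod.ext rfl ?_
  simp only
  ring

lemma det_lvDiffDeriv_ne (hc : c ∈ Ioo (0 : ℝ) (1 / 27)) :
    (lvDiffDeriv (c, omega1 c)).det ≠ 0 := by
  rw [det_prod, lvDiffDeriv_half hc, lvDiffDeriv_half hc]
  have h1 := lvSol_fst_pos hc (omega1 c)
  have h2 := lvSol_half_ne hc
  simp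
  exact ⟨h1.ne', h2⟩

lemma contDiffAt_omega1 (hc : c ∈ Ioo (0 : ℝ) (1 / 27)) : ContDiffAt ℝ ∞ omega1 c := by
  have hz : (c, omega1 c) ∈ strip := hc
  have h1 := contDiffOn_lvDiff.contDiffAt (isOpen_strip.mem_nhds hz)
  have h2 := hasFDerivAt_lvDiff hz
  rw [← (lvDiffDeriv (c, omega1 c)).coe_toContinuousLinearEquivOfDetNeZero
    (det_lvDiffDeriv_ne hc)] at h2
  have h3 := h1.to_localInverse h2 (by simp)
  have h4 := (h1.hasStrictFDerivAt' h2 (by simp)).eventually_left_inverse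
  rw [lvDiff_half hc] at h3
  have h5 : ContDiffAt ℝ ∞ (fun d : ℝ => (d, (0 : ℝ))) c := by fun_prop
  refine (h3.comp c h5).snd.congr_of_eventuallyEq ?_
  -- Continuity of ω₁ keeps its graph in the neighbourhood where the local inverse is valid, so the
  -- two agree.
  have h6 : Tendsto (fun d => (d, omega1 d)) (𝓝 c) (𝓝 (c, omega1 c)) :=
    (continuousAt_id.prodMk (continuousAt_omega1 hc))
  filter_upwards [h6.eventually h4, Ioo_mem_nhds hc.1 hc.2] with d hd hd'
  rw [lvDiff_half hd'] at hd
  exact (congrArg Prod.snd hd).symm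

lemma hasDerivAt_omega1 (hc : c ∈ Ioo (0 : ℝ) (1 / 27)) :
    HasDerivAt omega1 (omega1Deriv c) c := by
  have hz : (c, omega1 c) ∈ strip := hc
  have h1 := ((contDiffAt_omega1 hc).differentiableAt (by simp)).hasDerivAt
  have h2 := (hasFDerivAt_lvDiff hz).comp_hasDerivAt c ((hasDerivAt_id c).prodMk h1)
  have h3 : HasDerivAt (fun d : ℝ => (d, (0 : ℝ))) ((1 : ℝ), (0 : ℝ)) c :=
    (hasDerivAt_id c).prodMk (hasDerivAt_const c 0)
  have h4 := h3.unique (h2.congr_of_eventuallyEq (by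
    filter_upwards [Ioo_mem_nhds hc.1 hc.2] with d hd using (lvDiff_half hd).symm))
  rw [lvDiffDeriv_half hc] at h4
  have h5 := congrArg Prod.snd h4
  have h6 := lvSol_fst_pos hc (omega1 c)
  have h7 := lvSol_half_ne hc
  simp only [one_mul, zero_eq_mul] at h5
  rcases h5 with h5 | h5
  · exact absurd h5 (mul_ne_zero (by positivity) h7)
  · rw [sub_eq_zero] at h5
    rwa [← h5]

end RealHalfPeriod

end HitchinCP2

namespace HitchinCP2

open Filter Topology

/-! ### Rescaling time to s, with period 2π. -/

section PeriodicTime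

lemma ofReal_lineY (c : ℝ) (p : HalfPeriods) (x : ℝ) : (lineY c p x : ℂ) =
    c / (1 / 12 - p.lattice.weierstrassP (p.1.2 * Complex.I + x)) := by
  rw [lineY, ← ofReal_lineQ]; push_cast; rfl

/-- The real time `x = ω₁ s / π`. -/
noncomputable def realTime (r : ℝ × ℝ) : ℝ := omega1 r.1 * r.2 / π

lemma yC_eq (k : ℕ) (c s : ℝ) : yC k c s =
    (lineY c (halfPeriods c) (realTime (c, s) + k * (2 * (halfPeriods c).1.1 / 3)) : ℝ) := by
  rw [yC, ofReal_lineY, lat, omega2, omega1, realTime, omega1]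
  have hpi : (π : ℂ) ≠ 0 := by exact_mod_cast pi_ne_zero
  congr 4
  push_cast
  field_simp

lemma y_eq (k : ℕ) (c s : ℝ) : y k c s =
    lineY c (halfPeriods c) (realTime (c, s) + k * (2 * (halfPeriods c).1.1 / 3)) := by
  rw [y, yC_eq, Complex.ofReal_re]

lemma y_one (c s : ℝ) : y 1 c s = (lvSol c (realTime (c, s))).1 := by
  rw [y_eq, lvSol]; simp

lemma y_two (c s : ℝ) : y 2 c s = (lvSol c (realTime (c, s))).2.1 := by
  rw [y_eq, lvSol]
  simp only
  rw [← IsHalfPeriods.lineY_add_two_thirds]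
  congr 1; push_cast; ring

lemma y_three (c s : ℝ) : y 3 c s = lineY c (halfPeriods c) (realTime (c, s)) := by
  rw [y_eq, ← lineY_periodic c (halfPeriods c) (realTime (c, s))]
  congr 1; push_cast; ring

variable {c : ℝ}

lemma y_pos (hc : c ∈ Ioo (0 : ℝ) (1 / 27)) (k : ℕ) (s : ℝ) : 0 < y k c s := by
  rw [y_eq]
  exact (isHalfPeriods_halfPeriods hc).lineY_pos hc.1 _

lemma y_three_eq (hc : c ∈ Ioo (0 : ℝ) (1 / 27)) (s : ℝ) : y 3 c s = 1 - y 1 c s - y 2 c s := by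
  rw [y_one, y_two, y_three, lvSol_third hc]

lemma y_sum (hc : c ∈ Ioo (0 : ℝ) (1 / 27)) (s : ℝ) : y 1 c s + y 2 c s + y 3 c s = 1 := by
  rw [y_three_eq hc]; ring

lemma y_prod (hc : c ∈ Ioo (0 : ℝ) (1 / 27)) (s : ℝ) : y 1 c s * y 2 c s * y 3 c s = c := by
  rw [y_three_eq hc, y_one, y_two, lvSol_prod hc]

/-- The terms x/12 built into `lineZ` cancel between ζ and (s/π)η₁, since x = ω₁s/π. -/
lemma varsigmaC_eq (c s : ℝ) : varsigmaC c s = (lineZ (halfPeriods c) (realTime (c, s)) -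
    s / π * lineZ (halfPeriods c) (omega1 c) : ℝ) := by
  have h1 := ofReal_lineZ (halfPeriods c) (realTime (c, s))
  have h2 := ofReal_lineZ_half (halfPeriods c)
  have hpi : (π : ℂ) ≠ 0 := by exact_mod_cast pi_ne_zero
  rw [varsigmaC, eta1, eta2, lat, omega2, omega1, ← h2]
  have e : ((halfPeriods c).1.2 * Complex.I + (s : ℂ) * ((halfPeriods c).1.1 : ℂ) / π) =
      ((halfPeriods c).1.2 * Complex.I + (realTime (c, s) : ℝ)) := by
    rw [realTime, omega1]; push_cast; ring
  rw [e]
  rw [eq_comm, sub_eq_iff_eq_add] at h1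
  rw [h1, realTime, omega1]
  push_cast
  field_simp
  ring

lemma varsigma_eq (c s : ℝ) : varsigma c s = lineZ (halfPeriods c) (realTime (c, s)) -
    s / π * lineZ (halfPeriods c) (omega1 c) := by
  rw [varsigma, varsigmaC_eq, Complex.ofReal_re]

/-- The map `(c, s) ↦ (y¹, y²)`. -/
noncomputable def yMap (r : ℝ × ℝ) : ℝ × ℝ := (y 1 r.1 r.2, y 2 r.1 r.2)

lemma yMap_eq (r : ℝ × ℝ) :
    yMap r = ((lvSol r.1 (realTime r)).1, (lvSol r.1 (realTime r)).2.1) := by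
  rw [yMap, y_one, y_two]

/-- The derivative of `(y¹, y²)` along `s`, up to the factor `ω₁ / π`. -/
noncomputable def yFlow (r : ℝ × ℝ) : ℝ × ℝ :=
  (y 1 r.1 r.2 * (y 1 r.1 r.2 + 2 * y 2 r.1 r.2 - 1),
    y 2 r.1 r.2 * (1 - 2 * y 1 r.1 r.2 - y 2 r.1 r.2))

/-- The derivative of `(y¹, y²)` along `c`, up to the factor `1 / (c (1 - 27 c))`. -/
noncomputable def yVar (r : ℝ × ℝ) : ℝ × ℝ :=
  let p := y 1 r.1 r.2
  let q := y 2 r.1 r.2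
  let A := 1 + 3 * q - 18 * p * q
  let B := 1 + 3 * p - 18 * p * q
  (p * (A - (A * p + B * q)) / 2, q * (B - (A * p + B * q)) / 2) +
    (3 * varsigma r.1 r.2) • yFlow r

/-- The derivative of `yMap`. -/
noncomputable def yDeriv (r : ℝ × ℝ) : ℝ × ℝ →L[ℝ] ℝ × ℝ :=
  (ContinuousLinearMap.fst ℝ ℝ ℝ).smulRight ((r.1 * (1 - 27 * r.1))⁻¹ • yVar r) +
    (ContinuousLinearMap.snd ℝ ℝ ℝ).smulRight ((omega1 r.1 / π) • yFlow r)

lemma contDiffOn_omega1 : ContDiffOn ℝ ∞ (fun r : ℝ × ℝ => omega1 r.1) strip :=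
  fun r hr => ((contDiffAt_omega1 hr).comp r contDiff_fst.contDiffAt).contDiffWithinAt

lemma contDiffOn_realTime : ContDiffOn ℝ ∞ realTime strip :=
  (contDiffOn_omega1.mul contDiff_snd.contDiffOn).div_const π

lemma contDiffOn_yMap : ContDiffOn ℝ ∞ yMap strip := by
  have h : ContDiffOn ℝ ∞ (fun r : ℝ × ℝ => lvSol r.1 (realTime r)) strip :=
    contDiffOn_lvSol.comp (contDiff_fst.contDiffOn.prodMk contDiffOn_realTime) fun _ hr => hr
  exact (h.fst.prodMk h.snd.fst).congr fun r _ => yMap_eq r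

/-- The chain rule adds ω₁'(c)·s/π to the flow coefficient 3Z − 9cx over c(1 − 27c). The terms 9cx
cancel and exactly 3ς over c(1 − 27c) is left. -/
lemma hasFDerivAt_yMap {r : ℝ × ℝ} (hr : r ∈ strip) : HasFDerivAt yMap (yDeriv r) r := by
  have hc : r.1 ∈ Ioo (0 : ℝ) (1 / 27) := hr
  have hω : HasFDerivAt (fun r : ℝ × ℝ => omega1 r.1) _ r :=
    (hasDerivAt_omega1 hc).hasFDerivAt.comp r hasFDerivAt_fst
  have ht : HasFDerivAt realTime _ r := (hω.mul hasFDerivAt_snd).mul_const π⁻¹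
  have hz : (r.1, realTime r) ∈ strip := hr
  have hp : HasFDerivAt (fun r : ℝ × ℝ => (r.1, realTime r)) _ r := hasFDerivAt_fst.prodMk ht
  have h : HasFDerivAt (fun r : ℝ × ℝ => lvSol r.1 (realTime r)) _ r :=
    HasFDerivAt.comp (g := fun z : ℝ × ℝ => lvSol z.1 z.2) r (hasFDerivAt_lvSol hz) hp
  have h' := (h.fst.prodMk h.snd.fst).congr_of_eventuallyEq
    (Eventually.of_forall fun r => yMap_eq r)
  convert! h' using 1
  refine ContinuousLinearMap.ext fun v => ?_
  have hZ : (lvSol r.1 (realTime r)).2.2 = lineZ (halfPeriods r.1) (realTime r) := rfl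
  have hx : realTime r = omega1 r.1 * r.2 * π⁻¹ := rfl
  simp only [yDeriv, lvTotal, yVar, yFlow, varsigma_eq, y_one, y_two, lvVar, lvNum, lvField,
    omega1Deriv, hZ, div_eq_mul_inv]
  simp
  generalize lineZ (halfPeriods r.1) (realTime r) = Z
  generalize (lvSol r.1 (realTime r)).1 = p
  generalize (lvSol r.1 (realTime r)).2.1 = q
  rw [hx]
  refine ⟨?_, ?_⟩ <;> ring

end PeriodicTime

end HitchinCP2

namespace HitchinCP2

open Filter Topology

/-! ### Local diffeomorphisms from the inverse function theorem. -/

section InverseFunction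

variable {E F : Type*} [NormedAddCommGroup E] [NormedSpace ℝ E] [CompleteSpace E]
  [NormedAddCommGroup F] [NormedSpace ℝ F]

lemma exists_openPartialHomeomorph {f : E → F} {U : Set E} (hU : IsOpen U)
    (hf : ContDiffOn ℝ ∞ f U) (hf' : ∀ x ∈ U, ∃ A : E ≃L[ℝ] F, HasFDerivAt f (A : E →L[ℝ] F) x)
    {x : E} (hx : x ∈ U) :
    ∃ e : OpenPartialHomeomorph E F, x ∈ e.source ∧ e.source ⊆ U ∧ (∀ z, e z = f z) ∧
      ContDiffOn ℝ ∞ e e.source ∧ ContDiffOn ℝ ∞ e.symm e.target := by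
  obtain ⟨A, hA⟩ := hf' x hx
  have h1 := hf.contDiffAt (hU.mem_nhds hx)
  refine ⟨(h1.toOpenPartialHomeomorph f hA (by simp)).restrOpen U hU, ?_, ?_, fun z => rfl, ?_, ?_⟩
  · exact ⟨h1.mem_toOpenPartialHomeomorph_source hA (by simp), hx⟩
  · exact fun z hz => hz.2
  · exact hf.mono fun z hz => hz.2
  · intro v hv
    set e := (h1.toOpenPartialHomeomorph f hA (by simp)).restrOpen U hU
    have hs : e.symm v ∈ U := (e.map_target hv).2
    obtain ⟨B, hB⟩ := hf' _ hs
    exact (e.contDiffAt_symm hv hB (hf.contDiffAt (hU.mem_nhds hs))).contDiffWithinAt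

lemma isLocalDiffeomorphOn_of_hasFDerivAt {f : E → F} {U : Set E} (hU : IsOpen U)
    (hf : ContDiffOn ℝ ∞ f U) (hf' : ∀ x ∈ U, ∃ A : E ≃L[ℝ] F, HasFDerivAt f (A : E →L[ℝ] F) x) :
    IsLocalDiffeomorphOn 𝓘(ℝ, E) 𝓘(ℝ, F) ∞ f U := by
  rintro ⟨x, hx⟩
  obtain ⟨e, h1, -, h3, h4, h5⟩ := exists_openPartialHomeomorph hU hf hf' hx
  exact ⟨⟨e.toPartialEquiv, e.open_source, e.open_target, h4.contMDiffOn, h5.contMDiffOn⟩, h1,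
    fun z _ => (h3 z).symm⟩

end InverseFunction

/-! ### The Jacobian of (c, s) against (y¹, y²). -/

section Jacobian

/-- The ς-term of the c-derivative is parallel to the flow and drops out; the rest of the
determinant reduces, through y¹y²y³ = c, to c(1 − 27c). -/
lemma det_yDeriv {r : ℝ × ℝ} (hr : r ∈ strip) : (yDeriv r).det = omega1 r.1 / π := by
  have hc : r.1 ∈ Ioo (0 : ℝ) (1 / 27) := hr
  have h1 := y_prod hc r.2
  rw [y_three_eq hc] at h1
  have hD : r.1 * (1 - 27 * r.1) ≠ 0 := mul_ne_zero hc.1.ne' (by linarith [hc.2])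
  have h2 : (yVar r).1 * (yFlow r).2 - (yFlow r).1 * (yVar r).2 = r.1 * (1 - 27 * r.1) := by
    simp only [yVar, yFlow, Prod.fst_add, Prod.snd_add, Prod.smul_mk, smul_eq_mul]
    generalize y 1 r.1 r.2 = p at h1
    generalize y 2 r.1 r.2 = q at h1
    linear_combination (1 - 27 * (p * q * (1 - p - q) + r.1)) * h1
  rw [det_prod]
  simp only [yDeriv, add_apply, ContinuousLinearMap.smulRight_apply,
    ContinuousLinearMap.coe_fst', ContinuousLinearMap.coe_snd', one_smul, zero_smul, add_zero,
    zero_add, Prod.smul_fst, Prod.smul_snd, smul_eq_mul]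
  calc _ = ((r.1 * (1 - 27 * r.1))⁻¹ * ((yVar r).1 * (yFlow r).2 - (yFlow r).1 * (yVar r).2)) *
        (omega1 r.1 / π) := by ring
    _ = _ := by rw [h2, inv_mul_cancel₀ hD, one_mul]

lemma det_yDeriv_ne {r : ℝ × ℝ} (hr : r ∈ strip) : (yDeriv r).det ≠ 0 := by
  rw [det_yDeriv hr]
  have := omega1_pos r.1
  positivity

lemma exists_chart_yMap {q : ℝ × ℝ} (hq : q.1 ∈ Ioo (0 : ℝ) (1 / 27)) :
    ∃ e : OpenPartialHomeomorph (ℝ × ℝ) (ℝ × ℝ),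
      q ∈ e.source ∧ e.source ⊆ {r | r.1 ∈ Ioo (0 : ℝ) (1 / 27)} ∧
      (∀ r ∈ e.source, e r = (y 1 r.1 r.2, y 2 r.1 r.2)) ∧
      ContDiffOn ℝ ∞ e e.source ∧ ContDiffOn ℝ ∞ e.symm e.target ∧
      ∀ v ∈ e.target, (fderiv ℝ e.symm v).det = π / omega1 (e.symm v).1 := by
  obtain ⟨e, h1, h2, h3, h4, h5⟩ := exists_openPartialHomeomorph isOpen_strip contDiffOn_yMap
    (fun r hr => ⟨(yDeriv r).toContinuousLinearEquivOfDetNeZero (det_yDeriv_ne hr),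
      by simpa using hasFDerivAt_yMap hr⟩) (show q ∈ strip from hq)
  refine ⟨e, h1, h2, fun r _ => h3 r, h4, h5, fun v hv => ?_⟩
  have hs : e.symm v ∈ strip := h2 (e.map_target hv)
  have h6 := hasFDerivAt_yMap hs
  rw [← (yDeriv (e.symm v)).coe_toContinuousLinearEquivOfDetNeZero (det_yDeriv_ne hs)] at h6
  have h7 := e.hasFDerivAt_symm hv (h6.congr_of_eventuallyEq (Eventually.of_forall h3))
  rw [h7.fderiv, ContinuousLinearEquiv.det_coe_symm,
    ContinuousLinearMap.coe_toContinuousLinearEquivOfDetNeZero, det_yDeriv hs, inv_div]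

end Jacobian

end HitchinCP2

namespace HitchinCP2

open Filter Topology

/-! ### Logarithms of the moduli of z₁, z₂. -/

section LogCoordinates

/-- The logarithms `log |z_k|` of the inhomogeneous coordinates. -/
noncomputable def rhoMap (r : ℝ × ℝ) : ℝ × ℝ :=
  (log (y 1 r.1 r.2 / y 3 r.1 r.2) / 2, log (y 2 r.1 r.2 / y 3 r.1 r.2) / 2)

/-- The derivative of `rhoMap` along `c`. -/
noncomputable def rhoC (r : ℝ × ℝ) : ℝ × ℝ :=
  (1 / (4 * r.1 * (1 - 27 * r.1)) * (1 + 3 * y 2 r.1 r.2 - 18 * y 1 r.1 r.2 * y 2 r.1 r.2 -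
      6 * varsigma r.1 r.2 * (1 - 3 * y 2 r.1 r.2)),
    1 / (4 * r.1 * (1 - 27 * r.1)) * (1 + 3 * y 1 r.1 r.2 - 18 * y 1 r.1 r.2 * y 2 r.1 r.2 +
      6 * varsigma r.1 r.2 * (1 - 3 * y 1 r.1 r.2)))

/-- The derivative of `rhoMap` along `s`. -/
noncomputable def rhoS (r : ℝ × ℝ) : ℝ × ℝ :=
  (omega1 r.1 / (2 * π) * (3 * y 2 r.1 r.2 - 1), omega1 r.1 / (2 * π) * (1 - 3 * y 1 r.1 r.2))

/-- The determinant of ρ in (c, s) is ω₁/(4πc), as ς cancels and the rest simplifies through y¹y²y³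
= c. It inverts the Jacobian matrix for J and is the coefficient of ∂_c ∧ ∂_s in Q. -/
lemma rhoC_rhoS {r : ℝ × ℝ} (hr : r ∈ strip) :
    4 * r.1 * π / omega1 r.1 * ((rhoC r).1 * (rhoS r).2 - (rhoC r).2 * (rhoS r).1) = 1 := by
  have hc : r.1 ∈ Ioo (0 : ℝ) (1 / 27) := hr
  have h1 := y_prod hc r.2
  rw [y_three_eq hc] at h1
  have hω := omega1_pos r.1
  have hD : 1 - 27 * r.1 ≠ 0 := by linarith [hc.2]
  have hc0 := hc.1.ne'
  simp only [rhoC, rhoS]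
  generalize y 1 r.1 r.2 = p at h1
  generalize y 2 r.1 r.2 = q at h1
  generalize varsigma r.1 r.2 = ς
  have h2 : (1 + 3 * q - 18 * p * q - 6 * ς * (1 - 3 * q)) * (1 - 3 * p) -
      (1 + 3 * p - 18 * p * q + 6 * ς * (1 - 3 * p)) * (3 * q - 1) = 2 * (1 - 27 * r.1) := by
    linear_combination (-54) * h1
  calc _ = 4 * r.1 * π / omega1 r.1 * (1 / (4 * r.1 * (1 - 27 * r.1)) * (omega1 r.1 / (2 * π)) *
        ((1 + 3 * q - 18 * p * q - 6 * ς * (1 - 3 * q)) * (1 - 3 * p) -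
          (1 + 3 * p - 18 * p * q + 6 * ς * (1 - 3 * p)) * (3 * q - 1))) := by ring
    _ = 1 := by
      rw [h2]
      generalize 1 - 27 * r.1 = d at hD
      field_simp

lemma yMap_third_pos {r : ℝ × ℝ} (hr : r ∈ strip) : 0 < 1 - (yMap r).1 - (yMap r).2 := by
  have := y_pos (c := r.1) hr 3 r.2
  rwa [y_three_eq hr] at this

lemma rhoMap_eq {r : ℝ × ℝ} (hr : r ∈ strip) : rhoMap r =
    ((log (yMap r).1 - log (1 - (yMap r).1 - (yMap r).2)) / 2,
      (log (yMap r).2 - log (1 - (yMap r).1 - (yMap r).2)) / 2) := by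
  have h1 := (y_pos (c := r.1) hr 1 r.2).ne'
  have h2 := (y_pos (c := r.1) hr 2 r.2).ne'
  have h3 := (y_pos (c := r.1) hr 3 r.2).ne'
  rw [rhoMap, log_div h1 h3, log_div h2 h3, y_three_eq hr, yMap]

lemma contDiffOn_rhoMap : ContDiffOn ℝ ∞ rhoMap strip := by
  have h1 := contDiffOn_yMap.fst
  have h2 := contDiffOn_yMap.snd
  have h3 : ContDiffOn ℝ ∞ (fun r => 1 - (yMap r).1 - (yMap r).2) strip :=
    (contDiffOn_const.sub h1).sub h2
  have l1 := h1.log fun r hr => (y_pos (c := r.1) hr 1 r.2).ne'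
  have l2 := h2.log fun r hr => (y_pos (c := r.1) hr 2 r.2).ne'
  have l3 := h3.log fun r hr => (yMap_third_pos hr).ne'
  exact (((l1.sub l3).div_const 2).prodMk ((l2.sub l3).div_const 2)).congr
    fun r hr => rhoMap_eq hr

/-- The derivative of `rhoMap`. -/
noncomputable def rhoDeriv (r : ℝ × ℝ) : ℝ × ℝ →L[ℝ] ℝ × ℝ :=
  (ContinuousLinearMap.fst ℝ ℝ ℝ).smulRight (rhoC r) +
    (ContinuousLinearMap.snd ℝ ℝ ℝ).smulRight (rhoS r)

lemma hasFDerivAt_rhoMap {r : ℝ × ℝ} (hr : r ∈ strip) : HasFDerivAt rhoMap (rhoDeriv r) r := by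
  have p1 : (yMap r).1 ≠ 0 := (y_pos (c := r.1) hr 1 r.2).ne'
  have p2 : (yMap r).2 ≠ 0 := (y_pos (c := r.1) hr 2 r.2).ne'
  have p3 := (yMap_third_pos hr).ne'
  have h1 := (hasFDerivAt_yMap hr).fst
  have h2 := (hasFDerivAt_yMap hr).snd
  have h3 : HasFDerivAt (fun r => 1 - (yMap r).1 - (yMap r).2) _ r := (h1.const_sub 1).sub h2
  have l1 := h1.log p1
  have l2 := h2.log p2
  have l3 := h3.log p3
  have h := (((l1.sub l3).mul_const (2 : ℝ)⁻¹).prodMk ((l2.sub l3).mul_const (2 : ℝ)⁻¹))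
  have h' := h.congr_of_eventuallyEq (f₁ := rhoMap) (by
    filter_upwards [isOpen_strip.mem_nhds hr] with r hr using rhoMap_eq hr)
  convert! h' using 1
  have e1 : (yMap r).1 = y 1 r.1 r.2 := rfl
  have e2 : (yMap r).2 = y 2 r.1 r.2 := rfl
  have hc : r.1 ∈ Ioo (0 : ℝ) (1 / 27) := hr
  have hD : 1 - 27 * r.1 ≠ 0 := by linarith [hc.2]
  have hc0 := hc.1.ne'
  refine ContinuousLinearMap.ext fun v => ?_
  simp [rhoDeriv, rhoC, rhoS, yDeriv, yVar, yFlow, ← e1, ← e2]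
  generalize (yMap r).1 = p at p1 p3
  generalize (yMap r).2 = q at p2 p3
  constructor
  · field_simp
    ring
  · field_simp
    ring

end LogCoordinates

end HitchinCP2

namespace HitchinCP2

open Filter Topology

/-! ### The coordinates in the affine chart and the complex structure. -/

section Parametrization

lemma isOpen_coordDomain : IsOpen coordDomain :=
  isOpen_Ioo.preimage (continuous_apply 0)

/-- The coordinates `(c₃, s)` of a point. -/
noncomputable def base : (Fin 4 → ℝ) →L[ℝ] ℝ × ℝ :=
  (ContinuousLinearMap.proj 0).prod (ContinuousLinearMap.proj 1)

lemma base_apply (x : Fin 4 → ℝ) : base x = (x 0, x 1) := rfl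

lemma ofReal_sqrt_div {a b : ℝ} (ha : 0 < a) (hb : 0 < b) :
    (√(a / b) : ℂ) = Complex.exp ((log (a / b) / 2 : ℝ) : ℂ) := by
  rw [← Complex.ofReal_exp, exp_half, exp_log (div_pos ha hb)]

/-- In the holomorphic logarithms ρ_k + iθ_k, multiplication by i has constant coefficients. -/
lemma param_eq {x : Fin 4 → ℝ} (hx : x ∈ coordDomain) : param x =
    ![Complex.exp ((rhoMap (base x)).1 + x 2 * Complex.I),
      Complex.exp ((rhoMap (base x)).2 + x 3 * Complex.I)] := by
  rw [param, base_apply, rhoMap, ofReal_sqrt_div (y_pos hx 1 _) (y_pos hx 3 _),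
    ofReal_sqrt_div (y_pos hx 2 _) (y_pos hx 3 _), Complex.exp_add, Complex.exp_add]

lemma param_ne_zero {x : Fin 4 → ℝ} (hx : x ∈ coordDomain) (k : Fin 2) : param x k ≠ 0 := by
  rw [param_eq hx]
  fin_cases k <;> exact Complex.exp_ne_zero _

/-- The derivative of `param`. -/
noncomputable def paramDeriv (x : Fin 4 → ℝ) : (Fin 4 → ℝ) →L[ℝ] (Fin 2 → ℂ) :=
  ContinuousLinearMap.pi ![
    (param x 0) • (Complex.ofRealCLM.comp ((ContinuousLinearMap.fst ℝ ℝ ℝ).comp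
        ((rhoDeriv (base x)).comp base)) +
      Complex.I • Complex.ofRealCLM.comp (ContinuousLinearMap.proj 2)),
    (param x 1) • (Complex.ofRealCLM.comp ((ContinuousLinearMap.snd ℝ ℝ ℝ).comp
        ((rhoDeriv (base x)).comp base)) +
      Complex.I • Complex.ofRealCLM.comp (ContinuousLinearMap.proj 3))]

lemma paramDeriv_apply (x v : Fin 4 → ℝ) : paramDeriv x v =
    ![param x 0 * ((v 0 * (rhoC (base x)).1 + v 1 * (rhoS (base x)).1 : ℝ) + v 2 * Complex.I),
      param x 1 * ((v 0 * (rhoC (base x)).2 + v 1 * (rhoS (base x)).2 : ℝ) + v 3 * Complex.I)] := by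
  ext k
  fin_cases k <;> simp [paramDeriv, rhoDeriv, base] <;> ring

lemma hasFDerivAt_param {x : Fin 4 → ℝ} (hx : x ∈ coordDomain) :
    HasFDerivAt param (paramDeriv x) x := by
  have hr : base x ∈ strip := hx
  have hρ : HasFDerivAt (fun x => rhoMap (base x)) ((rhoDeriv (base x)).comp base) x :=
    (hasFDerivAt_rhoMap hr).comp x base.hasFDerivAt
  have h1 := Complex.ofRealCLM.hasFDerivAt.comp x hρ.fst
  have h2 := Complex.ofRealCLM.hasFDerivAt.comp x hρ.snd
  have t : ∀ k : Fin 4, HasFDerivAt (fun x : Fin 4 → ℝ => (x k : ℂ) * Complex.I)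
      (Complex.I • Complex.ofRealCLM.comp (ContinuousLinearMap.proj k)) x := fun k =>
    (Complex.ofRealCLM.hasFDerivAt.comp x (hasFDerivAt_apply k x)).mul_const Complex.I
  have e1 := (h1.add (t 2)).cexp
  have e2 := (h2.add (t 3)).cexp
  have hp := param_eq hx
  refine HasFDerivAt.congr_of_eventuallyEq (f := fun x =>
    ![Complex.exp ((rhoMap (base x)).1 + x 2 * Complex.I),
      Complex.exp ((rhoMap (base x)).2 + x 3 * Complex.I)]) ?_ (by
    filter_upwards [isOpen_coordDomain.mem_nhds hx] with z hz using param_eq hz)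
  rw [hasFDerivAt_pi']
  intro k
  rw [paramDeriv, hp]
  fin_cases k
  · exact e1
  · exact e2

lemma contDiffOn_param : ContDiffOn ℝ ∞ param coordDomain := by
  have h : ContDiffOn ℝ ∞ (fun x => rhoMap (base x)) coordDomain :=
    contDiffOn_rhoMap.comp base.contDiff.contDiffOn fun _ hx => hx
  have t : ∀ k : Fin 4, ContDiffOn ℝ ∞ (fun x : Fin 4 → ℝ => (x k : ℂ) * Complex.I) coordDomain :=
    fun k => ((Complex.ofRealCLM.contDiff.comp (contDiff_apply ℝ ℝ k)).mul
      contDiff_const).contDiffOn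
  have e1 := ((Complex.ofRealCLM.contDiff.comp_contDiffOn h.fst).add (t 2)).cexp
  have e2 := ((Complex.ofRealCLM.contDiff.comp_contDiffOn h.snd).add (t 3)).cexp
  refine ContDiffOn.congr ?_ fun x hx => param_eq hx
  rw [contDiffOn_pi]
  intro k
  fin_cases k
  · exact e1
  · exact e2

lemma ofReal_add_mul_I_eq_zero {a b : ℝ} (h : (a : ℂ) + b * Complex.I = 0) : a = 0 ∧ b = 0 := by
  have h1 := congrArg Complex.re h
  have h2 := congrArg Complex.im h
  simp at h1 h2
  exact ⟨h1, h2⟩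

lemma paramDeriv_injective {x : Fin 4 → ℝ} (hx : x ∈ coordDomain) :
    Function.Injective (paramDeriv x) := by
  rw [injective_iff_map_eq_zero]
  intro v hv
  rw [paramDeriv_apply] at hv
  have h0 := congrFun hv 0
  have h1 := congrFun hv 1
  simp only [Matrix.cons_val_zero, Matrix.cons_val_one, Pi.zero_apply, mul_eq_zero,
    param_ne_zero hx, false_or] at h0 h1
  obtain ⟨h2, h3⟩ := ofReal_add_mul_I_eq_zero h0
  obtain ⟨h4, h5⟩ := ofReal_add_mul_I_eq_zero h1
  have hd := rhoC_rhoS (r := base x) hx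
  set k := 4 * (base x).1 * π / omega1 (base x).1
  -- Cramer's rule with the determinant of `rhoC_rhoS`.
  have h6 : v 0 = 0 := by
    linear_combination (-v 0) * hd + k * (rhoS (base x)).2 * h2 - k * (rhoS (base x)).1 * h4
  have h7 : v 1 = 0 := by
    linear_combination (-v 1) * hd - k * (rhoC (base x)).2 * h2 + k * (rhoC (base x)).1 * h4
  ext k
  fin_cases k <;> assumption

/-- The derivative of `param` as an isomorphism. -/
noncomputable def paramEquiv {x : Fin 4 → ℝ} (hx : x ∈ coordDomain) :
    (Fin 4 → ℝ) ≃L[ℝ] (Fin 2 → ℂ) :=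
  (LinearEquiv.ofInjectiveOfFinrankEq (paramDeriv x : (Fin 4 → ℝ) →ₗ[ℝ] (Fin 2 → ℂ))
    (paramDeriv_injective hx) (by simp [Module.finrank_pi_fintype])).toContinuousLinearEquiv

lemma coe_paramEquiv {x : Fin 4 → ℝ} (hx : x ∈ coordDomain) :
    (paramEquiv hx : (Fin 4 → ℝ) →L[ℝ] (Fin 2 → ℂ)) = paramDeriv x := rfl

lemma isLocalDiffeomorphOn_param :
    IsLocalDiffeomorphOn 𝓘(ℝ, Fin 4 → ℝ) 𝓘(ℝ, Fin 2 → ℂ) ∞ param coordDomain :=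
  isLocalDiffeomorphOn_of_hasFDerivAt isOpen_coordDomain contDiffOn_param fun _ hx =>
    ⟨paramEquiv hx, hasFDerivAt_param hx⟩

/-- The matrix of the standard complex structure. -/
noncomputable def complexStructure (x : Fin 4 → ℝ) : Fin 4 → Fin 4 → ℝ :=
  let k := 4 * x 0 * π / omega1 (x 0)
  ![![0, 0, -(k * (rhoS (base x)).2), k * (rhoS (base x)).1],
    ![0, 0, k * (rhoC (base x)).2, -(k * (rhoC (base x)).1)],
    ![(rhoC (base x)).1, (rhoS (base x)).1, 0, 0],
    ![(rhoC (base x)).2, (rhoS (base x)).2, 0, 0]]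

/-- Multiplication by i sends ∂_{ρ_k} to ∂_{θ_k} and ∂_{θ_k} to −∂_{ρ_k}. So one block of J is the
Jacobian matrix of ρ in (c, s), and the other is minus its inverse, given by cofactors. -/
lemma J_eq {x : Fin 4 → ℝ} (hx : x ∈ coordDomain) (a b : Fin 4) :
    J x a b = complexStructure x a b := by
  have h : (fderiv ℝ param x).inverse (Complex.I • fderiv ℝ param x (dd b)) =
      fun a => complexStructure x a b := by
    rw [(hasFDerivAt_param hx).fderiv, ← coe_paramEquiv hx, ContinuousLinearMap.inverse_equiv,
      ContinuousLinearEquiv.coe_coe, ContinuousLinearEquiv.symm_apply_eq]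
    simp only [← ContinuousLinearEquiv.coe_coe, coe_paramEquiv, paramDeriv_apply]
    have hd := rhoC_rhoS (r := base x) hx
    rw [show (base x).1 = x 0 from rfl] at hd
    simp only [complexStructure]
    generalize 4 * x 0 * π / omega1 (x 0) = k at hd
    have hd' := congrArg (fun t : ℝ => (t : ℂ)) hd
    push_cast at hd'
    have hI := Complex.I_sq
    ext m
    fin_cases b <;> fin_cases m <;> simp [dd]
    · ring
    · ring
    · ring
    · ring
    · linear_combination (param x 0) * hI + (param x 0) * hd'
    · right; ring
    · right; ring
    · linear_combination (param x 1) * hI + (param x 1) * hd'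
  rw [J, h]

end Parametrization

end HitchinCP2

namespace HitchinCP2

open Filter Topology

/-! ### The components of J and of the Hitchin Poisson tensor. -/

section Tensors

lemma complexStructure_formulas {c : ℝ} (s θ₁ θ₂ : ℝ) (hc : c ∈ Ioo (0 : ℝ) (1 / 27)) :
    J ![c, s, θ₁, θ₂] 2 1 = omega1 c / (2 * π) * (3 * y 2 c s - 1) ∧
    J ![c, s, θ₁, θ₂] 3 1 = omega1 c / (2 * π) * (1 - 3 * y 1 c s) ∧
    J ![c, s, θ₁, θ₂] 0 2 = 4 * π * c / omega1 c * -J ![c, s, θ₁, θ₂] 3 1 ∧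
    J ![c, s, θ₁, θ₂] 0 3 = 4 * π * c / omega1 c * J ![c, s, θ₁, θ₂] 2 1 ∧
    J ![c, s, θ₁, θ₂] 2 0 = 1 / (4 * c * (1 - 27 * c)) *
      (1 + 3 * y 2 c s - 18 * y 1 c s * y 2 c s - 6 * varsigma c s * (1 - 3 * y 2 c s)) ∧
    J ![c, s, θ₁, θ₂] 3 0 = 1 / (4 * c * (1 - 27 * c)) *
      (1 + 3 * y 1 c s - 18 * y 1 c s * y 2 c s + 6 * varsigma c s * (1 - 3 * y 1 c s)) ∧
    J ![c, s, θ₁, θ₂] 1 2 = 4 * c * π / omega1 c * J ![c, s, θ₁, θ₂] 3 0 ∧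
    J ![c, s, θ₁, θ₂] 1 3 = 4 * c * π / omega1 c * -J ![c, s, θ₁, θ₂] 2 0 ∧
    (∀ a ∈ ({0, 1} : Set (Fin 4)), ∀ b ∈ ({0, 1} : Set (Fin 4)), J ![c, s, θ₁, θ₂] a b = 0) ∧
    (∀ a ∈ ({2, 3} : Set (Fin 4)), ∀ b ∈ ({2, 3} : Set (Fin 4)), J ![c, s, θ₁, θ₂] a b = 0) := by
  have hx : ![c, s, θ₁, θ₂] ∈ coordDomain := hc
  have h : ∀ a b, J ![c, s, θ₁, θ₂] a b =
      (let k := 4 * c * π / omega1 c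
      ![![0, 0, -(k * (rhoS (c, s)).2), k * (rhoS (c, s)).1],
        ![0, 0, k * (rhoC (c, s)).2, -(k * (rhoC (c, s)).1)],
        ![(rhoC (c, s)).1, (rhoS (c, s)).1, 0, 0],
        ![(rhoC (c, s)).2, (rhoS (c, s)).2, 0, 0]] : Fin 4 → Fin 4 → ℝ) a b := J_eq hx
  simp only [h]
  refine ⟨rfl, rfl, ?_, ?_, rfl, rfl, rfl, ?_, ?_, ?_⟩
  · show -(4 * c * π / omega1 c * (rhoS (c, s)).2) = 4 * π * c / omega1 c * -(rhoS (c, s)).2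
    ring
  · show 4 * c * π / omega1 c * (rhoS (c, s)).1 = 4 * π * c / omega1 c * (rhoS (c, s)).1
    ring
  · show -(4 * c * π / omega1 c * (rhoC (c, s)).1) = 4 * c * π / omega1 c * -(rhoC (c, s)).1
    ring
  · rintro a (rfl | rfl) b (rfl | rfl) <;> rfl
  · rintro a (rfl | rfl) b (rfl | rfl) <;> rfl

lemma covector_apply (α : (Fin 2 → ℂ) →L[ℝ] ℝ) (u w : ℂ) : α ![u, w] =
    (u.re * α (Pi.single 0 1) + u.im * α (Pi.single 0 Complex.I)) +
      (w.re * α (Pi.single 1 1) + w.im * α (Pi.single 1 Complex.I)) := by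
  have e : (![u, w] : Fin 2 → ℂ) =
      (u.re • (Pi.single 0 1 : Fin 2 → ℂ) + u.im • (Pi.single 0 Complex.I : Fin 2 → ℂ)) +
        (w.re • (Pi.single 1 1 : Fin 2 → ℂ) + w.im • (Pi.single 1 Complex.I : Fin 2 → ℂ)) := by
    ext k
    fin_cases k <;> simp [Complex.re_add_im]
  rw [e]
  simp only [map_add, map_smul, smul_eq_mul]

/-- Since z_k∂_{z_k} = (∂_{ρ_k} − i∂_{θ_k})/2, the tensor is ∂_{ρ₁}∧∂_{ρ₂} − ∂_{θ₁}∧∂_{θ₂}. The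
first bivector is rescaled by the inverse Jacobian determinant. -/
lemma hitchinQ_eq {x : Fin 4 → ℝ} (hx : x ∈ coordDomain) (α β : (Fin 2 → ℂ) →L[ℝ] ℝ) :
    hitchinQ (param x) α β =
      4 * x 0 * π / omega1 (x 0) *
          wedge (dd 0) (dd 1) (α.comp (fderiv ℝ param x)) (β.comp (fderiv ℝ param x)) -
        wedge (dd 2) (dd 3) (α.comp (fderiv ℝ param x)) (β.comp (fderiv ℝ param x)) := by
  have hd := rhoC_rhoS (r := base x) hx
  rw [show (base x).1 = x 0 from rfl] at hd
  rw [(hasFDerivAt_param hx).fderiv]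
  simp only [wedge, ContinuousLinearMap.comp_apply, paramDeriv_apply, covector_apply, hitchinQ,
    sigma, pairDz]
  generalize param x 0 = u
  generalize param x 1 = w
  generalize 4 * x 0 * π / omega1 (x 0) = k at hd
  generalize α (Pi.single 0 1) = a₁
  generalize α (Pi.single 0 Complex.I) = a₂
  generalize α (Pi.single 1 1) = a₃
  generalize α (Pi.single 1 Complex.I) = a₄
  generalize β (Pi.single 0 1) = b₁
  generalize β (Pi.single 0 Complex.I) = b₂
  generalize β (Pi.single 1 1) = b₃
  generalize β (Pi.single 1 Complex.I) = b₄
  simp [dd]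
  linear_combination (-((u.re * a₁ + u.im * a₂) * (w.re * b₃ + w.im * b₄) -
    (w.re * a₃ + w.im * a₄) * (u.re * b₁ + u.im * b₂))) * hd

end Tensors

/-! ### The moment map on representatives. -/

section MomentMap

lemma momentMap_mk (Z : Fin 3 → ℂ) (hZ : Z ≠ 0) (k : Fin 3) :
    momentMap (Projectivization.mk ℂ Z hZ) k = ‖Z k‖ ^ 2 / ∑ j, ‖Z j‖ ^ 2 := by
  obtain ⟨a, ha⟩ := Projectivization.exists_smul_eq_mk_rep ℂ Z hZ
  have ha0 : ‖(a : ℂ)‖ ^ 2 ≠ 0 := by simp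
  rw [momentMap, ← ha]
  have e : ∀ j, ‖(a • Z) j‖ ^ 2 = ‖(a : ℂ)‖ ^ 2 * ‖Z j‖ ^ 2 := fun j => by
    rw [Pi.smul_apply, Units.smul_def, smul_eq_mul, norm_mul, mul_pow]
  simp only [e]
  rw [← Finset.mul_sum, mul_div_mul_left _ _ ha0]

lemma momentMap_affinePoint (z : Fin 2 → ℂ) (k : Fin 3) : momentMap (affinePoint z) k =
    ‖(![z 0, z 1, 1] : Fin 3 → ℂ) k‖ ^ 2 / (‖z 0‖ ^ 2 + ‖z 1‖ ^ 2 + 1) := by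
  rw [affinePoint, momentMap_mk]
  simp [Fin.sum_univ_three]

lemma affinePoint_injective : Function.Injective affinePoint := by
  intro z w h
  rw [affinePoint, affinePoint, Projectivization.mk_eq_mk_iff'] at h
  obtain ⟨a, ha⟩ := h
  have h2 := congrFun ha 2
  have h0 := congrFun ha 0
  have h1 := congrFun ha 1
  simp at h0 h1 h2
  subst h2
  ext k
  fin_cases k
  · simpa using h0.symm
  · simpa using h1.symm

lemma normSq_param {x : Fin 4 → ℝ} (hx : x ∈ coordDomain) :
    ‖param x 0‖ ^ 2 = y 1 (x 0) (x 1) / y 3 (x 0) (x 1) ∧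
      ‖param x 1‖ ^ 2 = y 2 (x 0) (x 1) / y 3 (x 0) (x 1) := by
  have h1 := y_pos hx 1 (x 1)
  have h2 := y_pos hx 2 (x 1)
  have h3 := y_pos hx 3 (x 1)
  constructor <;>
  · simp only [param, Matrix.cons_val_zero, Matrix.cons_val_one, norm_mul,
      Complex.norm_exp_ofReal_mul_I, mul_one, Complex.norm_real, norm_eq_abs, sq_abs]
    exact sq_sqrt (by positivity)

lemma momentMap_point {x : Fin 4 → ℝ} (hx : x ∈ coordDomain) :
    momentMap (point x) 0 = y 1 (x 0) (x 1) ∧ momentMap (point x) 1 = y 2 (x 0) (x 1) ∧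
      momentMap (point x) 2 = y 3 (x 0) (x 1) := by
  obtain ⟨h1, h2⟩ := normSq_param hx
  have h3 := y_pos hx 3 (x 1)
  have h4 : y 1 (x 0) (x 1) / y 3 (x 0) (x 1) + y 2 (x 0) (x 1) / y 3 (x 0) (x 1) + 1 =
      1 / y 3 (x 0) (x 1) := by
    field_simp
    exact y_sum hx (x 1)
  refine ⟨?_, ?_, ?_⟩ <;> rw [point, momentMap_affinePoint] <;> simp [h1, h2] <;>
    rw [h4] <;> field_simp

end MomentMap

end HitchinCP2

namespace HitchinCP2

open Filter Topology

/-! ### The solution traverses each level set exactly once per period. -/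

section LevelSets

variable {c : ℝ}

lemma lt_lineQ (hc : c ∈ Ioo (0 : ℝ) (1 / 27)) (x : ℝ) : c < lineQ (halfPeriods c) x := by
  have h := isHalfPeriods_halfPeriods hc
  have h1 := h.lineY_sum hc.1 x
  have h2 := h.lineY_pos hc.1 (x + 2 * (halfPeriods c).1.1 / 3)
  have h3 := h.lineY_pos hc.1 (x - 2 * (halfPeriods c).1.1 / 3)
  have h4 : lineY c (halfPeriods c) x < 1 := by linarith
  rwa [lineY, div_lt_one (h.lineQ_pos hc.1 x)] at h4

/-- The roots of the cubic sum to 1/4, and its value −4c³ < 0 at c forces the third root below c.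
Beyond c the cubic is therefore nonnegative only between m and M. -/
lemma mem_Icc_of_cubic {c m M Q : ℝ} (hc : 0 < c) (hm : c < m) (hM : m < M) (hQ : c < Q)
    (h1 : (c - m) ^ 2 - 4 * m ^ 3 = 0) (h2 : (c - M) ^ 2 - 4 * M ^ 3 = 0)
    (h3 : 0 ≤ (c - Q) ^ 2 - 4 * Q ^ 3) : m ≤ Q ∧ Q ≤ M := by
  have hmM : m - M ≠ 0 := by linarith
  have e1 : -4 * (m ^ 2 + m * M + M ^ 2) + (m + M) - 2 * c = 0 := by
    apply mul_left_cancel₀ hmM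
    linear_combination h1 - h2
  have e2 : ∀ t, (c - t) ^ 2 - 4 * t ^ 3 = 4 * ((t - m) * (M - t)) * (t - (1 / 4 - m - M)) := by
    intro t
    linear_combination h1 + (t - m) * e1
  have h4 : 0 < c - (1 / 4 - m - M) := by
    have h5 := e2 c
    have h6 : (c - m) * (M - c) < 0 := mul_neg_of_neg_of_pos (by linarith) (by linarith)
    by_contra! h7
    have h8 := mul_nonneg_of_nonpos_of_nonpos (mul_neg_of_pos_of_neg four_pos h6).le h7
    have h9 : 0 < c ^ 3 := by positivity
    nlinarith
  rw [e2 Q] at h3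
  have h5 : 0 ≤ 4 * ((Q - m) * (M - Q)) := nonneg_of_mul_nonneg_left h3 (by linarith)
  constructor
  · by_contra! h6
    nlinarith [mul_pos (sub_pos.mpr h6) (show 0 < M - Q by linarith)]
  · by_contra! h6
    nlinarith [mul_pos (sub_pos.mpr h6) (show 0 < Q - m by linarith)]

lemma exists_lineQ_eq (hc : c ∈ Ioo (0 : ℝ) (1 / 27)) {Q : ℝ} (hQ : c < Q)
    (h : 0 ≤ (c - Q) ^ 2 - 4 * Q ^ 3) : ∃ x, lineQ (halfPeriods c) x = Q := by
  obtain ⟨a, ha, ha'⟩ := exists_lineQ_le (halfPeriods c)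
  obtain ⟨b, hb, hb'⟩ := exists_le_lineQ (halfPeriods c)
  have hp := isHalfPeriods_halfPeriods hc
  have h1 := hp.lineQ'_sq a
  have h2 := hp.lineQ'_sq b
  rw [ha', zero_pow two_ne_zero, eq_comm] at h1
  rw [hb', zero_pow two_ne_zero, eq_comm] at h2
  have hab : lineQ (halfPeriods c) a < lineQ (halfPeriods c) b := by
    by_contra! hle
    exact not_forall_lineQ_eq (halfPeriods c) (lineQ (halfPeriods c) a) fun x =>
      le_antisymm ((hb x).trans hle) (ha x)
  obtain ⟨h3, h4⟩ := mem_Icc_of_cubic hc.1 (lt_lineQ hc a) hab hQ h1 h2 h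
  exact mem_range_of_exists_le_of_exists_ge (continuous_lineQ _) ⟨a, h3⟩ ⟨b, h4⟩

/-- For Q = pq the cubic is the square (pq(p − q))², so Q is a value of q. The pair is then
recovered up to order, and x ↦ −x exchanges y¹ and y². -/
lemma exists_lvSol_eq {p q : ℝ} (hp : 0 < p) (hq : 0 < q) (hr : 0 < 1 - p - q)
    (hc : p * q * (1 - p - q) ∈ Ioo (0 : ℝ) (1 / 27)) :
    ∃ x, (lvSol (p * q * (1 - p - q)) x).1 = p ∧ (lvSol (p * q * (1 - p - q)) x).2.1 = q := by
  have hpq : 0 < p * q := mul_pos hp hq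
  obtain ⟨x, hx⟩ := exists_lineQ_eq hc (Q := p * q)
    (by nlinarith) (by
      have : (p * q * (1 - p - q) - p * q) ^ 2 - 4 * (p * q) ^ 3 = (p * q * (p - q)) ^ 2 := by ring
      rw [this]; positivity)
  have h := isHalfPeriods_halfPeriods hc
  generalize hc' : p * q * (1 - p - q) = c at *
  have h1 := h.lineY_mul hc.1 x
  have h2 := h.lineY_sum hc.1 x
  have h3 : lineY c (halfPeriods c) x = 1 - p - q := by
    rw [lineY, hx, ← hc']; field_simp
  have h4 : lineY c (halfPeriods c) (-x + 2 * (halfPeriods c).1.1 / 3) =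
      lineY c (halfPeriods c) (x - 2 * (halfPeriods c).1.1 / 3) := by
    rw [← lineY_neg]; congr 1; ring
  have h5 : lineY c (halfPeriods c) (-x - 2 * (halfPeriods c).1.1 / 3) =
      lineY c (halfPeriods c) (x + 2 * (halfPeriods c).1.1 / 3) := by
    rw [← lineY_neg]; congr 1; ring
  rw [hx] at h1
  rw [h3] at h2
  have h6 : (lineY c (halfPeriods c) (x + 2 * (halfPeriods c).1.1 / 3) - p) *
      (lineY c (halfPeriods c) (x + 2 * (halfPeriods c).1.1 / 3) - q) = 0 := by
    linear_combination lineY c (halfPeriods c) (x + 2 * (halfPeriods c).1.1 / 3) * h2 - h1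
  rcases mul_eq_zero.mp h6 with h7 | h7
  · exact ⟨x, by simp only [lvSol]; linarith, by simp only [lvSol]; linarith⟩
  · exact ⟨-x, by simp only [lvSol, h4]; linarith, by simp only [lvSol, h5]; linarith⟩

lemma exists_y_eq {p q : ℝ} (hp : 0 < p) (hq : 0 < q) (hr : 0 < 1 - p - q)
    (hc : p * q * (1 - p - q) ∈ Ioo (0 : ℝ) (1 / 27)) :
    ∃ s, y 1 (p * q * (1 - p - q)) s = p ∧ y 2 (p * q * (1 - p - q)) s = q := by
  obtain ⟨x, hx⟩ := exists_lvSol_eq hp hq hr hc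
  generalize p * q * (1 - p - q) = c at *
  refine ⟨π * x / omega1 c, ?_⟩
  have h : realTime (c, π * x / omega1 c) = x := by
    have := omega1_pos c
    rw [realTime]; field_simp
  rwa [y_one, y_two, h]

/-- The product y¹y² gives q, and y¹ then gives q'. Equal ℘ and ℘' put the difference of the two
points in the lattice, and real parts give the multiple of 2ω₁. -/
lemma exists_int_of_lvSol_eq (hc : c ∈ Ioo (0 : ℝ) (1 / 27)) {x x' : ℝ}
    (h1 : (lvSol c x).1 = (lvSol c x').1) (h2 : (lvSol c x).2.1 = (lvSol c x').2.1) :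
    ∃ n : ℤ, x = x' + n * (2 * omega1 c) := by
  have h := isHalfPeriods_halfPeriods hc
  have hQ : lineQ (halfPeriods c) x = lineQ (halfPeriods c) x' := by
    rw [← h.lineY_mul hc.1, ← h.lineY_mul hc.1]
    exact congrArg₂ (· * ·) h1 h2
  have hQ' : lineQ' (halfPeriods c) x = lineQ' (halfPeriods c) x' := by
    have h0 := h.lineQ_pos hc.1 x'
    have e1 : lineY c (halfPeriods c) (x + 2 * (halfPeriods c).1.1 / 3) =
      lineY c (halfPeriods c) (x' + 2 * (halfPeriods c).1.1 / 3) := h1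
    rw [h.lineY_add_third hc.1, h.lineY_add_third hc.1, hQ, div_left_inj' (by positivity)] at e1
    linarith
  have e1 := ofReal_lineQ (halfPeriods c) x
  have e2 := ofReal_lineQ' (halfPeriods c) x
  rw [hQ, ofReal_lineQ] at e1
  rw [hQ', ofReal_lineQ'] at e2
  have h3 := sub_mem_lattice_of_weierstrassP_eq (halfPeriods c).lattice
    (line_notMem_lattice _ x) (line_notMem_lattice _ x') (sub_right_injective e1).symm
    (neg_injective e2).symm
  obtain ⟨⟨n, hn⟩, -⟩ := (mem_rect_lattice _).mp h3
  refine ⟨n, ?_⟩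
  simp at hn
  rw [omega1]
  linarith

lemma y_add_int_mul (k : ℕ) (c s : ℝ) (n : ℤ) : y k c (s + n * (2 * π)) = y k c s := by
  rw [y_eq, y_eq, ← (lineY_periodic c (halfPeriods c)).int_mul n
    (realTime (c, s) + k * (2 * (halfPeriods c).1.1 / 3))]
  congr 1
  rw [realTime, realTime, omega1]
  field_simp
  ring

lemma exists_int_of_y_eq (hc : c ∈ Ioo (0 : ℝ) (1 / 27)) {s s' : ℝ}
    (h1 : y 1 c s = y 1 c s') (h2 : y 2 c s = y 2 c s') : ∃ n : ℤ, s = s' + n * (2 * π) := by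
  rw [y_one, y_one] at h1
  rw [y_two, y_two] at h2
  obtain ⟨n, hn⟩ := exists_int_of_lvSol_eq hc h1 h2
  refine ⟨n, ?_⟩
  have := omega1_pos c
  simp only [realTime] at hn
  field_simp at hn
  linarith

end LevelSets

/-! ### Range of the coordinates and their ambiguity modulo 2π. -/

section Points

lemma exp_mul_I_eq_iff {a b : ℝ} : Complex.exp (a * Complex.I) = Complex.exp (b * Complex.I) ↔
    ∃ n : ℤ, a = b + n * (2 * π) := by
  rw [Complex.exp_eq_exp_iff_exists_int]
  refine exists_congr fun n => ?_
  rw [show (b : ℂ) * Complex.I + n * (2 * π * Complex.I) =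
    ((b + n * (2 * π) : ℝ) : ℂ) * Complex.I by push_cast; ring,
    mul_left_inj' Complex.I_ne_zero, Complex.ofReal_inj]

lemma sqrt_div_ne_zero {a b : ℝ} (ha : 0 < a) (hb : 0 < b) : (√(a / b) : ℂ) ≠ 0 := by
  have : √(a / b) ≠ 0 := (Real.sqrt_pos.mpr (div_pos ha hb)).ne'
  exact_mod_cast this

/-- The moment map recovers c and hence s modulo 2π. The moduli of z₁, z₂ then agree and cancel,
leaving the phases to be compared. -/
lemma point_eq_iff {x x' : Fin 4 → ℝ} (hx : x ∈ coordDomain) (hx' : x' ∈ coordDomain) :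
    point x = point x' ↔
      x 0 = x' 0 ∧ ∀ a : Fin 4, a ≠ 0 → ∃ n : ℤ, x a = x' a + n * (2 * π) := by
  constructor
  · intro h
    obtain ⟨h1, h2, h3⟩ := momentMap_point hx
    obtain ⟨h1', h2', h3'⟩ := momentMap_point hx'
    rw [h] at h1 h2 h3
    have e1 := h1.symm.trans h1'
    have e2 := h2.symm.trans h2'
    have e3 := h3.symm.trans h3'
    have e0 : x 0 = x' 0 := by
      rw [← y_prod hx (x 1), ← y_prod hx' (x' 1), e1, e2, e3]
    have hp := affinePoint_injective h
    have hp0 := congrFun hp 0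
    have hp1 := congrFun hp 1
    simp only [param, Matrix.cons_val_zero, Matrix.cons_val_one, e1, e2, e3] at hp0 hp1
    have h3 := y_pos hx' 3 (x' 1)
    refine ⟨e0, fun a ha => ?_⟩
    fin_cases a
    · exact absurd rfl ha
    · rw [e0] at e1 e2
      exact exists_int_of_y_eq hx' e1 e2
    · exact exp_mul_I_eq_iff.mp (mul_left_cancel₀ (sqrt_div_ne_zero (y_pos hx' 1 _) h3) hp0)
    · exact exp_mul_I_eq_iff.mp (mul_left_cancel₀ (sqrt_div_ne_zero (y_pos hx' 2 _) h3) hp1)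
  · rintro ⟨h0, h⟩
    obtain ⟨n, hn⟩ := h 1 (by decide)
    have h2 := exp_mul_I_eq_iff.mpr (h 2 (by decide))
    have h3 := exp_mul_I_eq_iff.mpr (h 3 (by decide))
    rw [point, point, param, param, h0, hn, h2, h3]
    simp only [y_add_int_mul]

lemma sum_momentMap (p : CP2) : momentMap p 0 + momentMap p 1 + momentMap p 2 = 1 := by
  have h : (∑ j, ‖p.rep j‖ ^ 2) ≠ 0 := by
    intro h
    rw [Finset.sum_eq_zero_iff_of_nonneg fun _ _ => by positivity] at h
    exact p.rep_nonzero (funext fun j => by simpa using h j (Finset.mem_univ j))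
  simp only [momentMap, ← add_div]
  rw [← Fin.sum_univ_three fun j => ‖p.rep j‖ ^ 2, div_self h]

lemma momentMap_nonneg (p : CP2) (k : Fin 3) : 0 ≤ momentMap p k := by
  rw [momentMap]; positivity

lemma exists_affinePoint_eq {p : CP2} (h : momentMap p 2 ≠ 0) : ∃ z, p = affinePoint z := by
  have h2 : p.rep 2 ≠ 0 := fun h0 => h (by simp [momentMap, h0])
  refine ⟨![p.rep 0 / p.rep 2, p.rep 1 / p.rep 2], ?_⟩
  conv_lhs => rw [← p.mk_rep]
  rw [affinePoint, Projectivization.mk_eq_mk_iff']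
  refine ⟨p.rep 2, ?_⟩
  ext k
  fin_cases k
  · simp [mul_div_cancel₀ _ h2]
  · simp [mul_div_cancel₀ _ h2]
  · simp

/-- A nonzero product of moments puts the point in the affine chart. The level set gives s, and the
arguments of z₁, z₂ serve as θ₁, θ₂. -/
lemma image_point : point '' coordDomain =
    {p : CP2 | (∏ k, momentMap p k) ∈ Ioo (0 : ℝ) (1 / 27)} := by
  ext p
  simp only [mem_image, Set.mem_ofPred_eq, Fin.prod_univ_three]
  constructor
  · rintro ⟨x, hx, rfl⟩
    obtain ⟨h1, h2, h3⟩ := momentMap_point hx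
    rw [h1, h2, h3, y_prod hx]
    exact hx
  · intro hp
    have n0 := momentMap_nonneg p 0
    have n1 := momentMap_nonneg p 1
    have n2 := momentMap_nonneg p 2
    have hsum := sum_momentMap p
    have hne := hp.1.ne'
    rw [mul_ne_zero_iff, mul_ne_zero_iff] at hne
    obtain ⟨⟨i0, i1⟩, i2⟩ := hne
    have e2 : momentMap p 2 = 1 - momentMap p 0 - momentMap p 1 := by linarith
    rw [e2] at hp
    obtain ⟨s, h1, h2⟩ := exists_y_eq (n0.lt_of_ne' i0) (n1.lt_of_ne' i1)
      (e2 ▸ n2.lt_of_ne' i2) hp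
    obtain ⟨z, rfl⟩ := exists_affinePoint_eq i2
    set c := momentMap (affinePoint z) 0 * momentMap (affinePoint z) 1 *
      (1 - momentMap (affinePoint z) 0 - momentMap (affinePoint z) 1) with hc
    have h3 : y 3 c s = momentMap (affinePoint z) 2 := by rw [y_three_eq hp, h1, h2, e2]
    refine ⟨![c, s, (z 0).arg, (z 1).arg], hp, ?_⟩
    rw [point]
    congr 1
    have hS : 0 < ‖z 0‖ ^ 2 + ‖z 1‖ ^ 2 + 1 := by positivity
    have hk : ∀ w : ℂ, (√(‖w‖ ^ 2 / (‖z 0‖ ^ 2 + ‖z 1‖ ^ 2 + 1) /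
        (1 / (‖z 0‖ ^ 2 + ‖z 1‖ ^ 2 + 1))) : ℂ) * Complex.exp (w.arg * Complex.I) = w := by
      intro w
      rw [div_div_div_cancel_right₀ hS.ne', div_one, sqrt_sq (norm_nonneg w)]
      exact Complex.norm_mul_exp_arg_mul_I w
    have m0 := momentMap_affinePoint z 0
    have m1 := momentMap_affinePoint z 1
    have m2 := momentMap_affinePoint z 2
    simp at m0 m1 m2
    rw [← one_div] at m2
    ext k
    fin_cases k
    · show (√(y 1 c s / y 3 c s) : ℂ) * Complex.exp ((z 0).arg * Complex.I) = z 0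
      rw [h1, h3, m0, m2, hk]
    · show (√(y 2 c s / y 3 c s) : ℂ) * Complex.exp ((z 1).arg * Complex.I) = z 1
      rw [h2, h3, m1, m2, hk]

end Points

end HitchinCP2

open HitchinCP2 in
theorem mainTheorem6 :
    -- the half-periods are well defined, and `y^k` and `ς` are real
    (∀ c ∈ Ioo (0 : ℝ) (1 / 27),
      (∀ p : HalfPeriods, IsHalfPeriods c p ↔ p = halfPeriods c) ∧
      ∀ s : ℝ, (∀ k ∈ ({1, 2, 3} : Set ℕ), yC k c s = (y k c s : ℂ) ∧ 0 < y k c s) ∧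
        y 1 c s + y 2 c s + y 3 c s = 1 ∧ y 1 c s * y 2 c s * y 3 c s = c ∧
        varsigmaC c s = (varsigma c s : ℂ)) ∧
    -- `(c₃, s, θ₁, θ₂)` are local coordinates on `CP2`, with `s, θ₁, θ₂` defined modulo `2π`
    IsLocalDiffeomorphOn 𝓘(ℝ, Fin 4 → ℝ) 𝓘(ℝ, Fin 2 → ℂ) ∞ param coordDomain ∧
    (∀ x ∈ coordDomain, momentMap (point x) 0 = y 1 (x 0) (x 1) ∧
      momentMap (point x) 1 = y 2 (x 0) (x 1) ∧ momentMap (point x) 2 = y 3 (x 0) (x 1)) ∧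
    point '' coordDomain = {p : CP2 | (∏ k, momentMap p k) ∈ Ioo (0 : ℝ) (1 / 27)} ∧
    (∀ x ∈ coordDomain, ∀ x' ∈ coordDomain, point x = point x' ↔
      x 0 = x' 0 ∧ ∀ a : Fin 4, a ≠ 0 → ∃ n : ℤ, x a = x' a + n * (2 * π)) ∧
    -- the Hitchin Poisson tensor
    (∀ x ∈ coordDomain, ∀ α β : (Fin 2 → ℂ) →L[ℝ] ℝ,
      hitchinQ (param x) α β =
        4 * x 0 * π / omega1 (x 0) *
            wedge (dd 0) (dd 1) (α.comp (fderiv ℝ param x)) (β.comp (fderiv ℝ param x)) -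
          wedge (dd 2) (dd 3) (α.comp (fderiv ℝ param x)) (β.comp (fderiv ℝ param x))) ∧
    -- the standard complex structure
    (∀ c s θ₁ θ₂ : ℝ, c ∈ Ioo (0 : ℝ) (1 / 27) →
      -- `⟨dθ_i, J ∂_s⟩`
      J ![c, s, θ₁, θ₂] 2 1 = omega1 c / (2 * π) * (3 * y 2 c s - 1) ∧
      J ![c, s, θ₁, θ₂] 3 1 = omega1 c / (2 * π) * (1 - 3 * y 1 c s) ∧
      -- `⟨dc₃, J ∂_{θ_i}⟩`
      J ![c, s, θ₁, θ₂] 0 2 = 4 * π * c / omega1 c * -J ![c, s, θ₁, θ₂] 3 1 ∧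
      J ![c, s, θ₁, θ₂] 0 3 = 4 * π * c / omega1 c * J ![c, s, θ₁, θ₂] 2 1 ∧
      -- `⟨dθ_i, J ∂_{c₃}⟩`
      J ![c, s, θ₁, θ₂] 2 0 = 1 / (4 * c * (1 - 27 * c)) *
        (1 + 3 * y 2 c s - 18 * y 1 c s * y 2 c s - 6 * varsigma c s * (1 - 3 * y 2 c s)) ∧
      J ![c, s, θ₁, θ₂] 3 0 = 1 / (4 * c * (1 - 27 * c)) *
        (1 + 3 * y 1 c s - 18 * y 1 c s * y 2 c s + 6 * varsigma c s * (1 - 3 * y 1 c s)) ∧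
      -- `⟨ds, J ∂_{θ_i}⟩`
      J ![c, s, θ₁, θ₂] 1 2 = 4 * c * π / omega1 c * J ![c, s, θ₁, θ₂] 3 0 ∧
      J ![c, s, θ₁, θ₂] 1 3 = 4 * c * π / omega1 c * -J ![c, s, θ₁, θ₂] 2 0 ∧
      -- the remaining components vanish
      (∀ a ∈ ({0, 1} : Set (Fin 4)), ∀ b ∈ ({0, 1} : Set (Fin 4)), J ![c, s, θ₁, θ₂] a b = 0) ∧
      (∀ a ∈ ({2, 3} : Set (Fin 4)), ∀ b ∈ ({2, 3} : Set (Fin 4)), J ![c, s, θ₁, θ₂] a b = 0)) ∧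
    -- the Jacobian `∂(c₃, s) / ∂(y¹, y²)` of the inverse coordinate change
    (∀ q : ℝ × ℝ, q.1 ∈ Ioo (0 : ℝ) (1 / 27) →
      ∃ e : OpenPartialHomeomorph (ℝ × ℝ) (ℝ × ℝ),
        q ∈ e.source ∧ e.source ⊆ {r | r.1 ∈ Ioo (0 : ℝ) (1 / 27)} ∧
        (∀ r ∈ e.source, e r = (y 1 r.1 r.2, y 2 r.1 r.2)) ∧
        ContDiffOn ℝ ∞ e e.source ∧ ContDiffOn ℝ ∞ e.symm e.target ∧
        ∀ v ∈ e.target, (fderiv ℝ e.symm v).det = π / omega1 (e.symm v).1) := by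
  refine ⟨fun c hc => ⟨isHalfPeriods_iff_eq hc, fun s => ⟨fun k _ => ⟨?_, y_pos hc k s⟩,
    y_sum hc s, y_prod hc s, ?_⟩⟩, isLocalDiffeomorphOn_param, fun x hx => momentMap_point hx,
    image_point, fun x hx x' hx' => point_eq_iff hx hx', fun x hx => hitchinQ_eq hx,
    fun c s θ₁ θ₂ hc => complexStructure_formulas s θ₁ θ₂ hc, fun q hq => exists_chart_yMap hq⟩
  · rw [y_eq, yC_eq]
  · rw [varsigma_eq, varsigmaC_eq]
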